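/- Let $n\ge 1$, $m_1\ge n$, $m_2\ge n$ be integers and put $\alpha_1=m_1-n$, $\alpha_2=m_2-n$. Let $\mathbf\Sigma$ be an $n\times n$ Hermitian positive definite matrix, and let $\mathbf X_1\in\mathbb C^{m_1\times n}$ and $\mathbf X_2\in\mathbb C^{m_2\times n}$ be independent random matrices, each with independent rows $x^\dagger$, where $x$ is a centred circularly symmetric complex Gaussian vector in $\mathbb C^n$ with covariance $\mathbb E[xx^\dagger]=\mathbf\Sigma$, i.e. with density $\pi^{-n}\det(\mathbf\Sigma)^{-1}e^{-x^\dagger\mathbf\Sigma^{-1}x}$. Let $\mathbf W_1=\mathbf X_1^\dagger\mathbf X_1$ and $\mathbf W_2=\mathbf X_2^\dagger\mathbf X_2$ (complex central Wishart matrices), and let $\phi_1$ and $\phi_n$ be the largest and the smallest eigenvalue of $$\mathbf W=(\mathbf W_1+\mathbf W_2)^{-1}\mathbf W_1,$$ whose eigenvalues are almost surely real. Let $P_l(x)=\sum_{k=0}^{l}\binom lk\binom{l+k}k\left(\frac{x-1}2\right)^k$ be the Legendre polynomial of degree $l$. For integers $\alpha,\beta\ge 0$ and $\gamma\in\{\alpha,\beta\}$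 let $\mathbf E_\gamma(y)$ be the $(\alpha+\beta)\times\gamma$ matrix with entries $$[\mathbf E_\gamma(y)]_{ij}=\frac{d^{\,j-1}}{dy^{\,j-1}}P_{n+i-1}(y),\qquad 1\le i\le\alpha+\beta,\ 1\le j\le\gamma,$$ and for $0\le\xi<1$ define $$g_{\alpha,\beta}(\xi)=1-(1-\xi)^{n^2+n\alpha+n\beta+\alpha\beta}\;\frac{\det\left[\mathbf E_\alpha\left(-\frac{1+\xi}{1-\xi}\right)\ \ \mathbf E_\beta(1)\right]}{\det\left[\mathbf E_\alpha(-1)\ \ \mathbf E_\beta(1)\right]},$$ where a determinant of size $0$ is $1$. Then the cumulative distribution functions of $\phi_n$ and $\phi_1$ are $$F_{\phi_n}(\xi)=g_{\alpha_1,\alpha_2}(\xi)\quad(0\le\xi<1),\qquad F_{\phi_1}(\xi)=1-g_{\alpha_2,\alpha_1}(1-\xi)\quad(0<\xi\le 1).$$ -/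

import Mathlib

open MeasureTheory ProbabilityTheory Polynomial Matrix
open scoped ComplexOrder

noncomputable section

/-- The Legendre polynomial `P_l(x) = ∑_{k=0}^{l} (l choose k) (l+k choose k) ((x-1)/2)^k`. -/
def legendrePoly (l : ℕ) : ℝ[X] :=
  ∑ k ∈ Finset.range (l + 1),
    C ((l.choose k : ℝ) * ((l + k).choose k : ℝ)) * (C (1 / 2 : ℝ) * (X - 1)) ^ k

/-- The `N × γ` matrix `E_γ(y)` whose entry in (zero-based) row `i` and column `j` is the
`j`-th derivative of `P_{n+i}` at `y`. -/
def legendreE (n N γ : ℕ) (y : ℝ) : Matrix (Fin N) (Fin γ) ℝ :=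
  Matrix.of fun i j => (derivative^[(j : ℕ)] (legendrePoly (n + i))).eval y

/-- `det [E_α(y)  E_β(z)]`, a determinant of size `α + β`. -/
def legendreDet (n α β : ℕ) (y z : ℝ) : ℝ :=
  ((Matrix.fromCols (legendreE n (α + β) α y) (legendreE n (α + β) β z)).submatrix
    id finSumFinEquiv.symm).det

/-- The function `g_{α,β}(ξ)`. -/
def legendreG (n α β : ℕ) (ξ : ℝ) : ℝ :=
  1 - (1 - ξ) ^ (n ^ 2 + n * α + n * β + α * β) *
    (legendreDet n α β (-((1 + ξ) / (1 - ξ))) 1 / legendreDet n α β (-1) 1)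

/-- The centred circularly symmetric complex Gaussian distribution on `ℂⁿ` with (positive
definite) covariance matrix `S = E[x x†]`: density `exp(-x† S⁻¹ x) / (πⁿ det S)`. -/
def complexGaussian {n : ℕ} (S : Matrix (Fin n) (Fin n) ℂ) : Measure (Fin n → ℂ) :=
  volume.withDensity fun x =>
    ENNReal.ofReal (Real.exp (-(star x ⬝ᵥ (S⁻¹ *ᵥ x)).re) / (Real.pi ^ n * S.det.re))

/-- `X` is a random `m × n` complex Gaussian matrix with covariance `S`: its rows `x_1†, …, x_m†`
are independent and each `x_k` is a centred complex Gaussian vector with covariance `S`, so that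
`X† X = ∑ k, x_k x_k†` is a complex Wishart matrix with `m` degrees of freedom and covariance
`S`. -/
structure IsComplexGaussianMatrix {Ω : Type*} [MeasurableSpace Ω] {m n : ℕ}
    (X : Ω → Matrix (Fin m) (Fin n) ℂ) (S : Matrix (Fin n) (Fin n) ℂ) (P : Measure Ω) :
    Prop where
  law_row : ∀ k, HasLaw (fun ω => star (X ω k)) (complexGaussian S) P
  indep_rows : iIndepFun (fun k ω => X ω k) P

/-- The matrix `(W₁ + W₂)⁻¹ W₁` with `W₁ = X₁† X₁` and `W₂ = X₂† X₂`. -/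
def doubleWishart {m₁ m₂ n : ℕ} (X₁ : Matrix (Fin m₁) (Fin n) ℂ)
    (X₂ : Matrix (Fin m₂) (Fin n) ℂ) : Matrix (Fin n) (Fin n) ℂ :=
  (X₁ᴴ * X₁ + X₂ᴴ * X₂)⁻¹ * (X₁ᴴ * X₁)

/-- The smallest eigenvalue of a square matrix all of whose eigenvalues are real. -/
def smallestEigenvalue {n : ℕ} (A : Matrix (Fin n) (Fin n) ℂ) : ℝ :=
  sInf {x : ℝ | (x : ℂ) ∈ spectrum ℂ A}

/-- The largest eigenvalue of a square matrix all of whose eigenvalues are real. -/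
def largestEigenvalue {n : ℕ} (A : Matrix (Fin n) (Fin n) ℂ) : ℝ :=
  sSup {x : ℝ | (x : ℂ) ∈ spectrum ℂ A}

end

noncomputable section

/-! ### Orthogonality of the Legendre polynomials -/

/-! Write `V` for the Vandermonde determinant. The eigenvalues are the roots of `z ↦ det ((z - 1) W₁
+ z W₂) = det (z (W₁ + W₂) - W₁)`. If `S⁻¹ = Aᴴ A`, whitening the rows with `A` multiplies every
`det (p W₁ + q W₂)` by `|det A|²` and so keeps the roots; after whitening, the `n` columns of the
two stacked matrices are independent standard Gaussian vectors in `ℂ^(m₁+m₂)` (`hasLaw_whitened`,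
`pencilDet_whitened`).

The law of the roots is found by adding one column at a time. If `k` columns have roots `φ`, the
Schur complement, written in coordinates adapted to the pencil, shows that the ratio of the new
determinant to the old one, divided by `z (z - 1)`, is `w₀ / z + w_last / (z - 1) + ∑ w_i / (z -
φ_i)`, where the `w`'s are independent Gamma variables (`HasRoots.exists_isometry_pencilDet_cons`,
`map_blockNormSq`). The new roots `μ` are the zeros of this function, and they interlace the poles
`a = (0, φ, 1)`. Passing from the residues to their sum `s` and the zeros `μ` is a bijection with
Jacobian `s^(k+1) V(μ) / V(a)` up to sign, and the density splits into a function of `s` times a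
function of `μ` (`abs_det_residueJacobian`, `residue_density`). Integrating out the old roots needs
only the integral of `V(φ)` over the box interlacing `μ`, which is `V(μ) / k!`. By induction the
ordered roots have density proportional to `V(φ)² ∏ φ_i^(m₁-n) (1 - φ_i)^(m₂-n)`
(`exists_lintegral_roots`).

Andréief's identity turns the tail of the smallest root into the Hankel determinant of `t^α (1 -
t)^β` on `[ξ, 1]`. An affine substitution moves it to the weight `(x - y)^α (x - 1)^β` on `[-1, 1]`,
with `y = -(1 + ξ) / (1 - ξ)`. For Legendre polynomials to appear, take the linear functionals
"moments of order below `n`, derivatives at `y` of order below `α`, derivatives at `1` of order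
below `β`" and evaluate their determinant in two bases: in the Legendre basis orthogonality isolates
`legendreDet`, in a Newton basis the Hankel determinant remains (`exists_legendreDet_eq`). Constants
are never computed: they cancel in the quotient by the value at `ξ = 0`, where the probability is
one.

The largest eigenvalue follows by exchanging the two matrices, which replaces each root by one minus
itself. -/

theorem legendrePoly_eval (l : ℕ) (x : ℝ) :
    (legendrePoly l).eval x = aeval ((1 - x) / 2) (shiftedLegendre l) := by
  simp only [legendrePoly, shiftedLegendre, eval_finsetSum, map_sum]
  refine Finset.sum_congr rfl fun k _ => ?_
  simp only [eval_mul, eval_C, eval_pow, eval_sub, eval_X, eval_one, map_mul, map_pow, aeval_X,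
    aeval_C]
  have h : (1 / 2 * (x - 1)) = (-1) * ((1 - x) / 2) := by ring
  rw [h, mul_pow, Nat.choose_symm_add (a := l) (b := k)]
  simp
  ring

theorem legendrePoly_natDegree_le (l : ℕ) : (legendrePoly l).natDegree ≤ l := by
  refine natDegree_sum_le_of_forall_le _ _ fun k hk => ?_
  refine (natDegree_C_mul_le _ _).trans (natDegree_pow_le.trans ?_)
  have h1 : (C (1 / 2 : ℝ) * (X - 1)).natDegree ≤ 1 :=
    (natDegree_C_mul_le _ _).trans (by rw [← C_1]; exact natDegree_X_sub_C_le _)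
  have hk' := Finset.mem_range.1 hk
  calc k * _ ≤ k * 1 := Nat.mul_le_mul_left _ h1
    _ ≤ l := by omega

theorem legendrePoly_coeff_ne_zero (l : ℕ) : (legendrePoly l).coeff l ≠ 0 := by
  have h : (legendrePoly l).coeff l
      = ((2 * l).choose l : ℝ) * (1 / 2) ^ l := by
    -- Only `k ≤ l` occurs in the sum; the last branch is a tautology that lets the claim be stated
    -- for all `k`.
    have hk : ∀ k, ((C (1 / 2 : ℝ) * (X - 1)) ^ k).coeff l = if k = l then (1 / 2) ^ l else
        if k < l then 0 else ((C (1 / 2 : ℝ) * (X - 1)) ^ k).coeff l := by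
      intro k
      split_ifs with h1 h2
      · subst h1
        rw [mul_pow, ← C_pow, coeff_C_mul, ← C_1]
        have := ((monic_X_sub_C (1 : ℝ)).pow k).coeff_natDegree
        rw [(monic_X_sub_C (1 : ℝ)).natDegree_pow, natDegree_X_sub_C, mul_one] at this
        rw [this, mul_one]
      · refine coeff_eq_zero_of_natDegree_lt ?_
        rw [mul_pow, ← C_pow, ← C_1]
        refine (natDegree_C_mul_le _ _).trans_lt ?_
        rwa [(monic_X_sub_C (1 : ℝ)).natDegree_pow, natDegree_X_sub_C, mul_one]
      · rfl
    rw [legendrePoly, finsetSum_coeff, Finset.sum_range_succ, Finset.sum_eq_zero]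
    · rw [coeff_C_mul, hk, if_pos rfl]
      simp [two_mul]
    · intro k hk'
      rw [coeff_C_mul, hk, if_neg (Finset.mem_range.1 hk').ne, if_pos (Finset.mem_range.1 hk'),
        mul_zero]
  rw [h]
  have := Nat.choose_pos (show l ≤ 2 * l by omega)
  positivity

/-- Repeated integration by parts: the boundary terms vanish because `w` vanishes to order `l` at
both ends, and each step lowers the degree bound on `q`, until `q = 0`. -/
theorem integral_iterate_derivative_mul_eq_zero (w : ℝ[X]) (l : ℕ)
    (h0 : ∀ i < l, (derivative^[i] w).eval 0 = 0) (h1 : ∀ i < l, (derivative^[i] w).eval 1 = 0) :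
    ∀ i ≤ l, ∀ q : ℝ[X], q.degree < i →
      ∫ x in (0 : ℝ)..1, (derivative^[i] w).eval x * q.eval x = 0 := by
  intro i
  induction i with
  | zero =>
    intro _ q hq
    have : q = 0 := by
      rw [← degree_eq_bot]
      exact Nat.WithBot.lt_zero_iff.1 (by simpa using hq)
    simp [this]
  | succ i ih =>
    intro hi q hq
    have hibp := intervalIntegral.integral_deriv_mul_eq_sub
      (u := fun x => (derivative^[i] w).eval x) (v := fun x => q.eval x)
      (u' := fun x => (derivative (derivative^[i] w)).eval x)
      (v' := fun x => (derivative q).eval x) (a := 0) (b := 1)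
      (fun x _ => (derivative^[i] w).hasDerivAt x) (fun x _ => q.hasDerivAt x)
      ((Polynomial.continuous _).intervalIntegrable _ _)
      ((Polynomial.continuous _).intervalIntegrable _ _)
    rw [intervalIntegral.integral_add
      (Continuous.intervalIntegrable (by fun_prop) _ _)
      (Continuous.intervalIntegrable (by fun_prop) _ _)] at hibp
    have hd : (derivative q).degree < i := by
      by_cases hq0 : q = 0
      · simp [hq0]
      · have h2 := degree_derivative_lt hq0
        rw [degree_eq_natDegree hq0] at hq h2
        have : q.natDegree < i + 1 := by exact_mod_cast hq
        exact h2.trans_le (by exact_mod_cast Nat.lt_succ_iff.1 this)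
    rw [ih (by omega) _ hd, h0 i (by omega), h1 i (by omega)] at hibp
    rw [Function.iterate_succ_apply']
    simpa using hibp

/-- Rodrigues' formula: `l!` times the shifted Legendre polynomial is the `l`-th derivative of `x^l
(1 - x)^l`, which vanishes to order `l` at `0` and `1`. -/
theorem integral_shiftedLegendre_mul_eq_zero (l : ℕ) (q : ℝ[X]) (hq : q.degree < l) :
    ∫ x in (0 : ℝ)..1, aeval x (shiftedLegendre l) * q.eval x = 0 := by
  set w : ℝ[X] := X ^ l * (1 - X) ^ l with hw
  have hR : ∀ x : ℝ, (l.factorial : ℝ) * aeval x (shiftedLegendre l)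
      = (derivative^[l] w).eval x := by
    intro x
    have h := congrArg (aeval x) (factorial_mul_shiftedLegendre_eq l)
    rw [map_mul] at h
    simp only [map_natCast] at h
    rw [h]
    have h2 : w = (X ^ l * (1 - (X : ℤ[X])) ^ l).map (Int.castRingHom ℝ) := by simp [hw]
    rw [h2, iterate_derivative_map, eval_map, aeval_def, ← algebraMap_int_eq]
  have hz : ∀ a : ℝ, (X - C a) ^ l ∣ w → ∀ i < l, (derivative^[i] w).eval a = 0 := by
    intro a ha i hi
    have h := pow_sub_dvd_iterate_derivative_of_pow_dvd i ha
    obtain ⟨r, hr⟩ := h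
    rw [hr]
    simp [eval_mul, zero_pow (by omega : l - i ≠ 0)]
  have hI := integral_iterate_derivative_mul_eq_zero w l
    (hz 0 (by rw [hw]; simp))
    (hz 1 ⟨(-1) ^ l * X ^ l, by
      rw [hw, show (1 - X : ℝ[X]) = (X - C 1) * (-1) by rw [C_1]; ring, mul_pow]; ring⟩)
    l le_rfl q hq
  have : ∫ x in (0 : ℝ)..1, (l.factorial : ℝ) * (aeval x (shiftedLegendre l) * q.eval x) = 0 := by
    simpa only [← hR, mul_assoc] using hI
  rw [intervalIntegral.integral_const_mul] at this
  exact (mul_eq_zero.1 this).resolve_left (by positivity)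

/-- The Legendre polynomial of degree `l` is orthogonal on `[-1, 1]` to all polynomials of
smaller degree. -/
theorem integral_legendrePoly_mul_eq_zero (l : ℕ) (q : ℝ[X]) (hq : q.degree < l) :
    ∫ x in (-1 : ℝ)..1, (legendrePoly l).eval x * q.eval x = 0 := by
  have h := integral_shiftedLegendre_mul_eq_zero l (q.comp (1 - C 2 * X)) (by
    refine lt_of_le_of_lt ?_ hq
    by_cases hq0 : q = 0
    · simp [hq0]
    · rw [degree_eq_natDegree hq0]
      refine natDegree_le_iff_degree_le.1 (natDegree_comp_le.trans ?_)
      have : (1 - C 2 * X : ℝ[X]).natDegree ≤ 1 := by compute_degree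
      calc _ ≤ q.natDegree * 1 := Nat.mul_le_mul_left _ this
        _ = _ := mul_one _)
  have h2 := intervalIntegral.integral_comp_sub_div
    (fun u => aeval u (shiftedLegendre l) * (q.comp (1 - C 2 * X)).eval u)
    (a := -1) (b := 1) (c := 2) (by norm_num) (1 / 2)
  norm_num at h2
  have h3 : ∫ x in (-1 : ℝ)..1, (legendrePoly l).eval x * q.eval x
      = ∫ x in (-1 : ℝ)..1, aeval (1 / 2 - x / 2) (shiftedLegendre l) *
        eval (1 - 2 * (1 / 2 - x / 2)) q := by
    refine intervalIntegral.integral_congr fun x _ => ?_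
    simp only [legendrePoly_eval]
    rw [show (1 - x) / 2 = 1 / 2 - x / 2 by ring, show 1 - 2 * (1 / 2 - x / 2) = x by ring]
  rw [h3, h2]
  simp only [eval_comp, eval_sub, eval_one, eval_mul, eval_C, eval_X] at h
  rw [h, mul_zero]

/-! ### Determinants of linear functionals on polynomials -/

/-- Passing from the monomials to a family of polynomials of degrees `0, 1, 2, …` multiplies a
determinant of linear functionals by the product of the leading coefficients. -/
theorem det_functional_eq {m : ℕ} {ρ : Type*} [Fintype ρ] [DecidableEq ρ] (e : ρ ≃ Fin m)
    (ℓ : ρ → ℝ[X] →ₗ[ℝ] ℝ) (p : ρ → ℝ[X]) (hp : ∀ r, (p r).natDegree ≤ e r) :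
    (Matrix.of fun r c => ℓ c (p r)).det =
      (∏ r, (p r).coeff (e r)) *
        (Matrix.of fun k c : Fin m => ℓ (e.symm c) (X ^ (k : ℕ))).det := by
  have h1 : (Matrix.of fun r c => ℓ c (p r)).det
      = (Matrix.of fun r c : Fin m => ℓ (e.symm c) (p (e.symm r))).det := by
    rw [← Matrix.det_reindex_self e]
    rfl
  have h2 : (Matrix.of fun r c : Fin m => ℓ (e.symm c) (p (e.symm r)))
      = (Matrix.of fun r k : Fin m => (p (e.symm r)).coeff k) *
        (Matrix.of fun k c : Fin m => ℓ (e.symm c) (X ^ (k : ℕ))) := by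
    ext r c
    simp only [Matrix.of_apply, Matrix.mul_apply]
    have hd : (p (e.symm r)).natDegree < m := by
      have := hp (e.symm r)
      rw [e.apply_symm_apply] at this
      omega
    conv_lhs => rw [(p (e.symm r)).as_sum_range' m hd]
    rw [map_sum, Finset.sum_range]
    refine Finset.sum_congr rfl fun k _ => ?_
    rw [← smul_X_eq_monomial, map_smul, smul_eq_mul]
  rw [h1, h2, Matrix.det_mul]
  congr 1
  rw [Matrix.det_of_isLowerTriangular]
  · rw [← e.prod_comp]
    simp
  · intro i j hij
    have hij' : i < j := hij
    refine coeff_eq_zero_of_natDegree_lt ((hp _).trans_lt ?_)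
    rw [e.apply_symm_apply]
    exact hij'

/-- Reordering the functionals changes the determinant by a sign. -/
theorem det_functional_reorder {m : ℕ} {ρ ρ' : Type*} (e : ρ ≃ Fin m) (e' : ρ' ≃ Fin m)
    (σ : ρ' ≃ ρ) (ℓ : ρ → ℝ[X] →ₗ[ℝ] ℝ) :
    (Matrix.of fun k c : Fin m => ℓ (σ (e'.symm c)) (X ^ (k : ℕ))).det =
      Equiv.Perm.sign ((e'.symm.trans σ).trans e) *
        (Matrix.of fun k c : Fin m => ℓ (e.symm c) (X ^ (k : ℕ))).det := by
  rw [← Matrix.det_permute']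
  congr 1
  ext k c
  simp

/-- Evaluation of the `j`-th derivative at `a`, as a linear functional. -/
def derivEval (j : ℕ) (a : ℝ) : ℝ[X] →ₗ[ℝ] ℝ := (Polynomial.leval a).comp (derivative ^ j)

theorem derivEval_apply (j : ℕ) (a : ℝ) (p : ℝ[X]) :
    derivEval j a p = (derivative^[j] p).eval a := by
  simp [derivEval, Module.End.pow_apply, Polynomial.leval]

/-- The functional `p ↦ ∫_{-1}^1 x^j p(x) dx`. -/
def momentFunctional (j : ℕ) : ℝ[X] →ₗ[ℝ] ℝ where
  toFun p := ∫ x in (-1 : ℝ)..1, p.eval x * x ^ j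
  map_add' p q := by
    rw [← intervalIntegral.integral_add (Continuous.intervalIntegrable (by fun_prop) _ _)
      (Continuous.intervalIntegrable (by fun_prop) _ _)]
    simp only [eval_add, add_mul]
  map_smul' c p := by
    simp only [eval_smul, smul_eq_mul, mul_assoc, RingHom.id_apply,
      intervalIntegral.integral_const_mul]

theorem momentFunctional_apply (j : ℕ) (p : ℝ[X]) :
    momentFunctional j p = ∫ x in (-1 : ℝ)..1, p.eval x * x ^ j := rfl

theorem momentFunctional_legendrePoly {l j : ℕ} (h : j < l) :
    momentFunctional j (legendrePoly l) = 0 := by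
  have := integral_legendrePoly_mul_eq_zero l (X ^ j) (by
    rw [degree_X_pow]; exact_mod_cast h)
  simpa [momentFunctional_apply] using this

theorem derivEval_of_pow_dvd {j m : ℕ} (hj : j < m) {a : ℝ} {p : ℝ[X]} (h : (X - C a) ^ m ∣ p) :
    derivEval j a p = 0 := by
  obtain ⟨r, hr⟩ := pow_sub_dvd_iterate_derivative_of_pow_dvd j h
  rw [derivEval_apply, hr]
  simp [eval_mul, zero_pow (by omega : m - j ≠ 0)]

theorem derivEval_pow_mul (m : ℕ) (a : ℝ) (p : ℝ[X]) :
    derivEval m a ((X - C a) ^ m * p) = m.factorial * p.eval a := by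
  rw [derivEval_apply]
  induction m generalizing p with
  | zero => simp
  | succ m ih =>
    have : derivative ((X - C a) ^ (m + 1) * p)
        = (X - C a) ^ m * (C ((m : ℝ) + 1) * p + (X - C a) * derivative p) := by
      rw [derivative_mul, derivative_X_sub_C_pow]
      simp
      ring
    rw [Function.iterate_succ_apply, this, ih]
    simp [Nat.factorial_succ]
    ring

/-- The Hankel matrix of the moments of `(x - y)^α (x - 1)^β` on `[-1, 1]`. -/
def jacobiHankel (n α β : ℕ) (y : ℝ) : Matrix (Fin n) (Fin n) ℝ :=
  Matrix.of fun i j =>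
    ∫ x in (-1 : ℝ)..1, x ^ ((i : ℕ) + j) * ((x - y) ^ α * (x - 1) ^ β)

/-! ### One determinant of functionals in two polynomial bases -/

section HermiteDet

variable (n α β : ℕ) (y : ℝ)

/-- The functionals: moments, then derivatives at `y`, then derivatives at `1`. -/
def hermiteFunctional : Fin n ⊕ Fin (α + β) → ℝ[X] →ₗ[ℝ] ℝ :=
  Sum.elim (fun j => momentFunctional j) fun c =>
    Sum.elim (fun a : Fin α => derivEval a y) (fun b : Fin β => derivEval b 1)
      (finSumFinEquiv.symm c)

/-- The monic polynomials `(x-1)^i`, `(x-1)^β (x-y)^i`, `(x-1)^β (x-y)^α x^i`. -/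
def newtonPoly : (Fin β ⊕ Fin α) ⊕ Fin n → ℝ[X] :=
  Sum.elim (Sum.elim (fun b => (X - C 1) ^ (b : ℕ)) fun a => (X - C y) ^ (a : ℕ) * (X - C 1) ^ β)
    fun i => (X - C y) ^ α * (X - C 1) ^ β * X ^ (i : ℕ)

/-- The index set of `newtonPoly`, ordered by degree. -/
def newtonEquiv : (Fin β ⊕ Fin α) ⊕ Fin n ≃ Fin (n + (α + β)) :=
  ((Equiv.sumCongr finSumFinEquiv (Equiv.refl _)).trans finSumFinEquiv).trans
    (finCongr (by omega))

/-- Matches the index sets of `newtonPoly` and `hermiteFunctional`. -/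
def newtonHermiteEquiv : (Fin β ⊕ Fin α) ⊕ Fin n ≃ Fin n ⊕ Fin (α + β) :=
  (Equiv.sumComm _ _).trans
    (Equiv.sumCongr (Equiv.refl _) ((Equiv.sumComm _ _).trans finSumFinEquiv))

theorem newtonPoly_natDegree (r : (Fin β ⊕ Fin α) ⊕ Fin n) :
    (newtonPoly n α β y r).natDegree = newtonEquiv n α β r ∧ (newtonPoly n α β y r).Monic := by
  have hm : ∀ (a : ℝ) (k : ℕ), ((X - C a) ^ k).Monic := fun a k => (monic_X_sub_C a).pow k
  have hd : ∀ (a : ℝ) (k : ℕ), ((X - C a) ^ k).natDegree = k := fun a k => by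
    rw [(monic_X_sub_C a).natDegree_pow, natDegree_X_sub_C, mul_one]
  rcases r with (b | a) | i
  · exact ⟨by simp [newtonPoly, newtonEquiv, hd, -map_one], by simpa [newtonPoly] using hm 1 b⟩
  · refine ⟨?_, by simpa [newtonPoly] using (hm y a).mul (hm 1 β)⟩
    simp only [newtonPoly, Sum.elim_inl, Sum.elim_inr, (hm y a).natDegree_mul (hm 1 β), hd]
    simp [newtonEquiv]
    omega
  · refine ⟨?_, by simpa [newtonPoly] using ((hm y α).mul (hm 1 β)).mul (monic_X_pow (i : ℕ))⟩
    simp only [newtonPoly, Sum.elim_inr, ((hm y α).mul (hm 1 β)).natDegree_mul (monic_X_pow _),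
      (hm y α).natDegree_mul (hm 1 β), hd, natDegree_X_pow]
    simp [newtonEquiv]
    omega

/-- `P_{n+i}` is orthogonal to `x^j` for `j < n`, so the lower left block is zero. The lower right
block consists of the derivatives of the `P_{n+i}` at `y` and `1`; the upper right block does not
matter. -/
theorem det_hermite_legendre :
    (Matrix.of fun r c : Fin n ⊕ Fin (α + β) => hermiteFunctional n α β y c
      (legendrePoly (finSumFinEquiv r : Fin (n + (α + β))))).det =
      (Matrix.of fun i j : Fin n => momentFunctional j (legendrePoly i)).det *
        legendreDet n α β y 1 := by
  rw [legendreDet, ← Matrix.det_fromBlocks_zero₂₁ _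
    (Matrix.of fun (i : Fin n) c => hermiteFunctional n α β y (Sum.inr c) (legendrePoly i))]
  congr 1
  ext (i | i) (j | j)
  · simp [hermiteFunctional]
  · simp
  · simp only [Matrix.of_apply, hermiteFunctional, Sum.elim_inl, finSumFinEquiv_apply_right,
      Matrix.fromBlocks_apply₂₁, Matrix.zero_apply]
    exact momentFunctional_legendrePoly (by simp; omega)
  · simp only [Matrix.of_apply, hermiteFunctional, Sum.elim_inr, finSumFinEquiv_apply_right,
      Matrix.fromBlocks_apply₂₂, Matrix.submatrix_apply, id]
    rcases h : finSumFinEquiv.symm j with a | b <;>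
      simp [legendreE, derivEval_apply]

/-- Each Newton polynomial is killed by all derivative functionals paired with later ones, so the
matrix is block triangular. The derivatives at `1` contribute `b!`, those at `y` contribute `a! (y -
1)^β`, which accounts for `(y - 1)^(αβ)`, and the moments of the last group form the Hankel matrix.
-/
theorem det_hermite_newton :
    (Matrix.of fun r c : (Fin β ⊕ Fin α) ⊕ Fin n =>
      hermiteFunctional n α β y (newtonHermiteEquiv n α β c) (newtonPoly n α β y r)).det =
      ((∏ b : Fin β, (b : ℕ).factorial : ℝ) * ∏ a : Fin α, ((a : ℕ).factorial : ℝ)) *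
        (y - 1) ^ (α * β) * (jacobiHankel n α β y).det := by
  set A : Matrix ((Fin β ⊕ Fin α) ⊕ Fin n) ((Fin β ⊕ Fin α) ⊕ Fin n) ℝ :=
    Matrix.of fun r c =>
      hermiteFunctional n α β y (newtonHermiteEquiv n α β c) (newtonPoly n α β y r) with hA
  have h21 : A.toBlocks₂₁ = 0 := by
    ext i c
    rcases c with b | a
    · have h : derivEval (b : ℕ) 1 ((X - C y) ^ α * (X - C 1) ^ β * X ^ (i : ℕ)) = 0 :=
        derivEval_of_pow_dvd b.2 (Dvd.dvd.mul_right (Dvd.intro_left _ rfl) _)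
      simpa [hA, Matrix.toBlocks₂₁, newtonHermiteEquiv, hermiteFunctional, newtonPoly] using h
    · have h : derivEval (a : ℕ) y ((X - C y) ^ α * (X - C 1) ^ β * X ^ (i : ℕ)) = 0 :=
        derivEval_of_pow_dvd a.2 (Dvd.dvd.mul_right (Dvd.intro _ rfl) _)
      simpa [hA, Matrix.toBlocks₂₁, newtonHermiteEquiv, hermiteFunctional, newtonPoly] using h
  have h22 : A.toBlocks₂₂ = (jacobiHankel n α β y) := by
    ext i j
    have h : momentFunctional j ((X - C y) ^ α * (X - C 1) ^ β * X ^ (i : ℕ))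
        = ∫ x in (-1 : ℝ)..1, x ^ ((i : ℕ) + j) * ((x - y) ^ α * (x - 1) ^ β) := by
      rw [momentFunctional_apply]
      refine intervalIntegral.integral_congr fun x _ => ?_
      simp
      ring
    simpa [hA, Matrix.toBlocks₂₂, newtonHermiteEquiv, hermiteFunctional, newtonPoly,
      jacobiHankel] using h
  have h11 : A.toBlocks₁₁.toBlocks₂₁ = 0 := by
    ext a b
    have h : derivEval (b : ℕ) 1 ((X - C y) ^ (a : ℕ) * (X - C 1) ^ β) = 0 :=
      derivEval_of_pow_dvd b.2 (Dvd.intro_left _ rfl)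
    simpa [hA, Matrix.toBlocks₂₁, Matrix.toBlocks₁₁, newtonHermiteEquiv, hermiteFunctional,
      newtonPoly] using h
  have hb : A.toBlocks₁₁.toBlocks₁₁.det = ∏ b : Fin β, ((b : ℕ).factorial : ℝ) := by
    rw [Matrix.det_of_isUpperTriangular]
    · refine Finset.prod_congr rfl fun b _ => ?_
      have h := derivEval_pow_mul b 1 1
      simpa [hA, Matrix.toBlocks₁₁, newtonHermiteEquiv, hermiteFunctional, newtonPoly] using h
    · intro i j hij
      have hij' : j < i := hij
      have h : derivEval (j : ℕ) 1 ((X - C 1) ^ (i : ℕ)) = 0 :=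
        derivEval_of_pow_dvd hij' dvd_rfl
      simpa [hA, Matrix.toBlocks₁₁, newtonHermiteEquiv, hermiteFunctional, newtonPoly] using h
  have ha : A.toBlocks₁₁.toBlocks₂₂.det =
      ∏ a : Fin α, (((a : ℕ).factorial : ℝ) * (y - 1) ^ β) := by
    rw [Matrix.det_of_isUpperTriangular]
    · refine Finset.prod_congr rfl fun a _ => ?_
      have h := derivEval_pow_mul a y ((X - C 1) ^ β)
      rw [eval_pow, eval_sub, eval_X, eval_C] at h
      simpa [hA, Matrix.toBlocks₁₁, Matrix.toBlocks₂₂, newtonHermiteEquiv, hermiteFunctional,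
        newtonPoly] using h
    · intro i j hij
      have hij' : j < i := hij
      have h : derivEval (j : ℕ) y ((X - C y) ^ (i : ℕ) * (X - C 1) ^ β) = 0 :=
        derivEval_of_pow_dvd hij' (Dvd.intro _ rfl)
      simpa [hA, Matrix.toBlocks₁₁, Matrix.toBlocks₂₂, newtonHermiteEquiv, hermiteFunctional,
        newtonPoly] using h
  rw [← A.fromBlocks_toBlocks, h21, Matrix.det_fromBlocks_zero₂₁, h22,
    ← A.toBlocks₁₁.fromBlocks_toBlocks, h11, Matrix.det_fromBlocks_zero₂₁, hb, ha,
    Finset.prod_mul_distrib]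
  rw [Finset.prod_const, Finset.card_univ, Fintype.card_fin, ← pow_mul, mul_comm β α]
  ring

end HermiteDet

/-- Up to constants, the Legendre determinant is the Hankel determinant of the Jacobi-type
weight `(x - y)^α (x - 1)^β` on `[-1, 1]`. -/
theorem exists_legendreDet_eq (n α β : ℕ) : ∃ c₁ c₂ : ℝ, c₂ ≠ 0 ∧ ∀ y : ℝ,
    c₂ * ((y - 1) ^ (α * β) * (jacobiHankel n α β y).det) = c₁ * legendreDet n α β y 1 := by
  set e := (finSumFinEquiv : Fin n ⊕ Fin (α + β) ≃ Fin (n + (α + β)))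
  set s : ℝ := ((Equiv.Perm.sign (((newtonEquiv n α β).symm.trans
    (newtonHermiteEquiv n α β)).trans e) : ℤ) : ℝ) with hs
  set d : ℝ := ∏ r, (legendrePoly (e r)).coeff (e r) with hd
  set f : ℝ := (∏ b : Fin β, (b : ℕ).factorial : ℝ) * ∏ a : Fin α, ((a : ℕ).factorial : ℝ) with hf
  -- `s` is the sign of the permutation matching the two orderings of the functionals. The first
  -- constant need not be shown nonzero here; where that is needed, it follows from a nonzero Hankel
  -- determinant.
  refine ⟨s * (Matrix.of fun i j : Fin n => momentFunctional j (legendrePoly i)).det, d * f,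
    mul_ne_zero ?_ ?_, fun y => ?_⟩
  · refine Finset.prod_ne_zero_iff.2 fun r _ => ?_
    exact legendrePoly_coeff_ne_zero _
  · exact mul_ne_zero (Finset.prod_ne_zero_iff.2 fun _ _ => by positivity)
      (Finset.prod_ne_zero_iff.2 fun _ _ => by positivity)
  · have h1 := det_functional_eq e (hermiteFunctional n α β y) (fun r => legendrePoly (e r))
      fun r => legendrePoly_natDegree_le _
    have h2 := det_functional_eq (newtonEquiv n α β)
      (fun c => hermiteFunctional n α β y (newtonHermiteEquiv n α β c))
      (newtonPoly n α β y) fun r => (newtonPoly_natDegree n α β y r).1.le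
    have h3 : ∏ r, (newtonPoly n α β y r).coeff (newtonEquiv n α β r) = 1 := by
      refine Finset.prod_eq_one fun r _ => ?_
      obtain ⟨hr1, hr2⟩ := newtonPoly_natDegree n α β y r
      rw [← hr1]
      exact hr2
    rw [h3, one_mul, det_functional_reorder e (newtonEquiv n α β) (newtonHermiteEquiv n α β),
      det_hermite_newton] at h2
    rw [det_hermite_legendre] at h1
    rw [← hs] at h2
    rw [← hd] at h1
    linear_combination d * h2 - s * h1

/-! ### Integrals over ordered tuples -/

theorem measurableSet_strictMono (n : ℕ) : MeasurableSet {x : Fin n → ℝ | StrictMono x} := by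
  have : {x : Fin n → ℝ | StrictMono x} = ⋂ i, ⋂ j, ⋂ _ : i < j, {x | x i < x j} := by
    ext x
    simp [StrictMono]
  rw [this]
  exact MeasurableSet.iInter fun i => MeasurableSet.iInter fun j => MeasurableSet.iInter fun _ =>
    measurableSet_lt (measurable_pi_apply i) (measurable_pi_apply j)

theorem ae_injective_pi (n : ℕ) : ∀ᵐ x : Fin n → ℝ, Function.Injective x := by
  have h : ∀ i j : Fin n, i ≠ j → ∀ᵐ x : Fin n → ℝ, x i ≠ x j := by
    intro i j hij
    let s : Submodule ℝ (Fin n → ℝ) := LinearMap.ker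
      ((LinearMap.proj i : (Fin n → ℝ) →ₗ[ℝ] ℝ) - LinearMap.proj j)
    have hs : s ≠ ⊤ := by
      intro h
      have : (Pi.single i 1 : Fin n → ℝ) ∈ s := by rw [h]; trivial
      simp [s, hij.symm] at this
    have h0 := Measure.addHaar_submodule volume s hs
    have : {x : Fin n → ℝ | ¬ x i ≠ x j} = s := by
      ext x
      simp [s, sub_eq_zero]
    rw [ae_iff, this, h0]
  have h2 : ∀ᵐ x : Fin n → ℝ, ∀ i j : Fin n, i ≠ j → x i ≠ x j := by
    rw [ae_all_iff]; intro i
    rw [ae_all_iff]; intro j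
    by_cases hij : i = j
    · simp [hij]
    · filter_upwards [h i j hij] with x hx _ using hx
  filter_upwards [h2] with x hx i j hij
  by_contra hne
  exact hx i j hne hij

theorem existsUnique_perm_strictMono {n : ℕ} {x : Fin n → ℝ} (hx : Function.Injective x) :
    ∃! σ : Equiv.Perm (Fin n), StrictMono (x ∘ σ) := by
  refine ⟨Tuple.sort x, (Tuple.monotone_sort x).strictMono_of_injective
    (hx.comp (Tuple.sort x).injective), fun τ hτ => ?_⟩
  have := Tuple.unique_monotone hτ.monotone (Tuple.monotone_sort x)
  ext i
  exact congrArg Fin.val (hx (congrFun this i))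

theorem comp_perm_eq_piCongrLeft {n : ℕ} (σ : Equiv.Perm (Fin n)) :
    (fun x : Fin n → ℝ => x ∘ σ) = MeasurableEquiv.piCongrLeft (fun _ : Fin n => ℝ) σ.symm := by
  funext x
  funext i
  have := Equiv.piCongrLeft_apply_apply (fun _ : Fin n => ℝ) σ.symm x (σ i)
  rw [σ.symm_apply_apply] at this
  exact this.symm

theorem measurePreserving_comp_perm {n : ℕ} (σ : Equiv.Perm (Fin n)) :
    MeasurePreserving (fun x : Fin n → ℝ => x ∘ σ) := by
  rw [comp_perm_eq_piCongrLeft]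
  exact volume_measurePreserving_piCongrLeft (fun _ : Fin n => ℝ) σ.symm

/-- An integral over `ℝⁿ` is a sum of integrals over ordered tuples. -/
theorem integral_eq_sum_perm {n : ℕ} {g : (Fin n → ℝ) → ℝ} (hg : Integrable g) :
    ∫ x, g x = ∑ σ : Equiv.Perm (Fin n), ∫ x in {x : Fin n → ℝ | StrictMono x}, g (x ∘ σ) := by
  have h1 : ∀ᵐ x : Fin n → ℝ, g x = ∑ σ : Equiv.Perm (Fin n),
      {x : Fin n → ℝ | StrictMono (x ∘ σ)}.indicator g x := by
    filter_upwards [ae_injective_pi n] with x hx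
    obtain ⟨σ, hσ, hu⟩ := existsUnique_perm_strictMono hx
    rw [Finset.sum_eq_single σ]
    · rw [Set.indicator_of_mem (show x ∈ {x : Fin n → ℝ | StrictMono (x ∘ σ)} from hσ)]
    · intro τ _ hτ
      exact Set.indicator_of_notMem (fun h => hτ (hu τ h)) _
    · simp
  have hm : ∀ σ : Equiv.Perm (Fin n), MeasurableSet {x : Fin n → ℝ | StrictMono (x ∘ σ)} :=
    fun σ => (measurePreserving_comp_perm σ).measurable (measurableSet_strictMono n)
  -- The sum is reindexed by `σ ↦ σ⁻¹`, because `x ↦ x ∘ σ` pulls the cell of `σ⁻¹` back to the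
  -- increasing tuples.
  rw [integral_congr_ae h1, integral_finsetSum _ fun σ _ => hg.indicator (hm σ),
    ← Equiv.sum_comp (Equiv.inv _)]
  refine Finset.sum_congr rfl fun σ _ => ?_
  have hemb : MeasurableEmbedding (fun x : Fin n → ℝ => x ∘ σ) := by
    rw [comp_perm_eq_piCongrLeft]
    exact MeasurableEquiv.measurableEmbedding _
  rw [integral_indicator (hm _), ← (measurePreserving_comp_perm σ).setIntegral_preimage_emb hemb]
  congr 2
  ext x
  simp [Function.comp_assoc]

/-- Integrating a determinant whose rows depend on different variables. -/
theorem integral_det_rows {n : ℕ} (f : Fin n → Fin n → ℝ → ℝ)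
    (hf : ∀ i j, Integrable (f i j)) :
    Integrable (fun x : Fin n → ℝ => (Matrix.of fun i j => f i j (x i)).det) ∧
    ∫ x : Fin n → ℝ, (Matrix.of fun i j => f i j (x i)).det
      = (Matrix.of fun i j => ∫ t, f i j t).det := by
  have h : ∀ x : Fin n → ℝ, (Matrix.of fun i j => f i j (x i)).det
      = ∑ σ : Equiv.Perm (Fin n), (Equiv.Perm.sign σ : ℝ) * ∏ i, f i (σ i) (x i) := by
    intro x
    rw [← Matrix.det_transpose, Matrix.det_apply']
    rfl
  have hi : ∀ σ : Equiv.Perm (Fin n), Integrable (fun x : Fin n → ℝ =>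
      (Equiv.Perm.sign σ : ℝ) * ∏ i, f i (σ i) (x i)) := fun σ =>
    (Integrable.fintype_prod (f := fun i => f i (σ i)) fun i => hf i (σ i)).const_mul _
  simp only [h]
  refine ⟨integrable_finsetSum _ fun σ _ => hi σ, ?_⟩
  rw [integral_finsetSum _ fun σ _ => hi σ, ← Matrix.det_transpose, Matrix.det_apply']
  refine Finset.sum_congr rfl fun σ _ => ?_
  rw [integral_const_mul, integral_fintype_prod_volume_eq_prod (fun i => f i (σ i))]
  rfl

/-- Andréief's identity on ordered tuples, for the squared Vandermonde determinant. -/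
theorem integral_strictMono_vandermonde_sq {n : ℕ} (h : ℝ → ℝ)
    (hh : ∀ k : ℕ, Integrable fun t => t ^ k * h t) :
    ∫ x in {x : Fin n → ℝ | StrictMono x}, (Matrix.vandermonde x).det ^ 2 * ∏ i, h (x i)
      = (Matrix.of fun i j : Fin n => ∫ t, t ^ ((i : ℕ) + j) * h t).det := by
  obtain ⟨hi, he⟩ := integral_det_rows (fun (i j : Fin n) t => t ^ ((i : ℕ) + j) * h t)
    fun i j => hh _
  have hrow : ∀ x : Fin n → ℝ,
      (Matrix.of fun i j : Fin n => x i ^ ((i : ℕ) + j) * h (x i)).det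
        = (∏ i, x i ^ (i : ℕ)) * (∏ i, h (x i)) * (Matrix.vandermonde x).det := by
    intro x
    rw [← Finset.prod_mul_distrib, ← Matrix.det_mul_column]
    congr 1
    ext i j
    simp [Matrix.vandermonde_apply, pow_add]
    ring
  rw [← he, integral_eq_sum_perm hi]
  simp only [hrow]
  -- A permutation multiplies the Vandermonde determinant by its sign, so summing the leftover
  -- monomials over `σ` rebuilds a second Vandermonde determinant.
  have hperm : ∀ (σ : Equiv.Perm (Fin n)) (x : Fin n → ℝ),
      (∏ i, (x ∘ σ) i ^ (i : ℕ)) * (∏ i, h ((x ∘ σ) i)) * (Matrix.vandermonde (x ∘ σ)).det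
        = ((Equiv.Perm.sign σ : ℝ) * ∏ i, Matrix.vandermonde x (σ i) i) *
          ((Matrix.vandermonde x).det * ∏ i, h (x i)) := by
    intro σ x
    have h1 : Matrix.vandermonde (x ∘ σ) = (Matrix.vandermonde x).submatrix σ id := by
      ext i j; simp [Matrix.vandermonde_apply]
    have h2 : ∏ i, h ((x ∘ σ) i) = ∏ i, h (x i) := Equiv.prod_comp σ fun i => h (x i)
    rw [h1, Matrix.det_permute, h2]
    simp only [Matrix.vandermonde_apply, Function.comp_apply]
    ring
  simp only [hperm]
  rw [← integral_finsetSum]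
  · refine setIntegral_congr_fun (measurableSet_strictMono n) fun x _ => ?_
    rw [← Finset.sum_mul, ← Matrix.det_apply']
    ring
  · intro σ _
    refine Integrable.integrableOn ?_
    have := (measurePreserving_comp_perm σ).integrable_comp_of_integrable hi
    refine this.congr (Filter.Eventually.of_forall fun x => ?_)
    exact (hrow (x ∘ σ)).trans (hperm σ x)

/-- The integral of the Vandermonde determinant over the tuples interlacing a given one. -/
theorem integral_vandermonde_interlacing {k : ℕ} (μ : Fin (k + 1) → ℝ) (hμ : Monotone μ) :
    ∫ x in Set.univ.pi fun i : Fin k => Set.Ioo (μ i.castSucc) (μ i.succ),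
      (Matrix.vandermonde x).det = (Matrix.vandermonde μ).det / k.factorial := by
  have hmeas : MeasurableSet (Set.univ.pi fun i : Fin k => Set.Ioo (μ i.castSucc) (μ i.succ)) :=
    MeasurableSet.univ_pi fun i => measurableSet_Ioo
  set f : Fin k → Fin k → ℝ → ℝ := fun i j =>
    (Set.Ioo (μ i.castSucc) (μ i.succ)).indicator fun t => t ^ (j : ℕ) with hf
  have hfi : ∀ i j, Integrable (f i j) := fun i j =>
    ((Continuous.integrableOn_Icc (by fun_prop)).mono_set Set.Ioo_subset_Icc_self).integrable_indicator
      measurableSet_Ioo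
  have hfv : ∀ i j, ∫ t, f i j t = (μ i.succ ^ ((j : ℕ) + 1) - μ i.castSucc ^ ((j : ℕ) + 1)) *
      ((j : ℝ) + 1)⁻¹ := by
    intro i j
    rw [hf, integral_indicator measurableSet_Ioo, ← integral_Ioc_eq_integral_Ioo,
      ← intervalIntegral.integral_of_le (hμ i.castSucc_le_succ), integral_pow, div_eq_mul_inv]
  have hdet : ∀ x : Fin k → ℝ, (Set.univ.pi fun i : Fin k =>
      Set.Ioo (μ i.castSucc) (μ i.succ)).indicator (fun x => (Matrix.vandermonde x).det) x
        = (Matrix.of fun i j => f i j (x i)).det := by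
    intro x
    by_cases hx : x ∈ Set.univ.pi fun i : Fin k => Set.Ioo (μ i.castSucc) (μ i.succ)
    · rw [Set.indicator_of_mem hx]
      congr 1
      ext i j
      simp only [hf, Matrix.of_apply]
      rw [Set.indicator_of_mem (hx i (Set.mem_univ i)), Matrix.vandermonde_apply]
    · rw [Set.indicator_of_notMem hx]
      simp only [Set.mem_univ_pi, not_forall] at hx
      obtain ⟨i, hi⟩ := hx
      refine (Matrix.det_eq_zero_of_row_eq_zero i fun j => ?_).symm
      simp only [hf, Matrix.of_apply]
      exact Set.indicator_of_notMem hi _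
  rw [← integral_indicator hmeas]
  simp only [hdet]
  rw [(integral_det_rows f hfi).2]
  simp only [hfv]
  have h1 : (Matrix.of fun i j : Fin k => (μ i.succ ^ ((j : ℕ) + 1) - μ i.castSucc ^ ((j : ℕ) + 1)) *
      ((j : ℝ) + 1)⁻¹).det = (∏ j : Fin k, ((j : ℝ) + 1)⁻¹) *
        (Matrix.of fun i j : Fin k => μ i.succ ^ ((j : ℕ) + 1) - μ i.castSucc ^ ((j : ℕ) + 1)).det := by
    rw [← Matrix.det_mul_row]
    congr 1
    ext i j
    simp
    ring
  -- Subtracting from each row its predecessor turns the first column into `(1, 0, …, 0)`.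
  have h2 : (Matrix.vandermonde μ).det =
      (Matrix.of fun i j : Fin k => μ i.succ ^ ((j : ℕ) + 1) - μ i.castSucc ^ ((j : ℕ) + 1)).det := by
    rw [Matrix.det_eq_of_forall_row_eq_smul_add_pred (A := Matrix.vandermonde μ)
      (B := Matrix.of fun i : Fin (k + 1) => Fin.cases (Matrix.vandermonde μ 0)
        (fun i => Matrix.vandermonde μ i.succ - Matrix.vandermonde μ i.castSucc) i)
      (fun _ => 1) (by intro j; simp) (by intro i j; simp)]
    rw [Matrix.det_succ_column_zero, Fin.sum_univ_succ, Finset.sum_eq_zero, add_zero]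
    · simp [Matrix.vandermonde_apply]
      rfl
    · intro i _
      simp [Matrix.vandermonde_apply]
  have h3 : ∏ j : Fin k, ((j : ℝ) + 1)⁻¹ = (k.factorial : ℝ)⁻¹ := by
    rw [Finset.prod_inv_distrib, Fin.prod_univ_eq_prod_range (fun j => (j : ℝ) + 1),
      ← Finset.prod_range_add_one_eq_factorial]
    push_cast
    rfl
  rw [h1, h3, h2]
  ring

theorem vandermonde_det_pos {n : ℕ} {x : Fin n → ℝ} (hx : StrictMono x) :
    0 < (Matrix.vandermonde x).det := by
  rw [Matrix.det_vandermonde]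
  exact Finset.prod_pos fun i _ => Finset.prod_pos fun j hj =>
    sub_pos.2 (hx (Finset.mem_Ioi.1 hj))

/-! ### Partial fractions with interlacing zeros and poles -/

theorem prod_erase_eq_prod_succAbove {M : Type*} [CommMonoid M] {n : ℕ} (j : Fin (n + 1))
    (f : Fin (n + 1) → M) : ∏ i ∈ Finset.univ.erase j, f i = ∏ l, f (j.succAbove l) := by
  have h := Fin.prod_univ_succAbove f j
  have h2 : Finset.univ.erase j = Finset.univ.image j.succAbove := by
    rw [Fin.image_succAbove_univ]
    ext i
    simp
  rw [h2, Finset.prod_image fun x _ y _ hxy => Fin.succAbove_right_injective hxy]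

/-- For `v = (s, μ)`, the residues of `s ∏ (z - μ_l) / ∏ (z - a_j)` at the poles `a_j`. -/
def residueMap {K : ℕ} (a : Fin (K + 1) → ℝ) (v : Fin (K + 1) → ℝ) (j : Fin (K + 1)) : ℝ :=
  v 0 * ∏ l : Fin K, (a j - v l.succ) / (a j - a (j.succAbove l))

/-- Pairs `(s, μ)` with `s > 0` and `a_0 < μ_0 < a_1 < ⋯ < μ_{K-1} < a_K`. -/
def interlacingSet {K : ℕ} (a : Fin (K + 1) → ℝ) : Set (Fin (K + 1) → ℝ) :=
  {v | 0 < v 0 ∧ ∀ l : Fin K, a l.castSucc < v l.succ ∧ v l.succ < a l.succ}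

variable {K : ℕ} {a : Fin (K + 1) → ℝ}

theorem measurableSet_interlacingSet : MeasurableSet (interlacingSet a) := by
  have : interlacingSet a = {v | 0 < v 0} ∩ ⋂ l : Fin K,
      {v | a l.castSucc < v l.succ} ∩ {v | v l.succ < a l.succ} := by
    ext v
    simp [interlacingSet]
  rw [this]
  refine (measurableSet_lt measurable_const (measurable_pi_apply _)).inter
    (MeasurableSet.iInter fun l => ?_)
  exact (measurableSet_lt measurable_const (measurable_pi_apply _)).inter
    (measurableSet_lt (measurable_pi_apply _) measurable_const)

theorem sub_ne_zero_succAbove (ha : StrictMono a) (j : Fin (K + 1)) (l : Fin K) :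
    a j - a (j.succAbove l) ≠ 0 :=
  sub_ne_zero.2 fun h => Fin.succAbove_ne j l (ha.injective h).symm

/-- The zero `μ_l` and the pole paired with it by `succAbove` lie on the same side of `a_j`. -/
theorem residue_ratio_pos (ha : StrictMono a) {v : Fin (K + 1) → ℝ} (hv : v ∈ interlacingSet a)
    (j : Fin (K + 1)) (l : Fin K) : 0 < (a j - v l.succ) / (a j - a (j.succAbove l)) := by
  obtain ⟨h1, h2⟩ := hv.2 l
  rcases lt_or_ge l.castSucc j with h | h
  · rw [Fin.succAbove_of_castSucc_lt _ _ h]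
    have h3 : a l.succ ≤ a j := ha.monotone (Fin.castSucc_lt_iff_succ_le.1 h)
    exact div_pos (by linarith) (by linarith)
  · rw [Fin.succAbove_of_le_castSucc _ _ h]
    have h3 : a j ≤ a l.castSucc := ha.monotone h
    exact div_pos_of_neg_of_neg (by linarith) (by linarith)

theorem residueMap_pos (ha : StrictMono a) {v : Fin (K + 1) → ℝ} (hv : v ∈ interlacingSet a)
    (j : Fin (K + 1)) : 0 < residueMap a v j :=
  mul_pos hv.1 (Finset.prod_pos fun l _ => residue_ratio_pos ha hv j l)

/-- The polynomial `s ∏ (z - μ_l)`. -/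
def rootPoly (v : Fin (K + 1) → ℝ) : ℝ[X] := C (v 0) * ∏ l : Fin K, (X - C (v l.succ))

theorem rootPoly_eval (v : Fin (K + 1) → ℝ) (z : ℝ) :
    (rootPoly v).eval z = v 0 * ∏ l : Fin K, (z - v l.succ) := by
  simp [rootPoly, eval_prod]

theorem rootPoly_natDegree_le (v : Fin (K + 1) → ℝ) : (rootPoly v).natDegree ≤ K := by
  refine (natDegree_C_mul_le _ _).trans ?_
  rw [natDegree_prod_of_monic _ _ fun l _ => monic_X_sub_C _]
  simp

theorem rootPoly_coeff (v : Fin (K + 1) → ℝ) : (rootPoly v).coeff K = v 0 := by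
  rw [rootPoly, coeff_C_mul]
  have hm : (∏ l : Fin K, (X - C (v l.succ))).Monic := monic_prod_of_monic _ _ fun l _ =>
    monic_X_sub_C _
  have hd : (∏ l : Fin K, (X - C (v l.succ))).natDegree = K := by
    rw [natDegree_prod_of_monic _ _ fun l _ => monic_X_sub_C _]
    simp
  have := hm.coeff_natDegree
  rw [hd] at this
  rw [this, mul_one]

theorem residueMap_eq_div (v : Fin (K + 1) → ℝ) (j : Fin (K + 1)) :
    residueMap a v j = (rootPoly v).eval (a j) / ∏ i ∈ Finset.univ.erase j, (a j - a i) := by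
  rw [prod_erase_eq_prod_succAbove j fun i => a j - a i, rootPoly_eval, residueMap,
    Finset.prod_div_distrib, mul_div_assoc]

theorem rootPoly_degree_lt (v : Fin (K + 1) → ℝ) :
    (rootPoly v).degree < (Finset.univ : Finset (Fin (K + 1))).card := by
  refine (degree_le_of_natDegree_le (rootPoly_natDegree_le v)).trans_lt ?_
  simp only [Finset.card_univ, Fintype.card_fin]
  exact_mod_cast Nat.lt_succ_self K

/-- Leading coefficient of the Lagrange interpolation of `s ∏ (z - μ_l)` at the nodes `a_j`. -/
theorem sum_residueMap (ha : StrictMono a) (v : Fin (K + 1) → ℝ) :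
    ∑ j, residueMap a v j = v 0 := by
  have h := Lagrange.coeff_eq_sum (s := Finset.univ) (v := a) ha.injective.injOn
    (rootPoly_degree_lt v)
  simp only [Finset.card_univ, Fintype.card_fin, Nat.add_sub_cancel, rootPoly_coeff] at h
  simp only [residueMap_eq_div]
  exact h.symm

/-- The partial fraction expansion with denominators cleared, which is Lagrange interpolation at the
poles. -/
theorem sum_residueMap_mul_prod (ha : StrictMono a) (v : Fin (K + 1) → ℝ) (z : ℝ) :
    ∑ j, residueMap a v j * ∏ l, (z - a (j.succAbove l)) = v 0 * ∏ l : Fin K, (z - v l.succ) := by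
  have h := congrArg (eval z) (Lagrange.eq_interpolate (s := Finset.univ) (v := a)
    ha.injective.injOn (rootPoly_degree_lt v))
  rw [← rootPoly_eval, h, Lagrange.interpolate_apply, eval_finsetSum]
  refine Finset.sum_congr rfl fun j _ => ?_
  rw [residueMap_eq_div, eval_mul, eval_C, Lagrange.basis, eval_prod,
    ← prod_erase_eq_prod_succAbove j fun i => z - a i, div_mul_eq_mul_div, mul_div_assoc,
    ← Finset.prod_div_distrib]
  congr 1
  refine Finset.prod_congr rfl fun i _ => ?_
  simp [Lagrange.basisDivisor, div_eq_inv_mul]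

theorem interlacing_separated (ha : StrictMono a) {l m : Fin K} {x : ℝ}
    (h1 : a l.castSucc < x) (h2 : x < a l.succ) (h3 : a m.castSucc < x) (h4 : x < a m.succ) :
    l = m := by
  rcases lt_trichotomy l m with h | h | h
  · have : a l.succ ≤ a m.castSucc := ha.monotone (by
      rw [Fin.le_def]; simp; omega)
    linarith
  · exact h
  · have : a m.succ ≤ a l.castSucc := ha.monotone (by
      rw [Fin.le_def]; simp; omega)
    linarith

/-- The residues determine `s`, which is their sum, and then the polynomial `∏ (z - μ_l)`. Since
each gap between poles contains one zero, the zeros are recovered with their labels. -/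
theorem residueMap_injOn (ha : StrictMono a) :
    Set.InjOn (residueMap a) (interlacingSet a) := by
  intro v hv v' hv' h
  have h0 : v 0 = v' 0 := by rw [← sum_residueMap ha v, h, sum_residueMap ha v']
  have hz : ∀ z : ℝ, ∏ l : Fin K, (z - v l.succ) = ∏ l : Fin K, (z - v' l.succ) := by
    intro z
    have := sum_residueMap_mul_prod ha v z
    rw [h, sum_residueMap_mul_prod ha v' z, ← h0] at this
    exact (mul_left_cancel₀ hv.1.ne' this).symm
  funext i
  refine Fin.cases h0 (fun l => ?_) i
  have hl := hz (v l.succ)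
  rw [Finset.prod_eq_zero (Finset.mem_univ l) (sub_self _)] at hl
  obtain ⟨m, -, hm⟩ := Finset.prod_eq_zero_iff.1 hl.symm
  have hm' : v l.succ = v' m.succ := sub_eq_zero.1 hm
  have := interlacing_separated ha (hv.2 l).1 (hv.2 l).2 (m := m)
    (hm' ▸ (hv'.2 m).1) (hm' ▸ (hv'.2 m).2)
  rw [hm', this]

/-- Between two consecutive nodes the nodal derivative changes sign: only the factor joining these
two nodes differs in sign. -/
theorem prod_sub_succAbove_sign (ha : StrictMono a) (l : Fin K) :
    (∏ m, (a l.castSucc - a (l.castSucc.succAbove m))) *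
      (∏ m, (a l.succ - a (l.succ.succAbove m))) < 0 := by
  have hlt : a l.castSucc < a l.succ := ha l.castSucc_lt_succ
  rw [← Finset.prod_mul_distrib, ← Finset.mul_prod_erase _ _ (Finset.mem_univ l)]
  refine mul_neg_of_neg_of_pos ?_ (Finset.prod_pos fun m hm => ?_)
  · rw [Fin.succAbove_castSucc_self, Fin.succAbove_succ_self]
    exact mul_neg_of_neg_of_pos (by linarith) (by linarith)
  · have hne : m ≠ l := (Finset.mem_erase.1 hm).1
    rcases lt_or_gt_of_ne hne with h | h
    · rw [Fin.succAbove_of_castSucc_lt _ _ (by simpa using h),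
        Fin.succAbove_of_castSucc_lt _ _ (by rw [Fin.lt_def] at h ⊢; simp; omega)]
      have : a m.castSucc < a l.castSucc := ha (by simpa using h)
      exact mul_pos (by linarith) (by linarith)
    · rw [Fin.succAbove_of_le_castSucc _ _ (by simpa using h.le),
        Fin.succAbove_of_le_castSucc _ _ (by rw [Fin.lt_def] at h; rw [Fin.le_def]; simp; omega)]
      have : a l.succ < a m.succ := ha (by simpa using h)
      exact mul_pos_of_neg_of_neg (by linarith) (by linarith)

/-- The numerator `Q` of `∑ w_j / (z - a_j)` takes opposite signs at consecutive poles, so it has a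
root in each of the `K` gaps; its degree is at most `K` and its leading coefficient is `∑ w_j`. -/
theorem residueMap_surjOn (ha : StrictMono a) {w : Fin (K + 1) → ℝ} (hw : ∀ j, 0 < w j) :
    ∃ v ∈ interlacingSet a, residueMap a v = w := by
  set Q : ℝ[X] := ∑ j, C (w j) * ∏ l, (X - C (a (j.succAbove l))) with hQ
  have hmon : ∀ j : Fin (K + 1), (∏ l, (X - C (a (j.succAbove l)))).Monic := fun j =>
    monic_prod_of_monic _ _ fun l _ => monic_X_sub_C _
  have hdeg : ∀ j : Fin (K + 1), (∏ l, (X - C (a (j.succAbove l)))).natDegree = K := fun j => by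
    rw [natDegree_prod_of_monic _ _ fun l _ => monic_X_sub_C _]
    simp
  have hQd : Q.natDegree ≤ K := natDegree_sum_le_of_forall_le _ _ fun j _ =>
    (natDegree_C_mul_le _ _).trans (hdeg j).le
  have hQc : Q.coeff K = ∑ j, w j := by
    rw [hQ, finsetSum_coeff]
    refine Finset.sum_congr rfl fun j _ => ?_
    rw [coeff_C_mul]
    have := (hmon j).coeff_natDegree
    rw [hdeg] at this
    rw [this, mul_one]
  have hQe : ∀ j, Q.eval (a j) = w j * ∏ l, (a j - a (j.succAbove l)) := by
    intro j
    rw [hQ, eval_finsetSum, Finset.sum_eq_single j]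
    · simp [eval_prod]
    · intro i _ hij
      obtain ⟨l, hl⟩ := Fin.exists_succAbove_eq hij.symm
      rw [eval_mul, eval_prod, Finset.prod_eq_zero (Finset.mem_univ l) (by simp [hl]), mul_zero]
    · simp
  have hroot : ∀ l : Fin K, ∃ x, a l.castSucc < x ∧ x < a l.succ ∧ Q.eval x = 0 := by
    intro l
    have hlt : a l.castSucc < a l.succ := ha l.castSucc_lt_succ
    have hsign : Q.eval (a l.castSucc) * Q.eval (a l.succ) < 0 := by
      rw [hQe, hQe]
      have := mul_neg_of_pos_of_neg (mul_pos (hw l.castSucc) (hw l.succ))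
        (prod_sub_succAbove_sign ha l)
      linarith
    have hc : ContinuousOn (fun x => Q.eval x) (Set.Icc (a l.castSucc) (a l.succ)) :=
      Q.continuous.continuousOn
    rcases mul_neg_iff.1 hsign with ⟨h1, h2⟩ | ⟨h1, h2⟩
    · obtain ⟨x, hx, hx0⟩ := intermediate_value_Ioo' hlt.le hc ⟨h2, h1⟩
      exact ⟨x, hx.1, hx.2, hx0⟩
    · obtain ⟨x, hx, hx0⟩ := intermediate_value_Ioo hlt.le hc ⟨h1, h2⟩
      exact ⟨x, hx.1, hx.2, hx0⟩
  choose μ h1 h2 h3 using hroot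
  set v : Fin (K + 1) → ℝ := Fin.cons (∑ j, w j) μ with hv
  have hvU : v ∈ interlacingSet a :=
    ⟨Finset.sum_pos (fun j _ => hw j) Finset.univ_nonempty, fun l => by
      simpa [hv] using ⟨h1 l, h2 l⟩⟩
  have hinj : Function.Injective μ := fun l m hlm =>
    interlacing_separated ha (h1 l) (h2 l) (hlm ▸ h1 m) (hlm ▸ h2 m)
  have hQR : Q = rootPoly v := by
    -- Equal coefficients of degree `K` make the difference of degree below `K`, and it vanishes at
    -- `K` points.
    refine eq_of_degree_sub_lt_of_eval_index_eq (s := Finset.univ) (v := μ) hinj.injOn ?_ ?_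
    · rw [Finset.card_univ, Fintype.card_fin, degree_lt_iff_coeff_zero]
      intro m hm
      rcases hm.eq_or_lt with rfl | hm
      · rw [coeff_sub, rootPoly_coeff, hQc]
        simp [hv]
      · rw [coeff_sub, coeff_eq_zero_of_natDegree_lt (hQd.trans_lt hm),
          coeff_eq_zero_of_natDegree_lt ((rootPoly_natDegree_le v).trans_lt hm), sub_zero]
    · intro l _
      rw [h3, rootPoly_eval, Finset.prod_eq_zero (Finset.mem_univ l) (by simp [hv]), mul_zero]
  refine ⟨v, hvU, funext fun j => ?_⟩
  rw [residueMap_eq_div, ← hQR, hQe, prod_erase_eq_prod_succAbove j fun i => a j - a i]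
  exact mul_div_cancel_right₀ _
    (Finset.prod_ne_zero_iff.2 fun l _ => sub_ne_zero_succAbove ha j l)

theorem image_residueMap (ha : StrictMono a) :
    residueMap a '' interlacingSet a = {w | ∀ j, 0 < w j} := by
  ext w
  constructor
  · rintro ⟨v, hv, rfl⟩ j
    exact residueMap_pos ha hv j
  · intro hw
    obtain ⟨v, hv, rfl⟩ := residueMap_surjOn ha hw
    exact ⟨v, hv, rfl⟩

/-! ### The Jacobian of the residue map -/

theorem abs_prod_erase_sub {n : ℕ} (x : Fin n → ℝ) :
    |∏ i, ∏ j ∈ Finset.univ.erase i, (x i - x j)| = (Matrix.vandermonde x).det ^ 2 := by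
  have h1 : ∀ i : Fin n, ∏ j ∈ Finset.univ.erase i, |x i - x j|
      = (∏ j ∈ Finset.Ioi i, |x j - x i|) * ∏ j ∈ Finset.Iio i, |x i - x j| := by
    intro i
    have hu : Finset.univ.erase i = Finset.Ioi i ∪ Finset.Iio i := by
      ext j
      simp [lt_or_lt_iff_ne, eq_comm]
    rw [hu, Finset.prod_union]
    · congr 1
      exact Finset.prod_congr rfl fun j _ => abs_sub_comm _ _
    · rw [Finset.disjoint_left]
      intro j hj hj'
      exact lt_asymm (Finset.mem_Ioi.1 hj) (Finset.mem_Iio.1 hj')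
  have h2 : ∏ i, ∏ j ∈ Finset.Iio i, |x i - x j| = ∏ i, ∏ j ∈ Finset.Ioi i, |x j - x i| :=
    Finset.prod_comm' (by intro i j; simp)
  rw [Finset.abs_prod]
  simp only [Finset.abs_prod]
  simp only [h1]
  rw [Finset.prod_mul_distrib, h2, Matrix.det_vandermonde, ← sq_abs, Finset.abs_prod]
  simp only [Finset.abs_prod]
  ring

/-- The bordered Cauchy matrix with columns `1` and `1 / (a_j - μ_l)`. -/
def borderedCauchy (a : Fin (K + 1) → ℝ) (μ : Fin K → ℝ) :
    Matrix (Fin (K + 1)) (Fin (K + 1)) ℝ :=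
  Matrix.of fun j c => (Fin.cons 1 (fun l => (a j - μ l)⁻¹) : Fin (K + 1) → ℝ) c

/-- Lagrange interpolation at the `μ_l` writes `a_j^i / ∏ (a_j - μ_l)` as a combination of the `1 /
(a_j - μ_l)`, plus `1` when `i = K`. This factors the Vandermonde matrix of `a` through the bordered
Cauchy matrix and a matrix `E` of nodal weights and powers. Absolute values suffice for a change of
variables. -/
theorem det_borderedCauchy (μ : Fin K → ℝ) (hμ : Function.Injective μ)
    (hne : ∀ j l, a j ≠ μ l) :
    |(borderedCauchy a μ).det| * |∏ j, ∏ l, (a j - μ l)| * |(Matrix.vandermonde μ).det| =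
      |(Matrix.vandermonde a).det| * |∏ i, ∏ j ∈ Finset.univ.erase i, (μ i - μ j)| := by
  set nw : Fin K → ℝ := Lagrange.nodalWeight Finset.univ μ with hnw
  have hnw' : ∀ l, nw l = (∏ j ∈ Finset.univ.erase l, (μ l - μ j))⁻¹ := fun l => by
    rw [hnw, Lagrange.nodalWeight, Finset.prod_inv_distrib]
  set E : Matrix (Fin (K + 1)) (Fin (K + 1)) ℝ := Matrix.of fun r i =>
    (Fin.cons (if i = Fin.last K then 1 else 0) (fun l => nw l * μ l ^ (i : ℕ)) :
      Fin (K + 1) → ℝ) r with hE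
  have hmul : Matrix.vandermonde a =
      Matrix.diagonal (fun j => ∏ l, (a j - μ l)) * (borderedCauchy a μ * E) := by
    ext j i
    rw [Matrix.diagonal_mul, Matrix.mul_apply, Fin.sum_univ_succ, Matrix.vandermonde_apply]
    simp only [borderedCauchy, hE, Matrix.of_apply, Fin.cons_zero, Fin.cons_succ, one_mul]
    set R : ℝ[X] := ∏ l, (X - C (μ l)) with hR
    have hRm : R.Monic := monic_prod_of_monic _ _ fun l _ => monic_X_sub_C _
    have hRd : R.natDegree = K := by
      rw [hR, natDegree_prod_of_monic _ _ fun l _ => monic_X_sub_C _]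
      simp
    have hRe : ∀ x, R.eval x = ∏ l, (x - μ l) := fun x => by simp [hR, eval_prod]
    -- The remainder of `x^i` modulo `R`: only `i = K` needs a subtraction, which is what the border
    -- column supplies.
    set p : ℝ[X] := X ^ (i : ℕ) - C (if i = Fin.last K then 1 else 0) * R with hp
    have hpd : p.degree < (Finset.univ : Finset (Fin K)).card := by
      rw [Finset.card_univ, Fintype.card_fin, degree_lt_iff_coeff_zero]
      intro m hm
      rw [hp, coeff_sub, coeff_X_pow, coeff_C_mul]
      rcases hm.eq_or_lt with rfl | hm
      · have hc : R.coeff K = 1 := by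
          have := hRm.coeff_natDegree
          rwa [hRd] at this
        rw [hc]
        by_cases hi : i = Fin.last K
        · simp [hi]
        · have : K ≠ (i : ℕ) := fun h => hi (Fin.ext (by simp [← h]))
          simp [hi, this]
      · have : m ≠ (i : ℕ) := by have := i.2; omega
        rw [coeff_eq_zero_of_natDegree_lt (hRd ▸ hm), if_neg this]
        simp
    have hint := congrArg (eval (a j)) (Lagrange.eq_interpolate (s := Finset.univ) (v := μ)
      hμ.injOn hpd)
    rw [Lagrange.eval_interpolate_not_at_node _ fun l _ => hne j l, Lagrange.eval_nodal] at hint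
    have hpe : ∀ l, eval (μ l) p = μ l ^ (i : ℕ) := fun l => by
      rw [hp, eval_sub, eval_mul, hRe, Finset.prod_eq_zero (Finset.mem_univ l) (sub_self _)]
      simp
    simp only [hpe] at hint
    rw [hp, eval_sub, eval_mul, hRe, eval_C, eval_pow, eval_X] at hint
    rw [mul_add]
    have hs : ∑ l, (a j - μ l)⁻¹ * (nw l * μ l ^ (i : ℕ))
        = ∑ l, Lagrange.nodalWeight Finset.univ μ l * (a j - μ l)⁻¹ * μ l ^ (i : ℕ) :=
      Finset.sum_congr rfl fun l _ => by rw [hnw]; ring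
    rw [hs, ← hint]
    ring
  have hEdet : |E.det| = |∏ l, nw l| * |(Matrix.vandermonde μ).det| := by
    rw [Matrix.det_succ_row_zero, Finset.sum_eq_single (Fin.last K)]
    · have hsub : (E.submatrix Fin.succ (Fin.last K).succAbove)
          = Matrix.of fun l i => nw l * Matrix.vandermonde μ l i := by
        ext l i
        simp [hE, Matrix.vandermonde_apply]
      rw [hsub, Matrix.det_mul_column]
      simp [hE, abs_mul]
    · intro i _ hi
      simp [hE, hi]
    · simp
  have hdet := congrArg Matrix.det hmul
  rw [Matrix.det_mul, Matrix.det_mul, Matrix.det_diagonal] at hdet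
  rw [hdet, abs_mul, abs_mul, hEdet]
  have hone : |∏ l, nw l| * |∏ i, ∏ j ∈ Finset.univ.erase i, (μ i - μ j)| = 1 := by
    rw [← abs_mul, ← Finset.prod_mul_distrib, Finset.prod_eq_one, abs_one]
    intro l _
    rw [hnw']
    exact inv_mul_cancel₀ (Finset.prod_ne_zero_iff.2 fun j hj =>
      sub_ne_zero.2 fun h => (Finset.mem_erase.1 hj).1 (hμ h).symm)
  linear_combination (-|∏ j, ∏ l, (a j - μ l)| * |(borderedCauchy a μ).det| *
    |(Matrix.vandermonde μ).det|) * hone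

/-- The Jacobian matrix of `residueMap`. -/
def residueJacobian (a v : Fin (K + 1) → ℝ) : Matrix (Fin (K + 1)) (Fin (K + 1)) ℝ :=
  Matrix.of fun j c => (Fin.cons (∏ l : Fin K, (a j - v l.succ) / (a j - a (j.succAbove l)))
    (fun l => -(residueMap a v j) * (a j - v l.succ)⁻¹) : Fin (K + 1) → ℝ) c

theorem hasFDerivAt_residueMap {v : Fin (K + 1) → ℝ}
    (hne : ∀ j (l : Fin K), a j ≠ v l.succ) :
    HasFDerivAt (residueMap a) (Matrix.toLin' (residueJacobian a v)).toContinuousLinearMap v := by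
  rw [hasFDerivAt_pi']
  intro j
  have hp : HasFDerivAt (fun v : Fin (K + 1) → ℝ =>
      ∏ l : Fin K, (a j - v l.succ) / (a j - a (j.succAbove l)))
      (∑ l : Fin K, (∏ m ∈ Finset.univ.erase l, (a j - v m.succ) / (a j - a (j.succAbove m))) •
        ((a j - a (j.succAbove l))⁻¹ •
          (-(ContinuousLinearMap.proj l.succ : (Fin (K + 1) → ℝ) →L[ℝ] ℝ)))) v := by
    refine HasFDerivAt.finsetProd fun l _ => ?_
    simp only [div_eq_inv_mul]
    exact ((hasFDerivAt_apply (𝕜 := ℝ) l.succ v).const_sub (a j)).const_mul _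
  have h0 : HasFDerivAt (fun v : Fin (K + 1) → ℝ => v 0)
      (ContinuousLinearMap.proj 0 : (Fin (K + 1) → ℝ) →L[ℝ] ℝ) v := hasFDerivAt_apply 0 v
  refine (h0.mul hp).congr_fderiv ?_
  ext u
  simp only [_root_.add_apply, _root_.smul_apply, _root_.sum_apply, _root_.neg_apply,
    ContinuousLinearMap.proj_apply,
    smul_eq_mul, ContinuousLinearMap.comp_apply, LinearMap.coe_toContinuousLinearMap',
    Matrix.toLin'_apply, Matrix.mulVec, dotProduct, Fin.sum_univ_succ, residueJacobian,
    Matrix.of_apply, Fin.cons_zero, Fin.cons_succ]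
  rw [add_comm, Finset.mul_sum]
  congr 1
  refine Finset.sum_congr rfl fun l _ => ?_
  rw [residueMap, ← Finset.mul_prod_erase _ _ (Finset.mem_univ l)]
  have := sub_ne_zero.2 (hne j l)
  field_simp

theorem interlacing_ne (ha : StrictMono a) {v : Fin (K + 1) → ℝ} (hv : v ∈ interlacingSet a)
    (j : Fin (K + 1)) (l : Fin K) : a j ≠ v l.succ := by
  intro h
  have := residue_ratio_pos ha hv j l
  rw [h, sub_self, zero_div] at this
  exact lt_irrefl _ this

theorem strictMono_tail_of_interlacing (ha : StrictMono a) {v : Fin (K + 1) → ℝ}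
    (hv : v ∈ interlacingSet a) : StrictMono (Fin.tail v) := by
  intro l m hlm
  have h : a l.succ ≤ a m.castSucc := ha.monotone (by
    rw [Fin.le_def]; rw [Fin.lt_def] at hlm; simp; omega)
  exact (hv.2 l).2.trans_le (h.trans (hv.2 m).1.le)

/-- Each row has its residue divided by `s` as a factor and each column but the first has `-s`; what
remains is the bordered Cauchy matrix. The denominators of the row factors multiply to `V(a)²` in
absolute value. -/
theorem abs_det_residueJacobian (ha : StrictMono a) {v : Fin (K + 1) → ℝ}
    (hv : v ∈ interlacingSet a) :
    |(residueJacobian a v).det| =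
      v 0 ^ K * ((Matrix.vandermonde (Fin.tail v)).det / (Matrix.vandermonde a).det) := by
  have hne := interlacing_ne ha hv
  have hmono := strictMono_tail_of_interlacing ha hv
  have hV := vandermonde_det_pos ha
  have hVt := vandermonde_det_pos hmono
  have hJ : residueJacobian a v = Matrix.of fun j c =>
      (∏ l : Fin K, (a j - v l.succ) / (a j - a (j.succAbove l))) *
        (Matrix.of fun j c => (Fin.cons 1 (fun _ => -v 0) : Fin (K + 1) → ℝ) c *
          borderedCauchy a (Fin.tail v) j c) j c := by
    ext j c
    refine Fin.cases ?_ (fun l => ?_) c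
    · simp [residueJacobian, borderedCauchy]
    · simp [residueJacobian, borderedCauchy, residueMap, Fin.tail]
      ring
  have hB := det_borderedCauchy (Fin.tail v) hmono.injective hne
  rw [abs_prod_erase_sub, abs_of_pos hVt, abs_of_pos hV] at hB
  have hA := abs_prod_erase_sub a
  simp only [fun i => prod_erase_eq_prod_succAbove i fun j => a i - a j] at hA
  have hBpos : |(borderedCauchy a (Fin.tail v)).det| * |∏ j, ∏ l, (a j - Fin.tail v l)|
      = (Matrix.vandermonde a).det * (Matrix.vandermonde (Fin.tail v)).det := by
    refine mul_right_cancel₀ hVt.ne' ?_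
    rw [hB]
    ring
  have hc : ∏ c, (Fin.cons 1 (fun _ => -v 0) : Fin (K + 1) → ℝ) c = (-v 0) ^ K := by
    simp [Fin.prod_univ_succ]
  rw [hJ, Matrix.det_mul_column, Matrix.det_mul_row, hc]
  simp only [Finset.prod_div_distrib]
  rw [abs_mul, abs_mul, abs_div, hA, abs_pow, abs_neg, abs_of_pos hv.1]
  change |∏ j, ∏ l, (a j - Fin.tail v l)| / _ * _ = _
  have : |∏ j, ∏ l, (a j - Fin.tail v l)| / (Matrix.vandermonde a).det ^ 2 *
      (v 0 ^ K * |(borderedCauchy a (Fin.tail v)).det|) =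
      v 0 ^ K * ((|(borderedCauchy a (Fin.tail v)).det| * |∏ j, ∏ l, (a j - Fin.tail v l)|) /
        (Matrix.vandermonde a).det ^ 2) := by ring
  rw [this, hBpos]
  field_simp

/-- Change of variables from positive residues to interlacing zeros. -/
theorem lintegral_pos_eq_lintegral_interlacing (ha : StrictMono a)
    (g : (Fin (K + 1) → ℝ) → ENNReal) :
    ∫⁻ w in {w : Fin (K + 1) → ℝ | ∀ j, 0 < w j}, g w =
      ∫⁻ v in interlacingSet a, ENNReal.ofReal (v 0 ^ K *
        ((Matrix.vandermonde (Fin.tail v)).det / (Matrix.vandermonde a).det)) *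
          g (residueMap a v) := by
  rw [← image_residueMap ha, lintegral_image_eq_lintegral_abs_det_fderiv_mul volume
    measurableSet_interlacingSet
    (fun v hv => (hasFDerivAt_residueMap (interlacing_ne ha hv)).hasFDerivWithinAt)
    (residueMap_injOn ha)]
  refine setLIntegral_congr_fun measurableSet_interlacingSet fun v hv => ?_
  simp only [ContinuousLinearMap.det, LinearMap.coe_toContinuousLinearMap, LinearMap.det_toLin']
  rw [abs_det_residueJacobian ha hv]

/-! ### Grouping independent random variables -/

/-- The joint law is a product over `ι`; currying along the fibres of `p` makes it a product over
the groups. -/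
theorem iIndepFun_fiber {Ω ι κ E : Type*} [MeasurableSpace Ω] [MeasurableSpace E]
    {μ : Measure Ω} {f : ι → Ω → E} (hf : iIndepFun f μ)
    (hm : ∀ i, Measurable (f i)) (p : ι → κ) :
    iIndepFun (fun o ω (i : {i // p i = o}) => f i ω) μ := by
  have := hf.isProbabilityMeasure
  have h1 : iIndepFun (fun (s : (o : κ) × {i // p i = o}) ω => f s.2 ω) μ :=
    hf.precomp (g := fun s : (o : κ) × {i // p i = o} => (s.2 : ι))
      (Equiv.sigmaFiberEquiv p).injective
  have h2 := (iIndepFun_iff_map_fun_eq_infinitePi_map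
    fun s : (o : κ) × {i // p i = o} => hm s.2).1 h1
  have h3 : ∀ o, μ.map (fun ω (i : {i // p i = o}) => f i ω)
      = Measure.infinitePi fun i : {i // p i = o} => μ.map (f i) := fun o =>
    (iIndepFun_iff_map_fun_eq_infinitePi_map fun i : {i // p i = o} => hm i).1
      (hf.precomp (g := fun i : {i // p i = o} => (i : ι)) Subtype.val_injective)
  have hmeas : Measurable fun ω (s : (o : κ) × {i // p i = o}) => f s.2 ω :=
    measurable_pi_lambda _ fun s => hm s.2
  rw [iIndepFun_iff_map_fun_eq_infinitePi_map fun o =>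
    measurable_pi_lambda _ fun i : {i // p i = o} => hm i]
  simp only [h3]
  have : ∀ i, IsProbabilityMeasure (μ.map (f i)) := fun i =>
    Measure.isProbabilityMeasure_map (hm i).aemeasurable
  rw [← Measure.infinitePi_map_piCurry
    (fun (o : κ) (i : {i // p i = o}) => μ.map (f i)), ← h2,
    Measure.map_map (MeasurableEquiv.measurable _) hmeas]
  rfl

/-! ### Product densities -/

theorem pi_withDensity_ofReal {ι E : Type*} [Fintype ι] [MeasurableSpace E]
    (μ : ι → Measure E) [∀ i, SigmaFinite (μ i)] (f : ι → E → ℝ)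
    (hf : ∀ i, Integrable (f i) (μ i)) (h0 : ∀ i x, 0 ≤ f i x) :
    Measure.pi (fun i => (μ i).withDensity fun x => ENNReal.ofReal (f i x)) =
      (Measure.pi μ).withDensity fun x => ENNReal.ofReal (∏ i, f i (x i)) := by
  have : ∀ i, IsFiniteMeasure ((μ i).withDensity fun x => ENNReal.ofReal (f i x)) := fun i =>
    isFiniteMeasure_withDensity_ofReal (hf i).2
  refine Measure.pi_eq fun s hs => ?_
  rw [withDensity_apply _ (MeasurableSet.univ_pi hs), Measure.restrict_pi_pi,
    ← ofReal_integral_eq_lintegral_ofReal]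
  · rw [integral_fintype_prod_eq_prod, ENNReal.ofReal_prod_of_nonneg]
    · refine Finset.prod_congr rfl fun i _ => ?_
      rw [withDensity_apply _ (hs i), ofReal_integral_eq_lintegral_ofReal (hf i).restrict
        (ae_of_all _ (h0 i))]
    · intro i _
      exact integral_nonneg (h0 i)
  · exact Integrable.fintype_prod_dep fun i => (hf i).restrict
  · exact ae_of_all _ fun x => Finset.prod_nonneg fun i _ => h0 i _

/-! ### The standard complex Gaussian distribution -/

/-- The standard complex Gaussian distribution, with density `exp (-|z|²) / π`. -/
def stdComplexGaussian : Measure ℂ :=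
  volume.withDensity fun z => ENNReal.ofReal (Real.exp (-‖z‖ ^ 2) / Real.pi)

/-- The Gamma distribution of integer shape `d + 1` and scale `1`. -/
def gammaNat (d : ℕ) : Measure ℝ :=
  (volume.restrict (Set.Ioi 0)).withDensity fun x =>
    ENNReal.ofReal (x ^ d / d.factorial * Real.exp (-x))

/-- Polar coordinates, then `x = r²`: the squared modulus is exponentially distributed. -/
theorem lintegral_normSq_stdComplexGaussian {f : ℝ → ENNReal} (hf : Measurable f) :
    ∫⁻ z, f (‖z‖ ^ 2) ∂stdComplexGaussian = ∫⁻ x, f x ∂gammaNat 0 := by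
  have hd : Measurable fun z : ℂ => ENNReal.ofReal (Real.exp (-‖z‖ ^ 2) / Real.pi) := by fun_prop
  have hd' : Measurable fun x : ℝ =>
      ENNReal.ofReal (x ^ 0 / (0 : ℕ).factorial * Real.exp (-x)) := by fun_prop
  rw [stdComplexGaussian, gammaNat, lintegral_withDensity_eq_lintegral_mul _ hd (by fun_prop),
    lintegral_withDensity_eq_lintegral_mul _ hd' hf,
    ← Complex.lintegral_comp_polarCoord_symm, polarCoord_target, Measure.volume_eq_prod,
    ← Measure.prod_restrict]
  have himg : (fun r : ℝ => r ^ 2) '' Set.Ioi 0 = Set.Ioi 0 := by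
    ext x
    constructor
    · rintro ⟨r, hr, rfl⟩
      exact pow_pos (Set.mem_Ioi.1 hr) 2
    · intro hx
      exact ⟨√x, Real.sqrt_pos.2 hx, Real.sq_sqrt (le_of_lt hx)⟩
  rw [← himg, lintegral_image_eq_lintegral_abs_deriv_mul measurableSet_Ioi
    (f' := fun r => 2 * r) (fun r _ => by
      simpa using (hasDerivAt_pow 2 r).hasDerivWithinAt)
    (fun r hr r' hr' h => (pow_left_inj₀ (le_of_lt hr) (le_of_lt hr') two_ne_zero).1 h), himg,
    lintegral_prod _ (by
      simp only [Complex.norm_polarCoord_symm, Pi.mul_apply]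
      fun_prop)]
  refine setLIntegral_congr_fun measurableSet_Ioi fun r hr => ?_
  have hr' : 0 < r := hr
  simp only [Complex.norm_polarCoord_symm, Pi.mul_apply, abs_of_pos hr', lintegral_const,
    Measure.restrict_apply_univ, Real.volume_Ioo, smul_eq_mul, pow_zero, Nat.factorial_zero,
    Nat.cast_one, div_one, one_mul]
  rw [show ENNReal.ofReal r * (ENNReal.ofReal (Real.exp (-r ^ 2) / Real.pi) * f (r ^ 2)) *
    ENNReal.ofReal (Real.pi - -Real.pi) = (ENNReal.ofReal r *
      ENNReal.ofReal (Real.exp (-r ^ 2) / Real.pi) * ENNReal.ofReal (Real.pi - -Real.pi)) *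
        f (r ^ 2) by ring, ← mul_assoc]
  congr 1
  rw [← ENNReal.ofReal_mul hr'.le, ← ENNReal.ofReal_mul (by positivity),
    ← ENNReal.ofReal_mul (by positivity), abs_of_pos (by positivity)]
  congr 1
  field_simp
  ring

theorem integrable_gammaDensity (d : ℕ) :
    IntegrableOn (fun x : ℝ => x ^ d / d.factorial * Real.exp (-x)) (Set.Ioi 0) := by
  have h := Real.GammaIntegral_convergent (s := d + 1) (by positivity)
  refine IntegrableOn.congr_fun (h.const_mul (d.factorial : ℝ)⁻¹) (fun x _ => ?_) measurableSet_Ioi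
  simp only [add_sub_cancel_right, Real.rpow_natCast]
  ring

instance isProbabilityMeasure_gammaNat (d : ℕ) : IsProbabilityMeasure (gammaNat d) := by
  constructor
  rw [gammaNat, withDensity_apply _ MeasurableSet.univ, Measure.restrict_univ,
    ← ofReal_integral_eq_lintegral_ofReal (integrable_gammaDensity d)
      ((ae_restrict_iff' measurableSet_Ioi).2 (ae_of_all _ fun x hx => by
        have : 0 < x := hx
        positivity))]
  have h := Real.Gamma_eq_integral (s := d + 1) (by positivity)
  rw [Real.Gamma_nat_eq_factorial] at h
  have h2 : ∫ x in Set.Ioi (0 : ℝ), x ^ d / d.factorial * Real.exp (-x)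
      = (d.factorial : ℝ)⁻¹ * ∫ x in Set.Ioi (0 : ℝ), Real.exp (-x) * x ^ ((d : ℝ) + 1 - 1) := by
    rw [← integral_const_mul]
    refine setIntegral_congr_fun measurableSet_Ioi fun x _ => ?_
    simp only [add_sub_cancel_right, Real.rpow_natCast]
    ring
  rw [h2, ← h, inv_mul_cancel₀ (by positivity), ENNReal.ofReal_one]

theorem map_normSq_stdComplexGaussian :
    stdComplexGaussian.map (fun z => ‖z‖ ^ 2) = gammaNat 0 := by
  refine Measure.ext_of_lintegral _ fun f hf => ?_
  rw [lintegral_map hf (by fun_prop), lintegral_normSq_stdComplexGaussian hf]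

instance : IsProbabilityMeasure stdComplexGaussian := by
  constructor
  have h := lintegral_normSq_stdComplexGaussian (f := fun _ => 1) measurable_const
  simpa using h

/-- After the substitution `u = x + y` the exponentials combine to `e^(-u)`, and `∫_0^u x^d / d! dx
= u^(d+1) / (d+1)!`. -/
theorem gammaNat_conv_gammaNat_zero (d : ℕ) : gammaNat d ∗ gammaNat 0 = gammaNat (d + 1) := by
  refine Measure.ext_of_lintegral _ fun f hf => ?_
  have hmeas : ∀ d : ℕ, Measurable fun x : ℝ =>
      ENNReal.ofReal (x ^ d / d.factorial * Real.exp (-x)) := fun d => by fun_prop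
  rw [Measure.lintegral_conv hf]
  have hinner : ∀ x : ℝ, ∫⁻ y, f (x + y) ∂gammaNat 0
      = ∫⁻ u, (Set.Ioi x).indicator (fun u => ENNReal.ofReal (Real.exp (-(u - x))) * f u) u := by
    intro x
    rw [gammaNat, lintegral_withDensity_eq_lintegral_mul _ (hmeas 0) (by fun_prop),
      ← lintegral_indicator measurableSet_Ioi,
      ← lintegral_sub_right_eq_self _ x]
    refine lintegral_congr fun u => ?_
    by_cases hu : x < u
    · rw [Set.indicator_of_mem (show u - x ∈ Set.Ioi 0 from sub_pos.2 hu),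
        Set.indicator_of_mem (show u ∈ Set.Ioi x from hu)]
      simp
    · rw [Set.indicator_of_notMem (fun h : u - x ∈ Set.Ioi 0 => hu (sub_pos.1 h)),
        Set.indicator_of_notMem (show u ∉ Set.Ioi _ from hu)]
  simp only [hinner]
  have hmi : Measurable fun p : ℝ × ℝ => (Set.Ioi p.1).indicator
      (fun u => ENNReal.ofReal (Real.exp (-(u - p.1))) * f u) p.2 := by
    have : (fun p : ℝ × ℝ => (Set.Ioi p.1).indicator
      (fun u => ENNReal.ofReal (Real.exp (-(u - p.1))) * f u) p.2) =
      {p : ℝ × ℝ | p.1 < p.2}.indicator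
        (fun p => ENNReal.ofReal (Real.exp (-(p.2 - p.1))) * f p.2) := by
      ext p
      simp [Set.indicator_apply]
    rw [this]
    exact Measurable.indicator (by fun_prop) (measurableSet_lt measurable_fst measurable_snd)
  rw [gammaNat, lintegral_withDensity_eq_lintegral_mul _ (hmeas d)
    hmi.lintegral_prod_right', gammaNat, lintegral_withDensity_eq_lintegral_mul _ (hmeas _) hf]
  simp only [Pi.mul_apply]
  have hmx : ∀ x : ℝ, Measurable fun u => (Set.Ioi x).indicator
      (fun u => ENNReal.ofReal (Real.exp (-(u - x))) * f u) u := fun x =>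
    hmi.comp measurable_prodMk_left
  simp only [← lintegral_const_mul _ (hmx _)]
  rw [lintegral_lintegral_swap ((by
    have h1 : Measurable fun p : ℝ × ℝ =>
      ENNReal.ofReal (p.1 ^ d / d.factorial * Real.exp (-p.1)) := by fun_prop
    exact (h1.mul hmi).aemeasurable)), ← lintegral_indicator measurableSet_Ioi]
  refine lintegral_congr fun u => ?_
  have hval : ∀ x : ℝ, ENNReal.ofReal (x ^ d / d.factorial * Real.exp (-x)) *
      (Set.Ioi x).indicator (fun u => ENNReal.ofReal (Real.exp (-(u - x))) * f u) u
      = (Set.Iio u).indicator (fun x => ENNReal.ofReal (Real.exp (-u)) * f u *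
        ENNReal.ofReal (x ^ d / d.factorial)) x := by
    intro x
    by_cases hx : x < u
    · rw [Set.indicator_of_mem (show u ∈ Set.Ioi x from hx),
        Set.indicator_of_mem (show x ∈ Set.Iio u from hx),
        show -u = -x + -(u - x) by ring, Real.exp_add,
        ENNReal.ofReal_mul' (Real.exp_pos _).le, ENNReal.ofReal_mul (Real.exp_pos _).le]
      ring
    · rw [Set.indicator_of_notMem (show u ∉ Set.Ioi x from hx),
        Set.indicator_of_notMem (show x ∉ Set.Iio u from hx),
        mul_zero]
  simp only [hval]
  rw [lintegral_indicator measurableSet_Iio, Measure.restrict_restrict measurableSet_Iio,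
    Set.inter_comm, Set.Ioi_inter_Iio, lintegral_const_mul _ (by fun_prop)]
  by_cases hu : 0 < u
  · rw [Set.indicator_of_mem (show u ∈ Set.Ioi 0 from hu), ← ofReal_integral_eq_lintegral_ofReal,
      ← integral_Ioc_eq_integral_Ioo, ← intervalIntegral.integral_of_le hu.le]
    · rw [intervalIntegral.integral_div, integral_pow, mul_right_comm, ← ENNReal.ofReal_mul
        (Real.exp_pos _).le]
      congr 2
      rw [Nat.factorial_succ]
      push_cast
      field_simp
      simp
    · exact (Continuous.integrableOn_Icc (by fun_prop)).mono_set Set.Ioo_subset_Icc_self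
    · exact (ae_restrict_iff' measurableSet_Ioo).2 (ae_of_all _ fun x hx => by
        have : 0 < x := hx.1
        positivity)
  · rw [Set.indicator_of_notMem (show u ∉ Set.Ioi _ from hu), Set.Ioo_eq_empty hu]
    simp

/-! ### Squared norms of blocks of Gaussian coordinates -/

/-- The distribution of a vector of independent standard complex Gaussian variables. -/
def gaussVec (ι : Type*) [Fintype ι] : Measure (ι → ℂ) := Measure.pi fun _ => stdComplexGaussian

instance (ι : Type*) [Fintype ι] : IsProbabilityMeasure (gaussVec ι) := by
  unfold gaussVec; infer_instance

theorem map_sum_normSq_gaussVec {ι : Type*} [Fintype ι] (s : Finset ι) (hs : s.Nonempty) :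
    (gaussVec ι).map (fun x => ∑ i ∈ s, ‖x i‖ ^ 2) = gammaNat (s.card - 1) := by
  classical
  have hm : ∀ i : ι, Measurable fun x : ι → ℂ => ‖x i‖ ^ 2 := fun i => by fun_prop
  have hind : iIndepFun (fun i (x : ι → ℂ) => ‖x i‖ ^ 2) (gaussVec ι) :=
    iIndepFun_pi (X := fun _ z => ‖z‖ ^ 2) fun i => by fun_prop
  have h1 : ∀ i : ι, (gaussVec ι).map (fun x => ‖x i‖ ^ 2) = gammaNat 0 := by
    intro i
    rw [← map_normSq_stdComplexGaussian,
      ← (measurePreserving_eval (fun _ : ι => stdComplexGaussian) i).map_eq,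
      Measure.map_map (by fun_prop) (by fun_prop)]
    rfl
  induction hs using Finset.Nonempty.cons_induction with
  | singleton i => simpa using h1 i
  | cons i s hi hs ih =>
    have hI := (hind.indepFun_finsetSum_of_notMem hm hi)
    have hadd := hI.map_add_eq_map_conv_map₀
      (Finset.aemeasurable_sum _ fun i _ => (hm i).aemeasurable) (hm i).aemeasurable
    have e1 : (fun x : ι → ℂ => ∑ j ∈ s, ‖x j‖ ^ 2) = ∑ j ∈ s, fun x : ι → ℂ => ‖x j‖ ^ 2 := by
      ext x; simp
    have e2 : (fun x : ι → ℂ => ∑ j ∈ Finset.cons i s hi, ‖x j‖ ^ 2)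
        = (∑ j ∈ s, fun x : ι → ℂ => ‖x j‖ ^ 2) + fun x => ‖x i‖ ^ 2 := by
      ext x
      rw [Finset.sum_cons, add_comm]
      simp
    rw [e2, hadd, ← e1, ih, h1, gammaNat_conv_gammaNat_zero, Finset.card_cons]
    congr 1
    have := hs.card_pos
    omega

/-- The squared norms of the blocks of `x` given by `p`; coordinates with `p i = none` are
discarded. -/
def blockNormSq {ι κ : Type*} [Fintype ι] [DecidableEq κ] (p : ι → Option κ) (x : ι → ℂ)
    (j : κ) : ℝ :=
  ∑ i ∈ Finset.univ.filter (fun i => p i = some j), ‖x i‖ ^ 2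

theorem measurable_blockNormSq {ι κ : Type*} [Fintype ι] [DecidableEq κ] (p : ι → Option κ) :
    Measurable (blockNormSq p) :=
  measurable_pi_lambda _ fun j => Finset.measurable_sum _ fun i _ => by fun_prop

/-- Blocks are disjoint, so their norms are independent, and a block of `d + 1` coordinates is a sum
of `d + 1` independent exponentials. -/
theorem map_blockNormSq {ι κ : Type*} [Fintype ι] [Fintype κ] [DecidableEq κ] (p : ι → Option κ)
    (d : κ → ℕ) (hd : ∀ j, (Finset.univ.filter fun i => p i = some j).card = d j + 1) :
    (gaussVec ι).map (blockNormSq p) = Measure.pi fun j => gammaNat (d j) := by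
  have hm : ∀ i : ι, Measurable fun x : ι → ℂ => ‖x i‖ ^ 2 := fun i => by fun_prop
  have hind : iIndepFun (fun i (x : ι → ℂ) => ‖x i‖ ^ 2) (gaussVec ι) :=
    iIndepFun_pi (X := fun _ z => ‖z‖ ^ 2) fun i => by fun_prop
  have h1 := iIndepFun_fiber hind hm p
  have h2 := (h1.precomp (Option.some_injective κ)).comp
    (fun j (u : {i // p i = some j} → ℝ) => ∑ i, u i) fun j =>
      Finset.measurable_sum _ fun i _ => measurable_pi_apply i
  have h3 : (fun (j : κ) (x : ι → ℂ) => blockNormSq p x j)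
      = fun j => (fun u : {i // p i = some j} → ℝ => ∑ i, u i) ∘
        fun (x : ι → ℂ) (i : {i // p i = some j}) => ‖x i‖ ^ 2 := by
    ext j x
    simp only [blockNormSq, Function.comp_apply]
    exact (Finset.sum_subtype _ (by simp) fun i => ‖x i‖ ^ 2)
  have h4 : iIndepFun (fun (j : κ) (x : ι → ℂ) => blockNormSq p x j) (gaussVec ι) := by
    rw [h3]
    exact h2
  have h5 := (iIndepFun_iff_map_fun_eq_pi_map fun j =>
    (measurable_pi_apply j |>.comp (measurable_blockNormSq p)).aemeasurable).1 h4
  refine h5.trans ?_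
  congr 1
  ext1 j
  have := map_sum_normSq_gaussVec (Finset.univ.filter fun i => p i = some j)
    (Finset.card_pos.1 (by rw [hd]; omega))
  rw [hd] at this
  exact this

theorem lintegral_blockNormSq {ι κ : Type*} [Fintype ι] [Fintype κ] [DecidableEq κ]
    (p : ι → Option κ) (d : κ → ℕ)
    (hd : ∀ j, (Finset.univ.filter fun i => p i = some j).card = d j + 1)
    {g : (κ → ℝ) → ENNReal} (hg : Measurable g) :
    ∫⁻ x, g (blockNormSq p x) ∂gaussVec ι = ∫⁻ w in {w : κ → ℝ | ∀ j, 0 < w j},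
      ENNReal.ofReal (∏ j, (w j ^ d j / (d j).factorial * Real.exp (-w j))) * g w := by
  have hset : {w : κ → ℝ | ∀ j, 0 < w j} = Set.univ.pi fun _ => Set.Ioi 0 := by
    ext w; simp
  have hpi : (Measure.pi fun j => gammaNat (d j)) =
      (volume.restrict {w : κ → ℝ | ∀ j, 0 < w j}).withDensity fun w =>
        ENNReal.ofReal (∏ j, (w j ^ d j / (d j).factorial * Real.exp (-w j))) := by
    -- `|x|` makes the density nonnegative on the whole line and changes nothing on the positive
    -- half-line.
    have h := pi_withDensity_ofReal (fun _ : κ => (volume : Measure ℝ).restrict (Set.Ioi 0))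
      (fun j x => |x| ^ d j / (d j).factorial * Real.exp (-x))
      (fun j => (integrable_gammaDensity (d j)).congr_fun (fun x hx => by
        simp only [abs_of_pos (Set.mem_Ioi.1 hx)]) measurableSet_Ioi)
      (fun j x => by positivity)
    have hg : ∀ d, gammaNat d = (volume.restrict (Set.Ioi 0)).withDensity fun x =>
        ENNReal.ofReal (|x| ^ d / d.factorial * Real.exp (-x)) := by
      intro d
      refine withDensity_congr_ae ?_
      filter_upwards [ae_restrict_mem measurableSet_Ioi] with x hx
      rw [abs_of_pos (Set.mem_Ioi.1 hx)]
    simp only [hg]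
    rw [h, ← Measure.restrict_pi_pi, ← volume_pi, hset]
    refine withDensity_congr_ae ?_
    filter_upwards [ae_restrict_mem (MeasurableSet.univ_pi fun _ => measurableSet_Ioi)] with w hw
    congr 1
    refine Finset.prod_congr rfl fun j _ => ?_
    rw [abs_of_pos (Set.mem_Ioi.1 (hw j (Set.mem_univ j)))]
  rw [← lintegral_map hg (measurable_blockNormSq p), map_blockNormSq p d hd, hpi,
    lintegral_withDensity_eq_lintegral_mul _ (by fun_prop) hg]
  rfl

/-! ### Linear images of Gaussian vectors -/

theorem gaussVec_eq_withDensity (ι : Type*) [Fintype ι] :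
    gaussVec ι = volume.withDensity fun x : ι → ℂ =>
      ENNReal.ofReal ((Real.pi ^ Fintype.card ι)⁻¹ * Real.exp (-∑ i, ‖x i‖ ^ 2)) := by
  have hint : Integrable fun z : ℂ => Real.exp (-‖z‖ ^ 2) / Real.pi := by
    refine ⟨by fun_prop, ?_⟩
    rw [hasFiniteIntegral_iff_ofReal (ae_of_all _ fun z => by positivity)]
    have : ∫⁻ z : ℂ, ENNReal.ofReal (Real.exp (-‖z‖ ^ 2) / Real.pi) = 1 := by
      have h := measure_univ (μ := stdComplexGaussian)
      rwa [stdComplexGaussian, withDensity_apply _ MeasurableSet.univ,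
        Measure.restrict_univ] at h
    rw [this]
    exact ENNReal.one_lt_top
  have h := pi_withDensity_ofReal (fun _ : ι => (volume : Measure ℂ))
    (fun _ z => Real.exp (-‖z‖ ^ 2) / Real.pi) (fun _ => hint) (fun _ z => by positivity)
  refine h.trans ?_
  rw [← volume_pi]
  congr 1
  ext1 x
  congr 1
  rw [Finset.prod_div_distrib, ← Real.exp_sum, Finset.prod_const, Finset.card_univ,
    Finset.sum_neg_distrib, div_eq_inv_mul]

/-- Densities transform under injective linear maps, up to a constant. -/
theorem exists_map_withDensity_linearMap {ι : Type*} [Fintype ι] (T : (ι → ℂ) →ₗ[ℂ] (ι → ℂ))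
    (hT : Function.Injective T) {g : (ι → ℂ) → ENNReal} (hg : Measurable g) :
    ∃ c : ENNReal, (volume.withDensity fun x => g (T x)).map T = c • volume.withDensity g := by
  set Tr : (ι → ℂ) →ₗ[ℝ] (ι → ℂ) := T.restrictScalars ℝ with hTr
  have hdet : LinearMap.det Tr ≠ 0 := by
    have hb : Function.Injective Tr := hT
    exact (LinearEquiv.isUnit_det' (LinearEquiv.ofInjectiveEndo Tr hb)).ne_zero
  have hcont : Measurable T := (LinearMap.continuous_of_finiteDimensional T).measurable
  refine ⟨ENNReal.ofReal |(LinearMap.det Tr)⁻¹|, ?_⟩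
  have hmap := Measure.map_linearMap_addHaar_eq_smul_addHaar (volume : Measure (ι → ℂ)) hdet
  refine Measure.ext_of_lintegral _ fun f hf => ?_
  have hgT : Measurable fun x => g (T x) := hg.comp hcont
  have hfT : Measurable fun x => f (T x) := hf.comp hcont
  rw [lintegral_map hf hcont, lintegral_withDensity_eq_lintegral_mul _ hgT hfT,
    lintegral_smul_measure, lintegral_withDensity_eq_lintegral_mul _ hg hf,
    ← lintegral_smul_measure, ← hmap,
    lintegral_map (hg.mul hf) (show Measurable Tr from hcont)]
  rfl

/-- Total mass fixes the constant, so Jacobian determinants of linear maps need never be evaluated.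
-/
theorem eq_of_eq_smul {E : Type*} [MeasurableSpace E] {μ ν : Measure E} [IsProbabilityMeasure μ]
    [IsProbabilityMeasure ν] {c : ENNReal} (h : μ = c • ν) : μ = ν := by
  have h1 := congrArg (fun m : Measure E => m Set.univ) h
  simp only [measure_univ, Measure.smul_apply, smul_eq_mul, mul_one] at h1
  rw [h, ← h1, one_smul]

/-- A linear map preserving the norm preserves the standard Gaussian distribution. -/
theorem measurePreserving_gaussVec {ι : Type*} [Fintype ι] (T : (ι → ℂ) →ₗ[ℂ] (ι → ℂ))
    (hT : ∀ x, ∑ i, ‖T x i‖ ^ 2 = ∑ i, ‖x i‖ ^ 2) :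
    MeasurePreserving T (gaussVec ι) (gaussVec ι) := by
  have hcont : Measurable T := (LinearMap.continuous_of_finiteDimensional T).measurable
  refine ⟨hcont, ?_⟩
  have hinj : Function.Injective T := by
    rw [injective_iff_map_eq_zero]
    intro x hx
    have h := hT x
    rw [hx] at h
    simp only [Pi.zero_apply, norm_zero, ne_eq, OfNat.ofNat_ne_zero, not_false_eq_true, zero_pow,
      Finset.sum_const_zero] at h
    funext i
    have := (Finset.sum_eq_zero_iff_of_nonneg fun i _ => by positivity).1 h.symm i
      (Finset.mem_univ i)
    simpa using this
  obtain ⟨c, hc⟩ := exists_map_withDensity_linearMap T hinj (g := fun x : ι → ℂ =>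
    ENNReal.ofReal ((Real.pi ^ Fintype.card ι)⁻¹ * Real.exp (-∑ i, ‖x i‖ ^ 2))) (by fun_prop)
  simp only [hT] at hc
  rw [← gaussVec_eq_withDensity] at hc
  have : IsProbabilityMeasure ((gaussVec ι).map T) :=
    Measure.isProbabilityMeasure_map hcont.aemeasurable
  exact eq_of_eq_smul hc

/-! ### Simultaneous diagonalization -/

theorem exists_unitary_diagonalization {k : ℕ} {A : Matrix (Fin k) (Fin k) ℂ}
    (hA : A.IsHermitian) : ∃ U : Matrix (Fin k) (Fin k) ℂ, Uᴴ * U = 1 ∧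
      Uᴴ * A * U = Matrix.diagonal fun i => (hA.eigenvalues i : ℂ) := by
  refine ⟨hA.eigenvectorUnitary, Unitary.coe_star_mul_self _, ?_⟩
  have h := hA.conjStarAlgAut_star_eigenvectorUnitary
  rw [Unitary.conjStarAlgAut_apply] at h
  simp only [Unitary.coe_star, star_star] at h
  exact h

/-- Scaling an eigenbasis of `B` by inverse square roots of its eigenvalues turns `B` into `1`; a
further unitary change diagonalizes `A` and keeps the identity. -/
theorem exists_simultaneous_diagonalization {k : ℕ} {A B : Matrix (Fin k) (Fin k) ℂ}
    (hA : A.IsHermitian) (hB : B.PosDef) :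
    ∃ (T : Matrix (Fin k) (Fin k) ℂ) (x : Fin k → ℝ), Tᴴ * B * T = 1 ∧
      Tᴴ * A * T = Matrix.diagonal fun i => (x i : ℂ) := by
  obtain ⟨U, hU, hUB⟩ := exists_unitary_diagonalization hB.isHermitian
  set r : Fin k → ℂ := fun i => ((√(hB.isHermitian.eigenvalues i))⁻¹ : ℝ) with hr
  set R := U * Matrix.diagonal r with hR
  have hRH : Rᴴ = Matrix.diagonal r * Uᴴ := by
    rw [hR, Matrix.conjTranspose_mul, Matrix.diagonal_conjTranspose]
    congr 2
    ext i
    simp [hr]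
  have hRB : Rᴴ * B * R = 1 := by
    have : Rᴴ * B * R = Matrix.diagonal r * (Uᴴ * B * U) * Matrix.diagonal r := by
      rw [hRH, hR]
      simp only [Matrix.mul_assoc]
    rw [this, hUB, Matrix.diagonal_mul_diagonal, Matrix.diagonal_mul_diagonal,
      ← Matrix.diagonal_one]
    congr 1
    ext i
    have hpos := hB.eigenvalues_pos i
    have hs : √(hB.isHermitian.eigenvalues i) ≠ 0 := (Real.sqrt_pos.2 hpos).ne'
    simp only [hr]
    rw [← Complex.ofReal_mul, ← Complex.ofReal_mul, ← Complex.ofReal_one]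
    congr 1
    rw [mul_right_comm, ← mul_inv, Real.mul_self_sqrt hpos.le, inv_mul_cancel₀ hpos.ne']
  have hH : (Rᴴ * A * R).IsHermitian := Matrix.isHermitian_conjTranspose_mul_mul R hA
  obtain ⟨V, hV, hVA⟩ := exists_unitary_diagonalization hH
  refine ⟨R * V, hH.eigenvalues, ?_, ?_⟩
  · rw [Matrix.conjTranspose_mul]
    calc Vᴴ * Rᴴ * B * (R * V) = Vᴴ * (Rᴴ * B * R) * V := by simp only [Matrix.mul_assoc]
      _ = 1 := by rw [hRB, Matrix.mul_one, hV]
  · rw [Matrix.conjTranspose_mul]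
    calc Vᴴ * Rᴴ * A * (R * V) = Vᴴ * (Rᴴ * A * R) * V := by simp only [Matrix.mul_assoc]
      _ = _ := hVA

/-! ### The pencil of two Gram matrices -/

section Pencil

variable {m₁ m₂ : ℕ}

/-- The matrix with columns `Y j`. -/
def colMatrix {ι κ : Type*} (Y : κ → ι → ℂ) : Matrix ι κ ℂ := Matrix.of fun r j => Y j r

/-- The diagonal weights `p` on the first block and `q` on the second one. -/
def blockWeight (m₁ m₂ : ℕ) (p q : ℝ) : Matrix (Fin m₁ ⊕ Fin m₂) (Fin m₁ ⊕ Fin m₂) ℂ :=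
  Matrix.diagonal (Sum.elim (fun _ => (p : ℂ)) fun _ => (q : ℂ))

/-- The matrix `p W₁ + q W₂`, where `W₁` and `W₂` are the Gram matrices of the two blocks of the
columns. -/
def pencil {κ : Type*} (Y : κ → Fin m₁ ⊕ Fin m₂ → ℂ) (p q : ℝ) : Matrix κ κ ℂ :=
  (colMatrix Y)ᴴ * blockWeight m₁ m₂ p q * colMatrix Y

/-- The determinant of `p W₁ + q W₂`. -/
def pencilDet {κ : Type*} [Fintype κ] [DecidableEq κ] (Y : κ → Fin m₁ ⊕ Fin m₂ → ℂ) (p q : ℝ) : ℝ :=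
  (pencil Y p q).det.re

theorem pencil_apply {κ : Type*} (Y : κ → Fin m₁ ⊕ Fin m₂ → ℂ) (p q : ℝ) (i j : κ) :
    pencil Y p q i j = p * ∑ r, star (Y i (Sum.inl r)) * Y j (Sum.inl r) +
      q * ∑ r, star (Y i (Sum.inr r)) * Y j (Sum.inr r) := by
  rw [pencil, blockWeight, Matrix.mul_apply]
  simp only [Matrix.mul_diagonal, Fintype.sum_sum_type, Matrix.conjTranspose_apply, colMatrix,
    Matrix.of_apply, Sum.elim_inl, Sum.elim_inr,
    Finset.mul_sum]
  congr 1 <;> exact Finset.sum_congr rfl fun r _ => by ring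

theorem pencil_eq_add {κ : Type*} (Y : κ → Fin m₁ ⊕ Fin m₂ → ℂ) (p q : ℝ) :
    pencil Y p q = (p : ℂ) • pencil Y 1 0 + (q : ℂ) • pencil Y 0 1 := by
  ext i j
  simp [pencil_apply]

theorem pencil_posSemidef {κ : Type*} [Fintype κ] (Y : κ → Fin m₁ ⊕ Fin m₂ → ℂ) {p q : ℝ}
    (hp : 0 ≤ p) (hq : 0 ≤ q) : (pencil Y p q).PosSemidef := by
  refine Matrix.PosSemidef.conjTranspose_mul_mul_same ?_ _
  refine Matrix.PosSemidef.diagonal ?_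
  rintro (r | r)
  · simpa using hp
  · simpa using hq

theorem pencil_det_eq {κ : Type*} [Fintype κ] [DecidableEq κ] (Y : κ → Fin m₁ ⊕ Fin m₂ → ℂ)
    {p q : ℝ} (hp : 0 ≤ p) (hq : 0 ≤ q) : (pencil Y p q).det = (pencilDet Y p q : ℂ) := by
  refine (Complex.conj_eq_iff_re.1 ?_).symm
  have h := (pencil_posSemidef Y hp hq).isHermitian
  exact (Matrix.det_conjTranspose _).symm.trans (congrArg Matrix.det h)

/-- The roots `φ` of the pencil: `det (z (W₁ + W₂) - W₁) = det (W₁ + W₂) ∏ (z - φ_i)`, with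
`W₁ + W₂` invertible. -/
def HasRoots {k : ℕ} (Y : Fin k → Fin m₁ ⊕ Fin m₂ → ℂ) (φ : Fin k → ℝ) : Prop :=
  0 < pencilDet Y 1 1 ∧ ∀ z : ℝ, 1 < z → pencilDet Y (z - 1) z = pencilDet Y 1 1 * ∏ i, (z - φ i)

theorem poly_eq_of_eval_gt_one {P Q : ℝ[X]} (h : ∀ z : ℝ, 1 < z → P.eval z = Q.eval z) : P = Q :=
  Polynomial.eq_of_infinite_eval_eq _ _ ((Set.Ioi_infinite (1 : ℝ)).mono fun z hz => h z hz)

/-- `W₁ + W₂` is positive definite because it is positive semidefinite with nonzero determinant, so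
it can be diagonalized simultaneously with `W₁`. The two factorizations of `det (z (W₁ + W₂) - W₁)`
agree for `z > 1`, hence as polynomials, so the diagonal entries are the `φ_i` up to order;
permuting the columns of `T` puts them in order. -/
theorem HasRoots.exists_diagonalization {k : ℕ} {Y : Fin k → Fin m₁ ⊕ Fin m₂ → ℂ} {φ : Fin k → ℝ}
    (hY : HasRoots Y φ) (hφ : Function.Injective φ) :
    ∃ T : Matrix (Fin k) (Fin k) ℂ, Tᴴ * pencil Y 1 0 * T = Matrix.diagonal (fun i => (φ i : ℂ)) ∧
      Tᴴ * pencil Y 0 1 * T = Matrix.diagonal (fun i => ((1 - φ i : ℝ) : ℂ)) := by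
  have hadd : ∀ p q : ℝ, pencil Y p q = (p : ℂ) • pencil Y 1 0 + (q : ℂ) • pencil Y 0 1 :=
    pencil_eq_add Y
  have hW : (pencil Y 1 1).PosDef := by
    rw [(pencil_posSemidef Y zero_le_one zero_le_one).posDef_iff_det_ne_zero,
      pencil_det_eq Y zero_le_one zero_le_one]
    exact_mod_cast hY.1.ne'
  obtain ⟨T, x, h1, h2⟩ := exists_simultaneous_diagonalization
    (pencil_posSemidef Y zero_le_one le_rfl).isHermitian hW
  have h3 : Tᴴ * pencil Y 0 1 * T = Matrix.diagonal (fun i => ((1 - x i : ℝ) : ℂ)) := by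
    have h4 : pencil Y 0 1 = pencil Y 1 1 - pencil Y 1 0 := by
      rw [hadd 1 1]; simp
    rw [h4, Matrix.mul_sub, Matrix.sub_mul, h1, h2, ← Matrix.diagonal_one,
      Matrix.diagonal_sub]
    congr 1
    ext i
    simp
  have hdet : ∀ z : ℝ, 1 < z → ∏ i, (z - x i) = ∏ i, (z - φ i) := by
    intro z hz
    have e1 : Tᴴ * pencil Y (z - 1) z * T = Matrix.diagonal (fun i => ((z - x i : ℝ) : ℂ)) := by
      rw [hadd, Matrix.mul_add, Matrix.add_mul, Matrix.mul_smul, Matrix.smul_mul, Matrix.mul_smul,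
        Matrix.smul_mul, h2, h3, ← Matrix.diagonal_smul, ← Matrix.diagonal_smul,
        Matrix.diagonal_add]
      congr 1
      ext i
      simp
      ring
    have d1 := congrArg Matrix.det h1
    have d2 := congrArg Matrix.det e1
    rw [Matrix.det_mul, Matrix.det_mul, Matrix.det_one] at d1
    rw [Matrix.det_mul, Matrix.det_mul, Matrix.det_diagonal,
      pencil_det_eq Y (by linarith) (by linarith), hY.2 z hz] at d2
    rw [pencil_det_eq Y zero_le_one zero_le_one] at d1
    have d3 : ((∏ i, (z - φ i) : ℝ) : ℂ) = ((∏ i, (z - x i) : ℝ) : ℂ) := by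
      rw [Complex.ofReal_prod _ (fun i => z - x i), ← d2]
      push_cast
      linear_combination (-∏ i, ((z : ℂ) - φ i)) * d1
    exact_mod_cast d3.symm
  have hpoly : (∏ i, (X - C (x i)) : ℝ[X]) = ∏ i, (X - C (φ i)) :=
    poly_eq_of_eval_gt_one fun z hz => by simpa [eval_prod] using hdet z hz
  have hex : ∀ i, ∃ j, x j = φ i := by
    intro i
    have := congrArg (eval (φ i)) hpoly
    simp only [eval_prod, eval_sub, eval_X, eval_C] at this
    rw [Finset.prod_eq_zero (f := fun j => φ i - φ j) (Finset.mem_univ i) (sub_self _)] at this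
    obtain ⟨j, -, hj⟩ := Finset.prod_eq_zero_iff.1 this
    exact ⟨j, (sub_eq_zero.1 hj).symm⟩
  choose σ hσ using hex
  have hσi : Function.Injective σ := fun i j hij => hφ (by rw [← hσ i, ← hσ j, hij])
  have hsub : ∀ (B : Matrix (Fin k) (Fin k) ℂ) (d : Fin k → ℂ), Tᴴ * B * T = Matrix.diagonal d →
      (T.submatrix id σ)ᴴ * B * T.submatrix id σ = Matrix.diagonal (d ∘ σ) := by
    intro B d h
    have : (T.submatrix id σ)ᴴ * B * T.submatrix id σ = (Tᴴ * B * T).submatrix σ σ := by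
      ext i j
      simp [Matrix.mul_apply]
    rw [this, h, Matrix.submatrix_diagonal _ _ hσi]
  refine ⟨T.submatrix id σ, ?_, ?_⟩
  · rw [hsub _ _ h2]
    congr 1
    ext i
    simp [hσ]
  · rw [hsub _ _ h3]
    congr 1
    ext i
    simp [hσ]

/-- Adding a column to a pencil, by the Schur complement. -/
theorem pencil_cons_det {k : ℕ} (Y : Fin k → Fin m₁ ⊕ Fin m₂ → ℂ) (y : Fin m₁ ⊕ Fin m₂ → ℂ)
    (p q : ℝ) (T : Matrix (Fin k) (Fin k) ℂ) (L : Fin k → ℝ) (hL : ∀ i, L i ≠ 0)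
    (hT : Tᴴ * pencil Y p q * T = Matrix.diagonal fun i => (L i : ℂ)) :
    (pencil (Fin.cons y Y : Fin (k + 1) → Fin m₁ ⊕ Fin m₂ → ℂ) p q).det =
      (pencil Y p q).det * (star y ⬝ᵥ (blockWeight m₁ m₂ p q *ᵥ y) -
        ∑ i, star (∑ r, star ((colMatrix Y * T) r i) * (blockWeight m₁ m₂ p q *ᵥ y) r) *
          (∑ r, star ((colMatrix Y * T) r i) * (blockWeight m₁ m₂ p q *ᵥ y) r) / L i) := by
  set D := blockWeight m₁ m₂ p q with hD
  set M := colMatrix Y with hM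
  set N : Matrix (Fin m₁ ⊕ Fin m₂) Unit ℂ := Matrix.of fun r _ => y r with hN
  have hDH : Dᴴ = D := by
    rw [hD, blockWeight, Matrix.diagonal_conjTranspose]
    congr 1
    ext (r | r) <;> simp
  let e : Unit ⊕ Fin k ≃ Fin (k + 1) :=
    (Equiv.sumComm _ _).trans ((Equiv.optionEquivSumPUnit (Fin k)).symm.trans (finSuccEquiv k).symm)
  have he0 : ∀ u, e (Sum.inl u) = 0 := fun u => by simp [e]
  have he1 : ∀ i, e (Sum.inr i) = i.succ := fun i => by simp [e]
  have h1 : (pencil (Fin.cons y Y : Fin (k + 1) → Fin m₁ ⊕ Fin m₂ → ℂ) p q).submatrix e e =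
      Matrix.fromBlocks (Nᴴ * D * N) (Nᴴ * D * M) (Mᴴ * D * N) (pencil Y p q) := by
    have hc : (colMatrix (Fin.cons y Y : Fin (k + 1) → Fin m₁ ⊕ Fin m₂ → ℂ)).submatrix id e
        = Matrix.fromCols N M := by
      ext r (u | i)
      · simp [colMatrix, he0, hN]
      · simp [colMatrix, he1, hM]
    have hp : (pencil (Fin.cons y Y : Fin (k + 1) → Fin m₁ ⊕ Fin m₂ → ℂ) p q).submatrix e e
        = ((colMatrix (Fin.cons y Y : Fin (k + 1) → Fin m₁ ⊕ Fin m₂ → ℂ)).submatrix id e)ᴴ * D *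
          (colMatrix (Fin.cons y Y : Fin (k + 1) → Fin m₁ ⊕ Fin m₂ → ℂ)).submatrix id e := by
      ext i j
      simp [pencil, Matrix.mul_apply, hD]
    rw [hp, hc, Matrix.conjTranspose_fromCols_eq_fromRows_conjTranspose, Matrix.fromRows_mul,
      Matrix.fromRows_mul_fromCols]
    rfl
  have hTdet : IsUnit T.det := by
    have h := congrArg Matrix.det hT
    rw [Matrix.det_mul, Matrix.det_diagonal] at h
    refine isUnit_iff_ne_zero.2 fun h0 => ?_
    rw [h0, mul_zero] at h
    exact Finset.prod_ne_zero_iff.2 (fun i _ => Complex.ofReal_ne_zero.2 (hL i)) h.symm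
  set Li : Matrix (Fin k) (Fin k) ℂ := Matrix.diagonal fun i => ((L i : ℂ))⁻¹ with hLi
  have hdiag : Matrix.diagonal (fun i => (L i : ℂ)) * Li = 1 := by
    rw [hLi, Matrix.diagonal_mul_diagonal, ← Matrix.diagonal_one]
    congr 1
    ext i
    exact mul_inv_cancel₀ (Complex.ofReal_ne_zero.2 (hL i))
  -- The congruence by `T` diagonalizes the pencil, so its inverse is explicit and the Schur
  -- complement becomes a sum over `i`.
  have hPinv : pencil Y p q * (T * Li * Tᴴ) = 1 := by
    have hTH : IsUnit Tᴴ.det := by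
      rw [Matrix.det_conjTranspose]
      exact hTdet.star
    have h2 : Tᴴ * (pencil Y p q * (T * Li * Tᴴ)) = Tᴴ := by
      calc _ = (Tᴴ * pencil Y p q * T) * Li * Tᴴ := by simp only [Matrix.mul_assoc]
        _ = _ := by rw [hT, hdiag, Matrix.one_mul]
    calc _ = (Tᴴ)⁻¹ * (Tᴴ * (pencil Y p q * (T * Li * Tᴴ))) := by
          rw [← Matrix.mul_assoc (Tᴴ)⁻¹ Tᴴ, Matrix.nonsing_inv_mul _ hTH, Matrix.one_mul]
      _ = 1 := by rw [h2, Matrix.nonsing_inv_mul _ hTH]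
  let : Invertible (pencil Y p q) := invertibleOfRightInverse _ _ hPinv
  have hinv : ⅟(pencil Y p q) = T * Li * Tᴴ := rfl
  rw [← Matrix.det_submatrix_equiv_self e, h1, Matrix.det_fromBlocks₂₂, hinv]
  congr 1
  rw [Matrix.det_unique, Matrix.sub_apply]
  congr 1
  · rw [Matrix.mul_assoc, Matrix.mul_apply]
    rfl
  · have hv : Nᴴ * D * M * (T * Li * Tᴴ) * (Mᴴ * D * N) =
        ((M * T)ᴴ * (D * N))ᴴ * Li * ((M * T)ᴴ * (D * N)) := by
      simp only [Matrix.conjTranspose_mul, Matrix.conjTranspose_conjTranspose, hDH,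
        Matrix.mul_assoc]
    have hDN : ∀ r u, (D * N) r u = (D *ᵥ y) r := by
      intro r u
      rw [Matrix.mul_apply]
      rfl
    rw [hv, Matrix.mul_apply]
    refine Finset.sum_congr rfl fun i _ => ?_
    rw [hLi, Matrix.mul_diagonal, Matrix.conjTranspose_apply, Matrix.mul_apply]
    simp only [hDN, Matrix.conjTranspose_apply]
    ring

end Pencil

/-- A linear isometry whose first coordinates are the coefficients along an orthonormal family. -/
theorem exists_isometry_of_orthonormal {k d m : ℕ} (hm : m = k + d) (q : Fin k → Fin m → ℂ)
    (hq : ∀ i j, ∑ r, star (q i r) * q j r = if i = j then 1 else 0) :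
    ∃ C : (Fin m → ℂ) →ₗ[ℂ] (Fin k ⊕ Fin d → ℂ),
      (∀ x, ∑ s, ‖C x s‖ ^ 2 = ∑ r, ‖x r‖ ^ 2) ∧
      ∀ x i, C x (Sum.inl i) = ∑ r, star (q i r) * x r := by
  let v : Fin k ⊕ Fin d → EuclideanSpace ℂ (Fin m) := Sum.elim (fun i => WithLp.toLp 2 (q i)) 0
  have hinner : ∀ x y : EuclideanSpace ℂ (Fin m), inner ℂ x y = ∑ r, star (x r) * y r := by
    intro x y
    simp [PiLp.inner_apply, mul_comm]
  have hv : Orthonormal ℂ ((Set.range (Sum.inl : Fin k → Fin k ⊕ Fin d)).domRestrict v) := by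
    rw [orthonormal_iff_ite]
    rintro ⟨_, i, rfl⟩ ⟨_, j, rfl⟩
    refine (hinner _ _).trans ((hq i j).trans (if_congr ?_ rfl rfl))
    exact ⟨fun h => by rw [h], fun h => Sum.inl_injective (congrArg Subtype.val h)⟩
  obtain ⟨b, hb⟩ := hv.exists_orthonormalBasis_extension_of_card_eq (by simp [hm])
  refine ⟨LinearMap.pi fun s => (innerSL ℂ (b s)).toLinearMap ∘ₗ
    (WithLp.linearEquiv 2 ℂ (Fin m → ℂ)).symm.toLinearMap, fun x => ?_, fun x i => ?_⟩
  · have := b.sum_sq_norm_inner_right (WithLp.toLp 2 x)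
    rw [EuclideanSpace.norm_sq_eq] at this
    exact this
  · have h1 : b (Sum.inl i) = WithLp.toLp 2 (q i) := hb _ ⟨i, rfl⟩
    change inner ℂ (b (Sum.inl i)) (WithLp.toLp 2 x) = _
    rw [h1, hinner]

theorem rotation_norm_sq (f g : ℝ) (hfg : f ^ 2 + g ^ 2 = 1) (a b : ℂ) :
    ‖(g : ℂ) * a - f * b‖ ^ 2 + ‖(f : ℂ) * a + g * b‖ ^ 2 = ‖a‖ ^ 2 + ‖b‖ ^ 2 := by
  simp only [Complex.sq_norm, Complex.normSq_apply, Complex.sub_re, Complex.sub_im, Complex.add_re,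
    Complex.add_im, Complex.re_ofReal_mul, Complex.im_ofReal_mul]
  linear_combination (a.re ^ 2 + a.im ^ 2 + b.re ^ 2 + b.im ^ 2) * hfg

/-- Lagrange's identity, the defect in the Cauchy–Schwarz inequality for the weights `p`, `q`. -/
theorem schur_norm_sq {p q f g L : ℝ} (hL : L = p * f ^ 2 + q * g ^ 2) (hL0 : L ≠ 0) (a b : ℂ) :
    p * ‖a‖ ^ 2 + q * ‖b‖ ^ 2 - ‖(p : ℂ) * (f * a) + q * (g * b)‖ ^ 2 / L =
      p * q * ‖(g : ℂ) * a - f * b‖ ^ 2 / L := by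
  rw [sub_eq_iff_eq_add, ← add_div, eq_div_iff hL0, hL]
  simp only [Complex.sq_norm, Complex.normSq_apply, Complex.sub_re, Complex.sub_im, Complex.add_re,
    Complex.add_im, Complex.re_ofReal_mul, Complex.im_ofReal_mul]
  ring

/-! ### Schur complement of a new column in adapted coordinates -/

section Step

variable {k e₁ e₂ m₁ m₂ : ℕ} {Y : Fin k → Fin m₁ ⊕ Fin m₂ → ℂ} {φ : Fin k → ℝ}

/-- Adding a column to a pencil with given roots, in coordinates adapted to the pencil. -/
theorem HasRoots.exists_isometry_pencilDet_cons {d₁ d₂ : ℕ} (h₁ : m₁ = k + d₁) (h₂ : m₂ = k + d₂)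
    (hY : HasRoots Y φ) (hφ : Function.Injective φ) (hφ0 : ∀ i, 0 < φ i) (hφ1 : ∀ i, φ i < 1) :
    ∃ A : (Fin m₁ ⊕ Fin m₂ → ℂ) →ₗ[ℂ] ((Fin k ⊕ Fin d₁) ⊕ (Fin k ⊕ Fin d₂) → ℂ),
      (∀ y, ∑ s, ‖A y s‖ ^ 2 = ∑ r, ‖y r‖ ^ 2) ∧
      ∀ y, ∀ p q : ℝ, 0 < p → 0 < q →
        pencilDet (Fin.cons y Y : Fin (k + 1) → Fin m₁ ⊕ Fin m₂ → ℂ) p q = pencilDet Y p q *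
          (p * ∑ j, ‖A y (Sum.inl (Sum.inr j))‖ ^ 2 + q * ∑ j, ‖A y (Sum.inr (Sum.inr j))‖ ^ 2 +
            ∑ i, p * q * ‖A y (Sum.inl (Sum.inl i))‖ ^ 2 / (p * φ i + q * (1 - φ i))) := by
  obtain ⟨T, hT1, hT2⟩ := hY.exists_diagonalization hφ
  set Z : Fin k → Fin m₁ ⊕ Fin m₂ → ℂ := fun i r => (colMatrix Y * T) r i with hZ
  have hpZ : ∀ p q, pencil Z p q = Tᴴ * pencil Y p q * T := by
    intro p q
    have : colMatrix Z = colMatrix Y * T := rfl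
    rw [pencil, pencil, this, Matrix.conjTranspose_mul]
    simp only [Matrix.mul_assoc]
  -- The diagonalizing combinations `Z i` have orthogonal upper parts of norm `√φ_i` and orthogonal
  -- lower parts of norm `√(1 - φ_i)`; dividing by these norms gives an orthonormal family in each
  -- block.
  set f : Fin k → ℝ := fun i => √(φ i) with hf
  set g : Fin k → ℝ := fun i => √(1 - φ i) with hg
  have hf0 : ∀ i, 0 < f i := fun i => Real.sqrt_pos.2 (hφ0 i)
  have hg0 : ∀ i, 0 < g i := fun i => Real.sqrt_pos.2 (sub_pos.2 (hφ1 i))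
  have hf2 : ∀ i, f i ^ 2 = φ i := fun i => Real.sq_sqrt (hφ0 i).le
  have hg2 : ∀ i, g i ^ 2 = 1 - φ i := fun i => Real.sq_sqrt (sub_pos.2 (hφ1 i)).le
  have hZ1 : ∀ i j, ∑ r, star (Z i (Sum.inl r)) * Z j (Sum.inl r) =
      if i = j then (φ i : ℂ) else 0 := by
    intro i j
    have := congrFun (congrFun ((hpZ 1 0).trans hT1) i) j
    rw [pencil_apply, Matrix.diagonal_apply] at this
    simpa using this
  have hZ2 : ∀ i j, ∑ r, star (Z i (Sum.inr r)) * Z j (Sum.inr r) =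
      if i = j then ((1 - φ i : ℝ) : ℂ) else 0 := by
    intro i j
    have := congrFun (congrFun ((hpZ 0 1).trans hT2) i) j
    rw [pencil_apply, Matrix.diagonal_apply] at this
    simpa using this
  have horth : ∀ {m : ℕ} (z : Fin k → Fin m → ℂ) (c : Fin k → ℝ), (∀ i, 0 < c i) →
      (∀ i j, ∑ r, star (z i r) * z j r = if i = j then ((c i ^ 2 : ℝ) : ℂ) else 0) →
      ∀ i j, ∑ r, star (z i r / c i) * (z j r / c j) = if i = j then 1 else 0 := by
    intro m z c hc hz i j
    have : ∀ r, star (z i r / c i) * (z j r / c j) =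
        ((c i : ℂ) * c j)⁻¹ * (star (z i r) * z j r) := by
      intro r
      simp only [star_div₀, Complex.star_def, Complex.conj_ofReal]
      rw [div_mul_div_comm, div_eq_inv_mul]
    simp only [this]
    rw [← Finset.mul_sum, hz]
    split_ifs with hij
    · subst hij
      have : (c i : ℂ) ≠ 0 := Complex.ofReal_ne_zero.2 (hc i).ne'
      push_cast
      field_simp
    · simp
  obtain ⟨C₁, hC1, hC1'⟩ := exists_isometry_of_orthonormal h₁
    (fun i r => Z i (Sum.inl r) / f i) (horth _ f hf0 fun i j => by rw [hf2]; exact hZ1 i j)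
  obtain ⟨C₂, hC2, hC2'⟩ := exists_isometry_of_orthonormal h₂
    (fun i r => Z i (Sum.inr r) / g i) (horth _ g hg0 fun i j => by rw [hg2]; exact hZ2 i j)
  have hc : ∀ {m : ℕ} (z x : Fin m → ℂ) (c : ℝ), 0 < c →
      ∑ r, star (z r) * x r = c * ∑ r, star (z r / c) * x r := by
    intro m z x c hc
    rw [Finset.mul_sum]
    refine Finset.sum_congr rfl fun r _ => ?_
    have : (c : ℂ) ≠ 0 := Complex.ofReal_ne_zero.2 hc.ne'
    simp only [star_div₀, Complex.star_def, Complex.conj_ofReal]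
    field_simp
  let P₁ : (Fin m₁ ⊕ Fin m₂ → ℂ) →ₗ[ℂ] (Fin k ⊕ Fin d₁ → ℂ) := C₁ ∘ₗ LinearMap.funLeft ℂ ℂ Sum.inl
  let P₂ : (Fin m₁ ⊕ Fin m₂ → ℂ) →ₗ[ℂ] (Fin k ⊕ Fin d₂ → ℂ) := C₂ ∘ₗ LinearMap.funLeft ℂ ℂ Sum.inr
  let co : ∀ {κ : Type} (i : κ), (κ → ℂ) →ₗ[ℂ] ℂ := fun i => LinearMap.proj i
  -- For each `i`, the coordinates `(a, b)` of `y` along the two normalized parts of `Z i` are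
  -- rotated. The combination `f a + g b`, the component along `Z i`, drops out of the Schur
  -- complement; only `g a - f b` survives.
  let A : (Fin m₁ ⊕ Fin m₂ → ℂ) →ₗ[ℂ] ((Fin k ⊕ Fin d₁) ⊕ (Fin k ⊕ Fin d₂) → ℂ) :=
    LinearMap.pi (Sum.elim
      (Sum.elim (fun i => (g i : ℂ) • (co (Sum.inl i) ∘ₗ P₁) - (f i : ℂ) • (co (Sum.inl i) ∘ₗ P₂))
        fun j => co (Sum.inr j) ∘ₗ P₁)
      (Sum.elim (fun i => (f i : ℂ) • (co (Sum.inl i) ∘ₗ P₁) + (g i : ℂ) • (co (Sum.inl i) ∘ₗ P₂))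
        fun j => co (Sum.inr j) ∘ₗ P₂))
  have hP1 : ∀ y, ∑ i, ‖P₁ y (Sum.inl i)‖ ^ 2 + ∑ j, ‖P₁ y (Sum.inr j)‖ ^ 2 =
      ∑ r, ‖y (Sum.inl r)‖ ^ 2 := fun y => by
    rw [← Fintype.sum_sum_type (f := fun s => ‖P₁ y s‖ ^ 2)]
    exact hC1 _
  have hP2 : ∀ y, ∑ i, ‖P₂ y (Sum.inl i)‖ ^ 2 + ∑ j, ‖P₂ y (Sum.inr j)‖ ^ 2 =
      ∑ r, ‖y (Sum.inr r)‖ ^ 2 := fun y => by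
    rw [← Fintype.sum_sum_type (f := fun s => ‖P₂ y s‖ ^ 2)]
    exact hC2 _
  have hA1 : ∀ y i, A y (Sum.inl (Sum.inl i)) =
    g i * P₁ y (Sum.inl i) - f i * P₂ y (Sum.inl i) := fun _ _ => rfl
  have hA2 : ∀ y i, A y (Sum.inr (Sum.inl i)) =
    f i * P₁ y (Sum.inl i) + g i * P₂ y (Sum.inl i) := fun _ _ => rfl
  have hA3 : ∀ y j, A y (Sum.inl (Sum.inr j)) = P₁ y (Sum.inr j) := fun _ _ => rfl
  have hA4 : ∀ y j, A y (Sum.inr (Sum.inr j)) = P₂ y (Sum.inr j) := fun _ _ => rfl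
  refine ⟨A, fun y => ?_, fun y p q hp hq => ?_⟩
  · rw [Fintype.sum_sum_type, Fintype.sum_sum_type, Fintype.sum_sum_type, Fintype.sum_sum_type,
      ← hP1, ← hP2]
    simp only [hA1, hA2, hA3, hA4]
    have : ∑ i, ‖(g i : ℂ) * P₁ y (Sum.inl i) - f i * P₂ y (Sum.inl i)‖ ^ 2 +
        ∑ i, ‖(f i : ℂ) * P₁ y (Sum.inl i) + g i * P₂ y (Sum.inl i)‖ ^ 2 =
        ∑ i, ‖P₁ y (Sum.inl i)‖ ^ 2 + ∑ i, ‖P₂ y (Sum.inl i)‖ ^ 2 := by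
      rw [← Finset.sum_add_distrib, ← Finset.sum_add_distrib]
      exact Finset.sum_congr rfl fun i _ => rotation_norm_sq _ _ (by rw [hf2, hg2]; ring) _ _
    linarith
  · set L : Fin k → ℝ := fun i => p * φ i + q * (1 - φ i) with hL
    have hL0 : ∀ i, 0 < L i := fun i =>
      add_pos (mul_pos hp (hφ0 i)) (mul_pos hq (sub_pos.2 (hφ1 i)))
    have hTL : Tᴴ * pencil Y p q * T = Matrix.diagonal fun i => (L i : ℂ) := by
      rw [pencil_eq_add, Matrix.mul_add, Matrix.add_mul, Matrix.mul_smul, Matrix.smul_mul,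
        Matrix.mul_smul, Matrix.smul_mul, hT1, hT2, ← Matrix.diagonal_smul, ← Matrix.diagonal_smul,
        Matrix.diagonal_add]
      congr 1
      ext i
      simp [hL]
    have key := pencil_cons_det Y y p q T L (fun i => (hL0 i).ne') hTL
    rw [pencil_det_eq _ hp.le hq.le, pencil_det_eq _ hp.le hq.le] at key
    have hDy1 : ∀ r, (blockWeight m₁ m₂ p q *ᵥ y) (Sum.inl r) = p * y (Sum.inl r) := fun r => by
      simp [blockWeight, Matrix.mulVec_diagonal]
    have hDy2 : ∀ r, (blockWeight m₁ m₂ p q *ᵥ y) (Sum.inr r) = q * y (Sum.inr r) := fun r => by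
      simp [blockWeight, Matrix.mulVec_diagonal]
    have hsum : ∀ i, ∑ r, star ((colMatrix Y * T) r i) * (blockWeight m₁ m₂ p q *ᵥ y) r =
        p * (f i * P₁ y (Sum.inl i)) + q * (g i * P₂ y (Sum.inl i)) := by
      intro i
      have e1 : f i * P₁ y (Sum.inl i) = ∑ r, star (Z i (Sum.inl r)) * y (Sum.inl r) := by
        rw [hc _ _ (f i) (hf0 i)]
        exact congrArg _ (hC1' _ i)
      have e2 : g i * P₂ y (Sum.inl i) = ∑ r, star (Z i (Sum.inr r)) * y (Sum.inr r) := by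
        rw [hc _ _ (g i) (hg0 i)]
        exact congrArg _ (hC2' _ i)
      rw [e1, e2, Fintype.sum_sum_type, Finset.mul_sum, Finset.mul_sum]
      congr 1
      · refine Finset.sum_congr rfl fun r _ => ?_
        rw [hDy1]
        exact mul_left_comm _ _ _
      · refine Finset.sum_congr rfl fun r _ => ?_
        rw [hDy2]
        exact mul_left_comm _ _ _
    have hss : ∀ z : ℂ, star z * z = ((‖z‖ ^ 2 : ℝ) : ℂ) := fun z => by
      rw [Complex.star_def, Complex.conj_mul']
      push_cast
      rfl
    have hquad : star y ⬝ᵥ (blockWeight m₁ m₂ p q *ᵥ y) =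
        ((p * ∑ r, ‖y (Sum.inl r)‖ ^ 2 + q * ∑ r, ‖y (Sum.inr r)‖ ^ 2 : ℝ) : ℂ) := by
      rw [dotProduct, Fintype.sum_sum_type]
      simp only [hDy1, hDy2, Pi.star_apply]
      rw [Complex.ofReal_add, Complex.ofReal_mul, Complex.ofReal_mul, Complex.ofReal_sum,
        Complex.ofReal_sum, Finset.mul_sum, Finset.mul_sum]
      congr 1
      · refine Finset.sum_congr rfl fun r _ => ?_
        rw [← hss]; ring
      · refine Finset.sum_congr rfl fun r _ => ?_
        rw [← hss]; ring
    simp only [hsum, hss] at key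
    rw [hquad] at key
    have key2 : pencilDet (Fin.cons y Y : Fin (k + 1) → Fin m₁ ⊕ Fin m₂ → ℂ) p q =
        pencilDet Y p q * (p * ∑ r, ‖y (Sum.inl r)‖ ^ 2 + q * ∑ r, ‖y (Sum.inr r)‖ ^ 2 -
          ∑ i, ‖(p : ℂ) * (f i * P₁ y (Sum.inl i)) + q * (g i * P₂ y (Sum.inl i))‖ ^ 2 / L i) := by
      exact_mod_cast key
    rw [key2, ← hP1, ← hP2]
    simp only [hA1, hA3, hA4]
    congr 1
    have : ∑ i, p * q * ‖(g i : ℂ) * P₁ y (Sum.inl i) - f i * P₂ y (Sum.inl i)‖ ^ 2 / L i =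
        p * ∑ i, ‖P₁ y (Sum.inl i)‖ ^ 2 + q * ∑ i, ‖P₂ y (Sum.inl i)‖ ^ 2 -
        ∑ i, ‖(p : ℂ) * (f i * P₁ y (Sum.inl i)) + q * (g i * P₂ y (Sum.inl i))‖ ^ 2 / L i := by
      rw [Finset.mul_sum, Finset.mul_sum, ← Finset.sum_add_distrib, ← Finset.sum_sub_distrib]
      exact Finset.sum_congr rfl fun i _ =>
        (schur_norm_sq (by rw [hf2, hg2]) (hL0 i).ne' _ _).symm
    rw [this]
    ring

end Step

/-! ### Adding a Gaussian column -/

theorem lintegral_pi_cons {K : ℕ} {E : Type*} [MeasurableSpace E] (μ : Measure E) [SigmaFinite μ]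
    {f : (Fin (K + 1) → E) → ENNReal} (hf : Measurable f) :
    ∫⁻ v, f v ∂(Measure.pi fun _ => μ) =
      ∫⁻ Y, ∫⁻ y, f (Fin.cons y Y : Fin (K + 1) → E) ∂μ ∂(Measure.pi fun _ : Fin K => μ) := by
  have h := (measurePreserving_piFinSuccAbove (fun _ : Fin (K + 1) => μ) 0).symm
  rw [← h.lintegral_comp hf]
  refine (lintegral_prod_symm' _ (hf.comp h.measurable)).trans ?_
  simp [MeasurableEquiv.piFinSuccAbove, Fin.insertNthEquiv]

theorem measurable_finCons {K : ℕ} {E : Type*} [MeasurableSpace E] :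
    Measurable fun z : (Fin K → E) × E => (Fin.cons z.2 z.1 : Fin (K + 1) → E) := by
  refine measurable_pi_lambda _ fun i => ?_
  refine Fin.cases ?_ (fun j => ?_) i
  · simpa using measurable_snd
  · exact (measurable_pi_apply j).comp measurable_fst

/-- An arbitrary bijection of the index types reduces the claim to a norm-preserving endomorphism.
-/
theorem lintegral_gaussVec_isometry {ι κ : Type*} [Fintype ι] [Fintype κ]
    (hcard : Fintype.card ι = Fintype.card κ) (A : (ι → ℂ) →ₗ[ℂ] (κ → ℂ))
    (hA : ∀ x, ∑ s, ‖A x s‖ ^ 2 = ∑ r, ‖x r‖ ^ 2) {g : (κ → ℂ) → ENNReal} (hg : Measurable g) :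
    ∫⁻ x, g (A x) ∂gaussVec ι = ∫⁻ x, g x ∂gaussVec κ := by
  let e : ι ≃ κ := Fintype.equivOfCardEq hcard
  have h1 := measurePreserving_gaussVec (LinearMap.funLeft ℂ ℂ e ∘ₗ A) (fun x => by
    rw [← hA x]
    exact Equiv.sum_comp e fun s => ‖A x s‖ ^ 2)
  have h2 := measurePreserving_piCongrLeft (fun _ : κ => stdComplexGaussian) e
  have h3 := h2.comp h1
  have h4 : ⇑(MeasurableEquiv.piCongrLeft (fun _ : κ => ℂ) e) ∘
      ⇑(LinearMap.funLeft ℂ ℂ e ∘ₗ A) = A := by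
    funext x
    funext s
    obtain ⟨i, rfl⟩ := e.surjective s
    simp [MeasurableEquiv.coe_piCongrLeft, LinearMap.funLeft_apply]
  rw [h4] at h3
  exact h3.lintegral_comp hg

/-- The points `0, φ_1, …, φ_k, 1`. -/
def padded {k : ℕ} (φ : Fin k → ℝ) : Fin (k + 1 + 1) → ℝ :=
  Fin.cons 0 (Fin.snoc φ 1 : Fin (k + 1) → ℝ)

/-- The chamber `0 < φ_1 < ⋯ < φ_k < 1`. -/
def chamber (k : ℕ) : Set (Fin k → ℝ) := {φ | StrictMono φ ∧ ∀ i, 0 < φ i ∧ φ i < 1}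

theorem measurableSet_chamber (k : ℕ) : MeasurableSet (chamber k) := by
  refine (measurableSet_strictMono k).inter ?_
  have : {φ : Fin k → ℝ | ∀ i, 0 < φ i ∧ φ i < 1} = Set.univ.pi fun _ => Set.Ioo 0 1 := by
    ext; simp
  change MeasurableSet {φ : Fin k → ℝ | ∀ i, 0 < φ i ∧ φ i < 1}
  rw [this]
  exact MeasurableSet.univ_pi fun _ => measurableSet_Ioo

section

variable {k : ℕ} {φ : Fin k → ℝ}

@[simp] theorem padded_zero : padded φ 0 = 0 := rfl

@[simp] theorem padded_last : padded φ (Fin.last (k + 1)) = 1 := by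
  rw [← Fin.succ_last, padded, Fin.cons_succ, Fin.snoc_last]

@[simp] theorem padded_succ_castSucc (i : Fin k) : padded φ i.castSucc.succ = φ i := by
  rw [padded, Fin.cons_succ, Fin.snoc_castSucc]

theorem sum_padded {M : Type*} [AddCommMonoid M] (f : Fin (k + 1 + 1) → M) :
    ∑ j, f j = f 0 + (∑ i : Fin k, f i.castSucc.succ + f (Fin.last (k + 1))) := by
  rw [Fin.sum_univ_succ, Fin.sum_univ_castSucc, Fin.succ_last]

theorem prod_padded {M : Type*} [CommMonoid M] (f : Fin (k + 1 + 1) → M) :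
    ∏ j, f j = f 0 * ((∏ i : Fin k, f i.castSucc.succ) * f (Fin.last (k + 1))) := by
  rw [Fin.prod_univ_succ, Fin.prod_univ_castSucc, Fin.succ_last]

theorem strictMono_padded (hφ : φ ∈ chamber k) : StrictMono (padded φ) := by
  intro i j
  refine Fin.cases ?_ (fun i => Fin.lastCases ?_ (fun i => ?_) i) i <;>
    refine Fin.cases ?_ (fun j => Fin.lastCases ?_ (fun j => ?_) j) j
  · simp
  · simp [Fin.succ_last]
  · simpa using (hφ.2 j).1
  · simp
  · simp
  · intro h
    exact absurd (Fin.succ_lt_succ_iff.1 h) (not_lt.2 (Fin.le_last _))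
  · simp
  · simpa [Fin.succ_last] using fun _ => (hφ.2 i).2
  · simpa using fun h => hφ.1 h

end

/-- The grouping of the adapted coordinates of the new column. -/
def blockIdx (k d₁ d₂ : ℕ) : (Fin k ⊕ Fin d₁) ⊕ (Fin k ⊕ Fin d₂) → Option (Fin (k + 1 + 1)) :=
  Sum.elim (Sum.elim (fun i => some i.castSucc.succ) fun _ => some 0)
    (Sum.elim (fun _ => none) fun _ => some (Fin.last (k + 1)))

theorem blockNormSq_blockIdx (k d₁ d₂ : ℕ) (x : (Fin k ⊕ Fin d₁) ⊕ (Fin k ⊕ Fin d₂) → ℂ) :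
    blockNormSq (blockIdx k d₁ d₂) x 0 = ∑ j, ‖x (Sum.inl (Sum.inr j))‖ ^ 2 ∧
    blockNormSq (blockIdx k d₁ d₂) x (Fin.last (k + 1)) = ∑ j, ‖x (Sum.inr (Sum.inr j))‖ ^ 2 ∧
    ∀ i : Fin k, blockNormSq (blockIdx k d₁ d₂) x i.castSucc.succ =
      ‖x (Sum.inl (Sum.inl i))‖ ^ 2 := by
  have h0 : ∀ i : Fin k, i.castSucc.succ ≠ Fin.last (k + 1) := fun i => by
    rw [← Fin.succ_last, Ne, Fin.succ_inj]
    exact (Fin.castSucc_lt_last i).ne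
  have h2 : Fin.last (k + 1) ≠ 0 := Fin.last_pos.ne'
  refine ⟨?_, ?_, fun i => ?_⟩ <;> rw [blockNormSq, Finset.sum_filter]
  · simp [Fintype.sum_sum_type, blockIdx, h2]
  · simp [Fintype.sum_sum_type, blockIdx, h0, h2.symm]
  · simp [Fintype.sum_sum_type, blockIdx, (h0 _).symm, (Fin.succ_ne_zero _).symm]

/-- The shape parameters of the block norms. -/
def blockShape (k e₁ e₂ : ℕ) : Fin (k + 1 + 1) → ℕ :=
  Fin.cons e₁ (Fin.snoc (fun _ => 0) e₂ : Fin (k + 1) → ℕ)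

theorem card_blockIdx (k e₁ e₂ : ℕ) (j : Fin (k + 1 + 1)) :
    (Finset.univ.filter fun i => blockIdx k (e₁ + 1) (e₂ + 1) i = some j).card =
      blockShape k e₁ e₂ j + 1 := by
  have h0 : ∀ i : Fin k, i.castSucc.succ ≠ Fin.last (k + 1) := fun i => by
    rw [← Fin.succ_last, Ne, Fin.succ_inj]
    exact (Fin.castSucc_lt_last i).ne
  have h2 : Fin.last (k + 1) ≠ 0 := Fin.last_pos.ne'
  rw [Finset.card_filter]
  refine Fin.cases ?_ (fun j => Fin.lastCases ?_ (fun i => ?_) j) j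
  · simp [Fintype.sum_sum_type, blockIdx, h2, blockShape]
  · simp [Fintype.sum_sum_type, blockIdx, h0, h2.symm, blockShape]
  · simp [Fintype.sum_sum_type, blockIdx, (h0 _).symm, blockShape, (Fin.succ_ne_zero _).symm]

section

variable {k m₁ m₂ : ℕ} {Y : Fin k → Fin m₁ ⊕ Fin m₂ → ℂ} {φ : Fin k → ℝ}

/-- The roots after adding a column. -/
theorem HasRoots.cons (hY : HasRoots Y φ) (hφ : φ ∈ chamber k) {y : Fin m₁ ⊕ Fin m₂ → ℂ}
    {w : Fin (k + 1 + 1) → ℝ}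
    (hw : ∀ p q : ℝ, 0 < p → 0 < q →
      pencilDet (Fin.cons y Y : Fin (k + 1) → Fin m₁ ⊕ Fin m₂ → ℂ) p q = pencilDet Y p q *
        (p * w 0 + q * w (Fin.last (k + 1)) +
          ∑ i : Fin k, p * q * w i.castSucc.succ / (p * φ i + q * (1 - φ i))))
    {v : Fin (k + 1 + 1) → ℝ} (hv : v ∈ interlacingSet (padded φ))
    (hwv : residueMap (padded φ) v = w) :
    HasRoots (Fin.cons y Y : Fin (k + 1) → Fin m₁ ⊕ Fin m₂ → ℂ) (Fin.tail v) := by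
  have ha := strictMono_padded hφ
  have h11 : pencilDet (Fin.cons y Y : Fin (k + 1) → Fin m₁ ⊕ Fin m₂ → ℂ) 1 1 =
      pencilDet Y 1 1 * v 0 := by
    rw [hw 1 1 one_pos one_pos, ← sum_residueMap ha v, hwv, sum_padded]
    simp only [one_mul, add_sub_cancel, div_one]
    ring
  refine ⟨by rw [h11]; exact mul_pos hY.1 hv.1, fun z hz => ?_⟩
  have hz0 : ∀ j, z - padded φ j ≠ 0 := by
    intro j
    have : padded φ j ≤ 1 := by
      rw [← padded_last (φ := φ)]
      exact ha.monotone (Fin.le_last j)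
    linarith
  have hres := sum_residueMap_mul_prod ha v z
  have hdiv : ∀ j, ∏ l, (z - padded φ (j.succAbove l)) =
      (∏ i, (z - padded φ i)) / (z - padded φ j) := by
    intro j
    rw [Fin.prod_univ_succAbove _ j, mul_div_cancel_left₀ _ (hz0 j)]
  simp only [hdiv, hwv] at hres
  have hφz : ∀ i, z - φ i ≠ 0 := fun i => by simpa using hz0 i.castSucc.succ
  -- With `p = z - 1` and `q = z` each denominator becomes `z - φ_i`, and division by `z (z - 1)`
  -- gives the poles `0` and `1` the residues `w 0` and `w (Fin.last (k + 1))`.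
  have hLi : ∀ i, (z - 1) * φ i + z * (1 - φ i) = z - φ i := fun i => by ring
  rw [hw (z - 1) z (by linarith) (by linarith), hY.2 z hz, h11, mul_assoc, mul_assoc]
  congr 1
  refine Eq.trans ?_ hres
  rw [sum_padded, prod_padded]
  simp only [padded_zero, padded_last, padded_succ_castSucc, sub_zero, hLi]
  rw [mul_add, mul_add, Finset.mul_sum]
  have hz1 : z - 1 ≠ 0 := by linarith
  have hz2 : z ≠ 0 := by linarith
  have hsum : ∑ i : Fin k, (∏ i, (z - φ i)) * ((z - 1) * z * w i.castSucc.succ / (z - φ i)) =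
      ∑ i : Fin k, w i.castSucc.succ * (z * ((∏ i, (z - φ i)) * (z - 1)) / (z - φ i)) :=
    Finset.sum_congr rfl fun i _ => by ring
  rw [hsum]
  have e1 : z * ((∏ i, (z - φ i)) * (z - 1)) / z = (∏ i, (z - φ i)) * (z - 1) := by
    field_simp
  have e2 : z * ((∏ i, (z - φ i)) * (z - 1)) / (z - 1) = z * (∏ i, (z - φ i)) := by
    field_simp
  rw [e1, e2]
  ring

theorem residueMap_padded_zero (v : Fin (k + 1 + 1) → ℝ) :
    residueMap (padded φ) v 0 = v 0 * ((∏ l, Fin.tail v l) / ∏ i, φ i) := by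
  rw [residueMap, Finset.prod_div_distrib]
  have h1 : ∏ l : Fin (k + 1), (padded φ 0 - v l.succ) = (-1) ^ (k + 1) * ∏ l, Fin.tail v l := by
    rw [← Fin.prod_const, ← Finset.prod_mul_distrib]
    exact Finset.prod_congr rfl fun l _ => by simp [Fin.tail]
  have h2 : ∏ l : Fin (k + 1), (padded φ 0 - padded φ (Fin.succAbove 0 l)) =
      (-1) ^ (k + 1) * ∏ i, φ i := by
    have : ∏ i, φ i = ∏ l : Fin (k + 1), padded φ l.succ := by
      rw [Fin.prod_univ_castSucc, Fin.succ_last, padded_last, mul_one]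
      simp
    rw [this, ← Fin.prod_const, ← Finset.prod_mul_distrib]
    exact Finset.prod_congr rfl fun l _ => by simp
  rw [h1, h2, mul_div_mul_left _ _ (pow_ne_zero _ (by norm_num))]

theorem residueMap_padded_last (v : Fin (k + 1 + 1) → ℝ) :
    residueMap (padded φ) v (Fin.last (k + 1)) =
      v 0 * ((∏ l, (1 - Fin.tail v l)) / ∏ i, (1 - φ i)) := by
  rw [residueMap, Finset.prod_div_distrib, padded_last]
  congr 2
  simp only [Fin.succAbove_last]
  rw [Fin.prod_univ_succ]
  simp

theorem vandermonde_det_eq_prod_ite {n : ℕ} (v : Fin n → ℝ) : (vandermonde v).det =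
    ∏ i, ∏ j, if i < j then v j - v i else 1 := by
  rw [det_vandermonde]
  refine Finset.prod_congr rfl fun i _ => ?_
  rw [← Finset.prod_filter]
  exact Finset.prod_congr (by ext; simp) fun _ _ => rfl

theorem vandermonde_padded_det (φ : Fin k → ℝ) : (vandermonde (padded φ)).det =
    (vandermonde φ).det * (∏ i, φ i) * ∏ i, (1 - φ i) := by
  have h1 : ∀ i : Fin k, i.castSucc.succ < Fin.last (k + 1) := fun i => by
    rw [← Fin.succ_last, Fin.succ_lt_succ_iff]
    exact Fin.castSucc_lt_last i
  rw [vandermonde_det_eq_prod_ite, vandermonde_det_eq_prod_ite, prod_padded]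
  simp only [prod_padded (k := k), padded_zero, padded_last, padded_succ_castSucc]
  simp [h1, fun i => (h1 i).not_gt, Finset.prod_mul_distrib, Fin.last_pos]
  ring

/-- The points `μ` with `0 < μ_0 < φ_0 < μ_1 < ⋯ < φ_{k-1} < μ_k < 1`. -/
def interlacers (φ : Fin k → ℝ) : Set (Fin (k + 1) → ℝ) :=
  {μ | ∀ l : Fin (k + 1), padded φ l.castSucc < μ l ∧ μ l < padded φ l.succ}

theorem measurableSet_interlacers (φ : Fin k → ℝ) : MeasurableSet (interlacers φ) := by
  have : interlacers φ = Set.univ.pi fun l => Set.Ioo (padded φ l.castSucc) (padded φ l.succ) := by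
    ext; simp [interlacers]
  rw [this]
  exact MeasurableSet.univ_pi fun _ => measurableSet_Ioo

theorem cons_mem_interlacingSet {s : ℝ} {μ : Fin (k + 1) → ℝ} :
    (Fin.cons s μ : Fin (k + 1 + 1) → ℝ) ∈ interlacingSet (padded φ) ↔
      0 < s ∧ μ ∈ interlacers φ := by
  simp [interlacingSet, interlacers]

theorem interlacers_subset_chamber (hφ : φ ∈ chamber k) : interlacers φ ⊆ chamber (k + 1) := by
  intro μ hμ
  have ha := strictMono_padded hφ
  have hv := (cons_mem_interlacingSet (s := 1)).2 ⟨one_pos, hμ⟩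
  refine ⟨by simpa using strictMono_tail_of_interlacing ha hv, fun i => ⟨?_, ?_⟩⟩
  · have : padded φ 0 ≤ padded φ i.castSucc := ha.monotone (Fin.zero_le _)
    exact lt_of_le_of_lt this (hμ i).1
  · have : padded φ i.succ ≤ padded φ (Fin.last _) := ha.monotone (Fin.le_last _)
    rw [padded_last] at this
    exact lt_of_lt_of_le (hμ i).2 this

/-- The Jacobi weight `V(φ) ∏ φ_i^{a} (1-φ_i)^{b}`. -/
def jacobiWeight (a b : ℕ) (φ : Fin k → ℝ) : ℝ :=
  (vandermonde φ).det * ((∏ i, φ i) ^ a * (∏ i, (1 - φ i)) ^ b)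

theorem jacobiWeight_pos (a b : ℕ) (hφ : φ ∈ chamber k) : 0 < jacobiWeight a b φ :=
  mul_pos (vandermonde_det_pos hφ.1) (mul_pos (pow_pos (Finset.prod_pos fun i _ => (hφ.2 i).1) _)
    (pow_pos (Finset.prod_pos fun i _ => sub_pos.2 (hφ.2 i).2) _))

theorem continuous_jacobiWeight (a b : ℕ) : Continuous (jacobiWeight a b : (Fin k → ℝ) → ℝ) := by
  unfold jacobiWeight
  have : Continuous fun φ : Fin k → ℝ => (vandermonde φ).det :=
    Continuous.matrix_det (continuous_matrix fun i j => by
      simp only [vandermonde_apply]; fun_prop)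
  fun_prop

/-- The normalization in the radial direction. -/
def radialConst (N e₁ e₂ : ℕ) : ENNReal :=
  ∫⁻ s in Set.Ioi (0 : ℝ), ENNReal.ofReal (s ^ (N + e₁ + e₂) * Real.exp (-s) /
    (e₁.factorial * e₂.factorial))

/-- The exponentials multiply to `e^(-s)` since the residues sum to `s`, and only the residues at
`0` and `1` carry powers. The variables `s` and `μ` therefore separate; the extra factors `∏ φ_i ∏
(1 - φ_i)` in `V(0, φ, 1)` raise both exponents of the weight of `φ` by one. -/
theorem residue_density (e₁ e₂ : ℕ) (hφ : φ ∈ chamber k) (s : ℝ)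
    (μ : Fin (k + 1) → ℝ) :
    s ^ (k + 1) * ((vandermonde μ).det / (vandermonde (padded φ)).det) *
      ∏ j, (residueMap (padded φ) (Fin.cons s μ) j ^ blockShape k e₁ e₂ j /
        (blockShape k e₁ e₂ j).factorial * Real.exp (-residueMap (padded φ) (Fin.cons s μ) j)) =
      (s ^ (k + 1 + e₁ + e₂) * Real.exp (-s) / (e₁.factorial * e₂.factorial)) *
        (jacobiWeight e₁ e₂ μ / jacobiWeight (e₁ + 1) (e₂ + 1) φ) := by
  have ha := strictMono_padded hφ
  rw [Finset.prod_mul_distrib, ← Real.exp_sum, Finset.sum_neg_distrib, sum_residueMap ha,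
    Fin.cons_zero, prod_padded, residueMap_padded_zero, residueMap_padded_last,
    vandermonde_padded_det]
  have h0 : blockShape k e₁ e₂ 0 = e₁ := rfl
  have h1 : blockShape k e₁ e₂ (Fin.last (k + 1)) = e₂ := by
    rw [← Fin.succ_last, blockShape, Fin.cons_succ, Fin.snoc_last]
  have h2 : ∀ i : Fin k, blockShape k e₁ e₂ i.castSucc.succ = 0 := fun i => by
    rw [blockShape, Fin.cons_succ, Fin.snoc_castSucc]
  simp only [h0, h1, h2, Fin.cons_zero, Fin.tail_cons, pow_zero, Nat.factorial_zero, Nat.cast_one,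
    div_one, Finset.prod_const_one, one_mul, jacobiWeight]
  have p1 : (∏ i, φ i) ≠ 0 := (Finset.prod_pos fun i _ => (hφ.2 i).1).ne'
  have p2 : (∏ i, (1 - φ i)) ≠ 0 := (Finset.prod_pos fun i _ => sub_pos.2 (hφ.2 i).2).ne'
  have p3 : (vandermonde φ).det ≠ 0 := (vandermonde_det_pos hφ.1).ne'
  rw [mul_pow s, mul_pow s, div_pow, div_pow]
  have f1 : (e₁.factorial : ℝ) ≠ 0 := by positivity
  have f2 : (e₂.factorial : ℝ) ≠ 0 := by positivity
  field_simp
  ring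

/-- The law of the roots after adding a Gaussian column to a pencil with roots `φ`. -/
theorem HasRoots.lintegral_cons {e₁ e₂ : ℕ} (h₁ : m₁ = k + (e₁ + 1)) (h₂ : m₂ = k + (e₂ + 1))
    (hY : HasRoots Y φ) (hφ : φ ∈ chamber k)
    {G : (Fin (k + 1) → Fin m₁ ⊕ Fin m₂ → ℂ) → ENNReal} {F : (Fin (k + 1) → ℝ) → ENNReal}
    (hF : Measurable F)
    (hGF : ∀ Y φ, φ ∈ chamber (k + 1) → HasRoots Y φ → G Y = F φ) :
    ∫⁻ y, G (Fin.cons y Y) ∂gaussVec (Fin m₁ ⊕ Fin m₂) =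
      radialConst (k + 1) e₁ e₂ * ∫⁻ μ in interlacers φ,
        ENNReal.ofReal (jacobiWeight e₁ e₂ μ / jacobiWeight (e₁ + 1) (e₂ + 1) φ) * F μ := by
  have ha := strictMono_padded hφ
  obtain ⟨A, hA, hdet⟩ := hY.exists_isometry_pencilDet_cons h₁ h₂ hφ.1.injective
    (fun i => (hφ.2 i).1) fun i => (hφ.2 i).2
  have hcard : Fintype.card (Fin m₁ ⊕ Fin m₂) =
      Fintype.card ((Fin k ⊕ Fin (e₁ + 1)) ⊕ (Fin k ⊕ Fin (e₂ + 1))) := by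
    simp [h₁, h₂]
  have hAm : Measurable A := (LinearMap.continuous_of_finiteDimensional A).measurable
  set w : (Fin m₁ ⊕ Fin m₂ → ℂ) → Fin (k + 1 + 1) → ℝ :=
    fun y => blockNormSq (blockIdx k (e₁ + 1) (e₂ + 1)) (A y) with hw
  have hlaw : ∀ {g : (Fin (k + 1 + 1) → ℝ) → ENNReal}, Measurable g →
      ∫⁻ y, g (w y) ∂gaussVec (Fin m₁ ⊕ Fin m₂) = ∫⁻ w in {w | ∀ j, 0 < w j},
        ENNReal.ofReal (∏ j, (w j ^ blockShape k e₁ e₂ j / (blockShape k e₁ e₂ j).factorial *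
          Real.exp (-w j))) * g w := by
    intro g hg
    rw [← lintegral_blockNormSq _ _ (card_blockIdx k e₁ e₂) hg]
    exact lintegral_gaussVec_isometry hcard A hA (hg.comp (measurable_blockNormSq _))
  have hmpos : MeasurableSet {w : Fin (k + 1 + 1) → ℝ | ∀ j, 0 < w j} := by
    have : {w : Fin (k + 1 + 1) → ℝ | ∀ j, 0 < w j} = Set.univ.pi fun _ => Set.Ioi 0 := by
      ext; simp
    rw [this]
    exact MeasurableSet.univ_pi fun _ => measurableSet_Ioi
  -- Tested on the indicator of the complement of the positive orthant, the formula for the law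
  -- gives zero.
  have hpos : ∀ᵐ y ∂gaussVec (Fin m₁ ⊕ Fin m₂), ∀ j, 0 < w y j := by
    have h := hlaw (g := Set.indicator {w | ∀ j, 0 < w j}ᶜ 1)
      (measurable_one.indicator hmpos.compl)
    rw [setLIntegral_congr_fun (g := fun _ => 0) hmpos (fun x hx => by
      simp only [Set.indicator_of_notMem (Set.notMem_compl_iff.2 hx), mul_zero]),
      lintegral_zero] at h
    have hwm : Measurable w := (measurable_blockNormSq _).comp hAm
    have h' := (lintegral_eq_zero_iff ((measurable_one.indicator hmpos.compl).comp hwm)).1 h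
    filter_upwards [h'] with y hy
    by_contra hne
    rw [Pi.zero_apply, Function.comp_apply, Set.indicator_of_mem
      (show w y ∈ {w : Fin (k + 1 + 1) → ℝ | ∀ j, 0 < w j}ᶜ from hne)] at hy
    exact one_ne_zero hy
  have hcont : Continuous (residueMap (padded φ)) := by
    unfold residueMap
    fun_prop
  -- The new roots are a measurable function of the residues, because the injective continuous
  -- residue map is a measurable embedding; `g` is `F` of these roots, extended measurably.
  obtain ⟨g, hg, hgF⟩ := (hcont.continuousOn.measurableEmbedding measurableSet_interlacingSet
    (residueMap_injOn ha)).exists_measurable_extend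
    (g := fun v : interlacingSet (padded φ) => F (Fin.tail v.1))
    (hF.comp (measurable_pi_lambda _ fun i =>
      (measurable_pi_apply i.succ).comp measurable_subtype_coe)) fun _ => inferInstance
  have hgF' : ∀ v ∈ interlacingSet (padded φ), g (residueMap (padded φ) v) = F (Fin.tail v) :=
    fun v hv => congrFun hgF ⟨v, hv⟩
  have hGg : ∀ᵐ y ∂gaussVec (Fin m₁ ⊕ Fin m₂), G (Fin.cons y Y) = g (w y) := by
    filter_upwards [hpos] with y hy
    obtain ⟨v, hv, hvw⟩ := residueMap_surjOn ha hy
    rw [← hvw, hgF' v hv]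
    refine hGF _ _ ?_ (hY.cons hφ ?_ hv hvw)
    · refine interlacers_subset_chamber hφ fun l => ?_
      exact hv.2 l
    · intro p q hp hq
      obtain ⟨b0, b1, b2⟩ := blockNormSq_blockIdx k (e₁ + 1) (e₂ + 1) (A y)
      simp only [hw, b0, b1, b2]
      exact hdet y p q hp hq
  rw [lintegral_congr_ae hGg, hlaw hg, lintegral_pos_eq_lintegral_interlacing ha]
  rw [← lintegral_indicator measurableSet_interlacingSet]
  have hrw : (interlacingSet (padded φ)).indicator (fun v => ENNReal.ofReal (v 0 ^ (k + 1) *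
      ((vandermonde (Fin.tail v)).det / (vandermonde (padded φ)).det)) *
      (ENNReal.ofReal (∏ j, (residueMap (padded φ) v j ^ blockShape k e₁ e₂ j /
        (blockShape k e₁ e₂ j).factorial * Real.exp (-residueMap (padded φ) v j))) *
        g (residueMap (padded φ) v))) =
      (interlacingSet (padded φ)).indicator fun v =>
        ENNReal.ofReal (v 0 ^ (k + 1 + e₁ + e₂) * Real.exp (-v 0) /
          (e₁.factorial * e₂.factorial)) *
        (ENNReal.ofReal (jacobiWeight e₁ e₂ (Fin.tail v) / jacobiWeight (e₁ + 1) (e₂ + 1) φ) *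
          F (Fin.tail v)) := by
    refine Set.indicator_congr fun v hv => ?_
    have hden := residue_density e₁ e₂ hφ (v 0) (Fin.tail v)
    rw [Fin.cons_self_tail] at hden
    have hV := (vandermonde_det_pos (strictMono_tail_of_interlacing ha hv)).le
    have hV' := (vandermonde_det_pos ha).le
    rw [hgF' v hv, ← mul_assoc, ← ENNReal.ofReal_mul (mul_nonneg (pow_nonneg hv.1.le _)
      (div_nonneg hV hV')), hden, ENNReal.ofReal_mul (by have := hv.1; positivity), mul_assoc]
  rw [hrw, volume_pi]
  have htail : Measurable (Fin.tail : (Fin (k + 1 + 1) → ℝ) → Fin (k + 1) → ℝ) :=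
    measurable_pi_lambda _ fun i => measurable_pi_apply i.succ
  have hJ : Measurable fun μ : Fin (k + 1) → ℝ =>
      ENNReal.ofReal (jacobiWeight e₁ e₂ μ / jacobiWeight (e₁ + 1) (e₂ + 1) φ) * F μ :=
    (((continuous_jacobiWeight e₁ e₂).measurable.div_const _).ennreal_ofReal).mul hF
  rw [lintegral_pi_cons volume (Measurable.indicator (by
    refine Measurable.mul (by fun_prop) (hJ.comp htail)) measurableSet_interlacingSet)]
  rw [← volume_pi, ← lintegral_indicator (measurableSet_interlacers φ), ← lintegral_const_mul _
    (hJ.indicator (measurableSet_interlacers φ))]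
  refine lintegral_congr fun μ => ?_
  by_cases hμ : μ ∈ interlacers φ
  · rw [Set.indicator_of_mem hμ, radialConst, ← lintegral_mul_const _ (by fun_prop),
      ← lintegral_indicator measurableSet_Ioi]
    refine lintegral_congr fun s => ?_
    by_cases hs : 0 < s
    · rw [Set.indicator_of_mem (cons_mem_interlacingSet.2 ⟨hs, hμ⟩),
        Set.indicator_of_mem (Set.mem_Ioi.2 hs)]
      simp
    · rw [Set.indicator_of_notMem fun h => hs (cons_mem_interlacingSet.1 h).1,
        Set.indicator_of_notMem (show s ∉ Set.Ioi 0 from hs)]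
  · rw [Set.indicator_of_notMem hμ, mul_zero]
    simp only [Set.indicator_of_notMem fun h => hμ (cons_mem_interlacingSet.1 h).2,
      lintegral_zero]

end

/-! ### The law of the roots -/

theorem continuous_padded {k : ℕ} (j : Fin (k + 1 + 1)) :
    Continuous fun φ : Fin k → ℝ => padded φ j := by
  refine Fin.cases ?_ (fun j => Fin.lastCases ?_ (fun i => ?_) j) j
  · exact continuous_const
  · simp only [Fin.succ_last, padded_last]
    exact continuous_const
  · simp only [padded_succ_castSucc]
    exact continuous_apply i

theorem measurableSet_interlacing_pairs (k : ℕ) :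
    MeasurableSet {z : (Fin k → ℝ) × (Fin (k + 1) → ℝ) | z.2 ∈ interlacers z.1} := by
  refine MeasurableSet.congr (s := ⋂ l : Fin (k + 1), {z : (Fin k → ℝ) × (Fin (k + 1) → ℝ) |
    padded z.1 l.castSucc < z.2 l ∧ z.2 l < padded z.1 l.succ}) ?_ (by ext; simp [interlacers])
  refine MeasurableSet.iInter fun l => ?_
  have h1 : ∀ j, Measurable fun z : (Fin k → ℝ) × (Fin (k + 1) → ℝ) => padded z.1 j :=
    fun j => (continuous_padded j).measurable.comp measurable_fst
  have h2 : ∀ j, Measurable fun z : (Fin k → ℝ) × (Fin (k + 1) → ℝ) => z.2 j :=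
    fun j => (measurable_pi_apply j).comp measurable_snd
  exact (measurableSet_lt (h1 _) (h2 _)).inter (measurableSet_lt (h2 _) (h1 _))

/-- Describes the same set of interlacing pairs by its sections over `φ` and over `μ`, as required
for exchanging the integrals. -/
theorem mem_chamber_and_mem_interlacers_iff {k : ℕ} {φ : Fin k → ℝ} {μ : Fin (k + 1) → ℝ} :
    φ ∈ chamber k ∧ μ ∈ interlacers φ ↔ μ ∈ chamber (k + 1) ∧
      φ ∈ Set.univ.pi fun i : Fin k => Set.Ioo (μ i.castSucc) (μ i.succ) := by
  constructor
  · rintro ⟨hφ, hμ⟩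
    refine ⟨interlacers_subset_chamber hφ hμ, fun i _ => ⟨?_, ?_⟩⟩
    · simpa using (hμ i.castSucc).2
    · have := (hμ i.succ).1
      rwa [← Fin.succ_castSucc, padded_succ_castSucc] at this
  · rintro ⟨hμ, hφ⟩
    have hφ' : ∀ i : Fin k, μ i.castSucc < φ i ∧ φ i < μ i.succ := fun i => hφ i (Set.mem_univ i)
    refine ⟨⟨fun i j hij => ?_, fun i => ⟨(hμ.2 _).1.trans (hφ' i).1, (hφ' i).2.trans (hμ.2 _).2⟩⟩,
      fun l => ⟨?_, ?_⟩⟩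
    · have : μ i.succ ≤ μ j.castSucc := hμ.1.monotone (by
        rw [Fin.le_def]; rw [Fin.lt_def] at hij; simp; omega)
      exact ((hφ' i).2.trans_le this).trans (hφ' j).1
    · refine Fin.cases ?_ (fun i => ?_) l
      · simpa using (hμ.2 0).1
      · rw [← Fin.succ_castSucc, padded_succ_castSucc]
        exact (hφ' i).2
    · refine Fin.lastCases ?_ (fun i => ?_) l
      · rw [Fin.succ_last, padded_last]
        exact (hμ.2 _).2
      · rw [padded_succ_castSucc]
        exact (hφ' i).1

theorem continuous_vandermonde_det (k : ℕ) :
    Continuous fun φ : Fin k → ℝ => (vandermonde φ).det :=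
  Continuous.matrix_det (continuous_matrix fun i j => by simp only [vandermonde_apply]; fun_prop)

theorem lintegral_vandermonde_interlacing {k : ℕ} {μ : Fin (k + 1) → ℝ}
    (hμ : μ ∈ chamber (k + 1)) :
    ∫⁻ φ in Set.univ.pi fun i : Fin k => Set.Ioo (μ i.castSucc) (μ i.succ),
      ENNReal.ofReal (vandermonde φ).det =
        ENNReal.ofReal ((vandermonde μ).det / k.factorial) := by
  have hm : MeasurableSet (Set.univ.pi fun i : Fin k => Set.Ioo (μ i.castSucc) (μ i.succ)) :=
    MeasurableSet.univ_pi fun _ => measurableSet_Ioo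
  rw [← integral_vandermonde_interlacing μ hμ.1.monotone, ofReal_integral_eq_lintegral_ofReal]
  · have hc : IntegrableOn (fun φ : Fin k → ℝ => (vandermonde φ).det)
        (Set.univ.pi fun i : Fin k => Set.Icc (μ i.castSucc) (μ i.succ)) :=
      (continuous_vandermonde_det k).continuousOn.integrableOn_compact
        (isCompact_univ_pi fun _ => isCompact_Icc)
    exact hc.mono_set (Set.pi_mono fun _ _ => Set.Ioo_subset_Icc_self)
  · filter_upwards [ae_restrict_mem hm] with φ hφ
    exact (vandermonde_det_pos (mem_chamber_and_mem_interlacers_iff.2 ⟨hμ, hφ⟩).1.1).le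

/-- The density of the roots, up to normalization. -/
def jacobiDensity {k : ℕ} (a b : ℕ) (φ : Fin k → ℝ) : ℝ := jacobiWeight a b φ * (vandermonde φ).det

theorem continuous_jacobiDensity {k : ℕ} (a b : ℕ) :
    Continuous (jacobiDensity a b : (Fin k → ℝ) → ℝ) :=
  (continuous_jacobiWeight a b).mul (continuous_vandermonde_det k)

/-- The old density is its weight times `V(φ)`; the weight cancels against the denominator of the
transition density, and `V(φ)` integrates over the interlacing box to `V(μ) / k!`. -/
theorem lintegral_chamber_interlacers {k : ℕ} (a b : ℕ) {F : (Fin (k + 1) → ℝ) → ENNReal}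
    (hF : Measurable F) :
    ∫⁻ φ in chamber k, ENNReal.ofReal (jacobiDensity (a + 1) (b + 1) φ) *
      ∫⁻ μ in interlacers φ, ENNReal.ofReal (jacobiWeight a b μ / jacobiWeight (a + 1) (b + 1) φ) *
        F μ =
    ENNReal.ofReal (k.factorial : ℝ)⁻¹ * ∫⁻ μ in chamber (k + 1),
      ENNReal.ofReal (jacobiDensity a b μ) * F μ := by
  have hpairs := measurableSet_interlacing_pairs k
  have hV : Measurable fun φ : Fin k → ℝ => ENNReal.ofReal (vandermonde φ).det :=
    (continuous_vandermonde_det k).measurable.ennreal_ofReal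
  have hW : Measurable fun μ : Fin (k + 1) → ℝ => ENNReal.ofReal (jacobiWeight a b μ) * F μ :=
    (continuous_jacobiWeight a b).measurable.ennreal_ofReal.mul hF
  set S : Set ((Fin k → ℝ) × (Fin (k + 1) → ℝ)) := {z | z.1 ∈ chamber k ∧ z.2 ∈ interlacers z.1}
    with hS
  have hSm : MeasurableSet S := (measurable_fst (measurableSet_chamber k)).inter hpairs
  set T : (Fin k → ℝ) × (Fin (k + 1) → ℝ) → ENNReal := S.indicator fun z =>
    ENNReal.ofReal (vandermonde z.1).det * (ENNReal.ofReal (jacobiWeight a b z.2) * F z.2) with hT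
  have hTm : Measurable T :=
    ((hV.comp measurable_fst).mul (hW.comp measurable_snd)).indicator hSm
  have hleft : ∀ φ, (chamber k).indicator (fun φ => ENNReal.ofReal (jacobiDensity (a + 1) (b + 1) φ) *
      ∫⁻ μ in interlacers φ, ENNReal.ofReal (jacobiWeight a b μ / jacobiWeight (a + 1) (b + 1) φ) *
        F μ) φ = ∫⁻ μ, T (φ, μ) := by
    intro φ
    by_cases hφ : φ ∈ chamber k
    · have hpos := jacobiWeight_pos (a + 1) (b + 1) hφ
      rw [Set.indicator_of_mem hφ, ← lintegral_const_mul _ (by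
        exact ((continuous_jacobiWeight a b).measurable.div_const _).ennreal_ofReal.mul hF),
        ← lintegral_indicator (measurableSet_interlacers φ)]
      refine lintegral_congr fun μ => ?_
      by_cases hμ : μ ∈ interlacers φ
      · rw [Set.indicator_of_mem hμ, hT, Set.indicator_of_mem (show (φ, μ) ∈ S from ⟨hφ, hμ⟩),
          ← mul_assoc, ← mul_assoc, ← ENNReal.ofReal_mul (vandermonde_det_pos hφ.1).le,
          ← ENNReal.ofReal_mul (show 0 ≤ jacobiDensity (a + 1) (b + 1) φ from
            (mul_pos hpos (vandermonde_det_pos hφ.1)).le)]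
        congr 2
        rw [jacobiDensity]
        field_simp
      · rw [Set.indicator_of_notMem hμ, hT, Set.indicator_of_notMem fun h => hμ h.2]
    · rw [Set.indicator_of_notMem hφ]
      have : ∀ μ, T (φ, μ) = 0 := fun μ => by
        rw [hT, Set.indicator_of_notMem fun h => hφ h.1]
      simp [this]
  have hright : ∀ μ, ∫⁻ φ, T (φ, μ) = ENNReal.ofReal (k.factorial : ℝ)⁻¹ *
      (chamber (k + 1)).indicator (fun μ => ENNReal.ofReal (jacobiDensity a b μ) * F μ) μ := by
    intro μ
    by_cases hμ : μ ∈ chamber (k + 1)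
    · have hm : MeasurableSet (Set.univ.pi fun i : Fin k => Set.Ioo (μ i.castSucc) (μ i.succ)) :=
        MeasurableSet.univ_pi fun _ => measurableSet_Ioo
      have : ∀ φ, T (φ, μ) = (Set.univ.pi fun i : Fin k => Set.Ioo (μ i.castSucc) (μ i.succ)).indicator
          (fun φ => ENNReal.ofReal (vandermonde φ).det) φ *
            (ENNReal.ofReal (jacobiWeight a b μ) * F μ) := by
        intro φ
        by_cases h : φ ∈ Set.univ.pi fun i : Fin k => Set.Ioo (μ i.castSucc) (μ i.succ)
        · rw [Set.indicator_of_mem h, hT, Set.indicator_of_mem (show (φ, μ) ∈ S from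
            mem_chamber_and_mem_interlacers_iff.2 ⟨hμ, h⟩)]
        · rw [Set.indicator_of_notMem h, hT, Set.indicator_of_notMem (show (φ, μ) ∉ S from fun h' =>
            h (mem_chamber_and_mem_interlacers_iff.1 h').2), zero_mul]
      simp only [this]
      rw [lintegral_mul_const _ (hV.indicator hm), lintegral_indicator hm,
        lintegral_vandermonde_interlacing hμ, Set.indicator_of_mem hμ, ← mul_assoc, ← mul_assoc,
        ← ENNReal.ofReal_mul (div_nonneg (vandermonde_det_pos hμ.1).le (by positivity)),
        ← ENNReal.ofReal_mul (by positivity)]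
      congr 2
      rw [jacobiDensity]
      ring
    · rw [Set.indicator_of_notMem hμ, mul_zero]
      have : ∀ φ, T (φ, μ) = 0 := fun φ => by
        rw [hT, Set.indicator_of_notMem (show (φ, μ) ∉ S from fun h =>
          hμ (mem_chamber_and_mem_interlacers_iff.1 h).1)]
      simp [this]
  have hDm : Measurable fun μ : Fin (k + 1) → ℝ => ENNReal.ofReal (jacobiDensity a b μ) * F μ :=
    (continuous_jacobiDensity a b).measurable.ennreal_ofReal.mul hF
  rw [← lintegral_indicator (measurableSet_chamber k), lintegral_congr hleft,
    lintegral_lintegral_swap (f := fun φ μ => T (φ, μ)) hTm.aemeasurable, lintegral_congr hright,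
    lintegral_const_mul _ (hDm.indicator (measurableSet_chamber _)),
    lintegral_indicator (measurableSet_chamber _)]

/-- The law of the roots of a Gaussian pencil, up to normalization. -/
theorem exists_lintegral_roots (m₁ m₂ k : ℕ) (h₁ : k ≤ m₁) (h₂ : k ≤ m₂) :
    ∃ c : ENNReal, ∀ (G : (Fin k → Fin m₁ ⊕ Fin m₂ → ℂ) → ENNReal) (F : (Fin k → ℝ) → ENNReal),
      Measurable G → Measurable F → (∀ Y φ, φ ∈ chamber k → HasRoots Y φ → G Y = F φ) →
      ∫⁻ Y, G Y ∂(Measure.pi fun _ => gaussVec (Fin m₁ ⊕ Fin m₂)) =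
        c * ∫⁻ φ in chamber k, ENNReal.ofReal (jacobiDensity (m₁ - k) (m₂ - k) φ) * F φ := by
  induction k with
  | zero =>
    refine ⟨1, fun G F hG hF hGF => ?_⟩
    have hch : chamber 0 = Set.univ := by
      ext φ
      simp [chamber, StrictMono]
    have hG0 : ∀ Y, G Y = F default := fun Y => hGF Y default (by rw [hch]; trivial) (by
      simp [HasRoots, pencilDet])
    have hd : ∀ φ : Fin 0 → ℝ, ENNReal.ofReal (jacobiDensity (m₁ - 0) (m₂ - 0) φ) * F φ =
        F default := fun φ => by
      rw [Subsingleton.elim φ default]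
      simp [jacobiDensity, jacobiWeight]
    simp only [hG0, hd, hch]
    simp [volume_pi]
  | succ k ih =>
    obtain ⟨c, hc⟩ := ih (by omega) (by omega)
    obtain ⟨e₁, rfl⟩ := Nat.exists_eq_add_of_le h₁
    obtain ⟨e₂, rfl⟩ := Nat.exists_eq_add_of_le h₂
    refine ⟨c * (radialConst (k + 1) e₁ e₂ * ENNReal.ofReal (k.factorial : ℝ)⁻¹),
      fun G F hG hF hGF => ?_⟩
    rw [lintegral_pi_cons _ hG]
    set J : (Fin k → ℝ) → ENNReal := fun φ => ∫⁻ μ in interlacers φ,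
      ENNReal.ofReal (jacobiWeight e₁ e₂ μ / jacobiWeight (e₁ + 1) (e₂ + 1) φ) * F μ with hJ
    have hJm : Measurable J := by
      have : J = fun φ => ∫⁻ μ, {z : (Fin k → ℝ) × (Fin (k + 1) → ℝ) |
          z.2 ∈ interlacers z.1}.indicator (fun z => ENNReal.ofReal
            (jacobiWeight e₁ e₂ z.2 / jacobiWeight (e₁ + 1) (e₂ + 1) z.1) * F z.2) (φ, μ) := by
        funext φ
        rw [hJ]
        simp only
        rw [← lintegral_indicator (measurableSet_interlacers φ)]
        rfl
      rw [this]
      refine Measurable.lintegral_prod_right' (Measurable.indicator ?_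
        (measurableSet_interlacing_pairs k))
      exact ((((continuous_jacobiWeight e₁ e₂).measurable.comp measurable_snd).div
        ((continuous_jacobiWeight (e₁ + 1) (e₂ + 1)).measurable.comp
          measurable_fst)).ennreal_ofReal).mul (hF.comp measurable_snd)
    have hH : Measurable fun Y => ∫⁻ y, G (Fin.cons y Y)
        ∂gaussVec (Fin (k + 1 + e₁) ⊕ Fin (k + 1 + e₂)) :=
      (hG.comp measurable_finCons).lintegral_prod_right'
    -- The integral over the new column depends on the old columns only through their roots, so the
    -- induction hypothesis applies. With one column fewer, both exponents are larger by one.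
    rw [hc _ (fun φ => radialConst (k + 1) e₁ e₂ * J φ) hH (hJm.const_mul _)
      fun Y φ hφ hY => hY.lintegral_cons (by omega) (by omega) hφ hF hGF]
    have hs : ∀ e, k + 1 + e - k = e + 1 := fun e => by omega
    have hs' : ∀ e, k + 1 + e - (k + 1) = e := fun e => by omega
    simp only [hs, hs']
    have := lintegral_chamber_interlacers (k := k) e₁ e₂ hF
    have hcom : ∀ φ, ENNReal.ofReal (jacobiDensity (e₁ + 1) (e₂ + 1) φ) *
        (radialConst (k + 1) e₁ e₂ * J φ) = radialConst (k + 1) e₁ e₂ *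
          (ENNReal.ofReal (jacobiDensity (e₁ + 1) (e₂ + 1) φ) * J φ) :=
      fun φ => mul_left_comm _ _ _
    simp only [hcom]
    have hDm : Measurable fun φ => ENNReal.ofReal (jacobiDensity (e₁ + 1) (e₂ + 1) φ) * J φ :=
      (continuous_jacobiDensity _ _).measurable.ennreal_ofReal.mul hJm
    rw [lintegral_const_mul _ hDm, this]
    simp only [mul_assoc]

/-! ### The tail of the smallest root as a ratio of Legendre determinants -/

/-- The Hankel matrix of the weight `t ^ α (1 - t) ^ β` on `[ξ, 1]`. -/
def truncatedHankel (n α β : ℕ) (ξ : ℝ) : Matrix (Fin n) (Fin n) ℝ :=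
  Matrix.of fun i j => ∫ t in ξ..1, t ^ ((i : ℕ) + j) * (t ^ α * (1 - t) ^ β)

theorem integrable_pow_mul_indicator {f : ℝ → ℝ} (hf : Continuous f) (a b : ℝ) (k : ℕ) :
    Integrable fun t : ℝ => t ^ k * (Set.Ioo a b).indicator f t := by
  have : (fun t : ℝ => t ^ k * (Set.Ioo a b).indicator f t) =
      (Set.Ioo a b).indicator fun t => t ^ k * f t := by
    funext t
    by_cases h : t ∈ Set.Ioo a b <;> simp [h]
  rw [this, integrable_indicator_iff measurableSet_Ioo]
  exact ((by fun_prop : Continuous fun t => t ^ k * f t).continuousOn.integrableOn_compact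
    isCompact_Icc).mono_set Set.Ioo_subset_Icc_self

theorem integral_mul_indicator_Ioo {f : ℝ → ℝ} (g : ℝ → ℝ) {a b : ℝ} (hab : a ≤ b) :
    ∫ t, g t * (Set.Ioo a b).indicator f t = ∫ t in a..b, g t * f t := by
  rw [intervalIntegral.integral_of_le hab, integral_Ioc_eq_integral_Ioo,
    ← integral_indicator measurableSet_Ioo]
  congr 1
  funext t
  by_cases h : t ∈ Set.Ioo a b <;> simp [h]

/-- Hankel determinants are invariant under translation. -/
theorem det_hankel_sub (n : ℕ) {f : ℝ → ℝ} (hf : Continuous f) {a b : ℝ} (hab : a ≤ b) (y : ℝ) :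
    (Matrix.of fun i j : Fin n => ∫ x in a..b, (x - y) ^ ((i : ℕ) + j) * f x).det =
      (Matrix.of fun i j : Fin n => ∫ x in a..b, x ^ ((i : ℕ) + j) * f x).det := by
  set h := (Set.Ioo a b).indicator f with hh
  have h1 := integral_strictMono_vandermonde_sq (n := n) h (integrable_pow_mul_indicator hf a b)
  have hshift : ∀ k : ℕ, ∀ u : ℝ, u ^ k * h (u + y) = (fun x => (x - y) ^ k * h x) (u + y) := by
    intro k u; simp
  have h2 := integral_strictMono_vandermonde_sq (n := n) (fun u => h (u + y)) (fun k => by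
    simp only [hshift]
    refine Integrable.comp_add_right (f := fun x => (x - y) ^ k * h x) ?_ y
    have : (fun x => (x - y) ^ k * h x) =
        fun x => x ^ 0 * (Set.Ioo a b).indicator (fun x => (x - y) ^ k * f x) x := by
      funext x
      by_cases hx : x ∈ Set.Ioo a b <;> simp [hh, hx]
    rw [this]
    exact integrable_pow_mul_indicator (by fun_prop) a b 0)
  have e1 : (Matrix.of fun i j : Fin n => ∫ x in a..b, x ^ ((i : ℕ) + j) * f x) =
      Matrix.of fun i j : Fin n => ∫ t, t ^ ((i : ℕ) + j) * h t := by
    ext i j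
    exact (integral_mul_indicator_Ioo (fun t => t ^ ((i : ℕ) + j)) hab).symm
  have e2 : (Matrix.of fun i j : Fin n => ∫ x in a..b, (x - y) ^ ((i : ℕ) + j) * f x) =
      Matrix.of fun i j : Fin n => ∫ t, t ^ ((i : ℕ) + j) * h (t + y) := by
    ext i j
    simp only [Matrix.of_apply, hshift]
    rw [integral_add_right_eq_self (fun x => (x - y) ^ ((i : ℕ) + j) * h x)]
    exact (integral_mul_indicator_Ioo (fun t => (t - y) ^ ((i : ℕ) + j)) hab).symm
  rw [e1, e2, ← h1, ← h2, ← integral_indicator (measurableSet_strictMono n),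
    ← integral_indicator (measurableSet_strictMono n)]
  symm
  -- By Andréief both determinants are integrals of a squared Vandermonde determinant, which does
  -- not change when all variables are shifted by `y`.
  rw [← integral_add_right_eq_self _ (fun _ : Fin n => y)]
  congr 1
  funext x
  have hmono : (x + fun _ => y) ∈ {x : Fin n → ℝ | StrictMono x} ↔
      x ∈ {x : Fin n → ℝ | StrictMono x} := by
    simp [StrictMono]
  by_cases hx : x ∈ {x : Fin n → ℝ | StrictMono x}
  · rw [Set.indicator_of_mem hx, Set.indicator_of_mem (hmono.2 hx)]
    congr 2
    exact det_vandermonde_add x y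
  · rw [Set.indicator_of_notMem hx, Set.indicator_of_notMem fun h => hx (hmono.1 h)]

theorem det_mul_geometric {n : ℕ} (K c : ℝ) (M : Matrix (Fin n) (Fin n) ℝ) :
    (Matrix.of fun i j : Fin n => K * c ^ ((i : ℕ) + j) * M i j).det =
      K ^ n * c ^ (n * (n - 1)) * M.det := by
  have : (Matrix.of fun i j : Fin n => K * c ^ ((i : ℕ) + j) * M i j) =
      Matrix.of fun i j : Fin n => (K * c ^ (i : ℕ)) *
        (Matrix.of fun i j : Fin n => c ^ (j : ℕ) * M i j) i j := by
    ext i j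
    simp only [Matrix.of_apply]
    ring
  rw [this, Matrix.det_mul_column, Matrix.det_mul_row, Finset.prod_mul_distrib, Finset.prod_const,
    Finset.card_univ, Fintype.card_fin, Finset.prod_pow_eq_pow_sum,
    Fin.sum_univ_eq_sum_range (fun i => i), ← Finset.sum_range_id_mul_two, mul_two, pow_add]
  ring

/-- The substitution `t = c (x - y)` with `c = (1 - ξ) / 2` maps `[-1, 1]` onto `[ξ, 1]`. The powers
of `x - y` in the moments are replaced by powers of `x` through translation invariance. -/
theorem truncatedHankel_det (n α β : ℕ) {ξ : ℝ} (hξ : ξ < 1) :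
    (truncatedHankel n α β ξ).det = (((-1) ^ β) ^ n * (1 / 2) ^ (n ^ 2 + n * α + n * β)) *
      ((1 - ξ) ^ (n ^ 2 + n * α + n * β) *
        (jacobiHankel n α β (-((1 + ξ) / (1 - ξ)))).det) := by
  set y := -((1 + ξ) / (1 - ξ)) with hy
  set c := (1 - ξ) / 2 with hc
  have hξ' : 1 - ξ ≠ 0 := by linarith
  have hc0 : c ≠ 0 := div_ne_zero hξ' two_ne_zero
  have hsub : ∀ k : ℕ, ∫ t in ξ..1, t ^ k * (t ^ α * (1 - t) ^ β) =
      (-1) ^ β * c ^ (1 + α + β) * c ^ k *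
        ∫ x in (-1)..1, (x - y) ^ k * ((x - y) ^ α * (x - 1) ^ β) := by
    intro k
    have h := intervalIntegral.mul_integral_comp_mul_sub
      (f := fun t : ℝ => t ^ k * (t ^ α * (1 - t) ^ β)) (a := -1) (b := 1) c (c * y)
    have e1 : c * -1 - c * y = ξ := by rw [hc, hy]; field_simp; ring
    have e2 : c * 1 - c * y = 1 := by rw [hc, hy]; field_simp; ring
    rw [e1, e2] at h
    rw [← h, ← intervalIntegral.integral_const_mul, ← intervalIntegral.integral_const_mul]
    refine intervalIntegral.integral_congr fun x _ => ?_
    have e3 : c * x - c * y = c * (x - y) := by ring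
    have e4 : 1 - c * (x - y) = -1 * c * (x - 1) := by linear_combination -e2
    simp only [e3, e4, mul_pow]
    ring
  have hM : truncatedHankel n α β ξ = Matrix.of fun i j : Fin n =>
      ((-1) ^ β * c ^ (1 + α + β)) * c ^ ((i : ℕ) + j) *
        (Matrix.of fun i j : Fin n => ∫ x in (-1)..1, (x - y) ^ ((i : ℕ) + j) *
          ((x - y) ^ α * (x - 1) ^ β)) i j := by
    ext i j
    exact hsub _
  rw [hM, det_mul_geometric, det_hankel_sub n (f := fun x => (x - y) ^ α * (x - 1) ^ β)
    (by fun_prop) (by norm_num)]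
  change _ * (jacobiHankel n α β y).det = _
  -- `n (1 + α + β)` comes from the weight and `dt`, `n (n - 1)` from the powers in rows and
  -- columns.
  have hp : (c ^ (1 + α + β)) ^ n * c ^ (n * (n - 1)) = c ^ (n ^ 2 + n * α + n * β) := by
    rw [← pow_mul, ← pow_add]
    congr 1
    rcases n with _ | n
    · simp
    · simp only [Nat.add_sub_cancel]; ring
  rw [mul_pow, mul_assoc (((-1) ^ β) ^ n), hp, hc, div_eq_mul_one_div, mul_pow]
  ring

/-- All constants cancel against the case `ξ = 0`, `y = -1`. The remaining factor `(1 - ξ)^(αβ)`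
comes from `y - 1 = -2 / (1 - ξ)`. Both `c₁` and the Legendre determinant at `-1` are nonzero
because the Hankel determinant at `0` is. -/
theorem truncatedHankel_ratio (n α β : ℕ) {ξ : ℝ} (hξ : ξ < 1)
    (h0 : (truncatedHankel n α β 0).det ≠ 0) :
    (truncatedHankel n α β ξ).det / (truncatedHankel n α β 0).det = 1 - legendreG n α β ξ := by
  obtain ⟨c₁, c₂, hc₂, hc⟩ := exists_legendreDet_eq n α β
  set N := n ^ 2 + n * α + n * β with hN
  rw [truncatedHankel_det n α β hξ, legendreG, sub_sub_cancel]
  have hC : ((-1 : ℝ) ^ β) ^ n * (1 / 2) ^ N ≠ 0 := by positivity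
  rw [truncatedHankel_det n α β zero_lt_one] at h0 ⊢
  simp only [add_zero, sub_zero, div_one, one_pow, one_mul] at h0 ⊢
  rw [mul_div_mul_left _ _ hC, pow_add _ N]
  have hJ : (jacobiHankel n α β (-1)).det ≠ 0 := right_ne_zero_of_mul h0
  have hy := hc (-((1 + ξ) / (1 - ξ)))
  have h1 := hc (-1)
  have hξ' : 1 - ξ ≠ 0 := by linarith
  have e1 : -((1 + ξ) / (1 - ξ)) - 1 = -2 / (1 - ξ) := by field_simp; ring
  have e2 : (-1 : ℝ) - 1 = -2 := by norm_num
  rw [e1, div_pow] at hy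
  rw [e2] at h1
  have h2 : (-2 : ℝ) ^ (α * β) ≠ 0 := pow_ne_zero _ (by norm_num)
  have hcL : c₁ * legendreDet n α β (-1) 1 ≠ 0 := by
    rw [← h1]; exact mul_ne_zero hc₂ (mul_ne_zero h2 hJ)
  have hL := right_ne_zero_of_mul hcL
  have hc₁ := left_ne_zero_of_mul hcL
  have hξp : (1 - ξ) ^ (α * β) ≠ 0 := pow_ne_zero _ hξ'
  have hD : (jacobiHankel n α β (-((1 + ξ) / (1 - ξ)))).det =
      c₁ * legendreDet n α β (-((1 + ξ) / (1 - ξ))) 1 * (1 - ξ) ^ (α * β) /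
        (c₂ * (-2) ^ (α * β)) := by
    rw [eq_div_iff (mul_ne_zero hc₂ h2), ← hy]
    field_simp
  have hD0 : (jacobiHankel n α β (-1)).det =
      c₁ * legendreDet n α β (-1) 1 / (c₂ * (-2) ^ (α * β)) := by
    rw [eq_div_iff (mul_ne_zero hc₂ h2), ← h1]
    ring
  rw [hD, hD0, ← hN]
  field_simp

/-! ### The smallest root of a Gaussian pencil -/

/-- Andréief's identity for the weight `t^α (1 - t)^β` cut off to `(ξ, 1)`. -/
theorem lintegral_chamber_tail (n α β : ℕ) {ξ : ℝ} (h0 : 0 ≤ ξ) (h1 : ξ ≤ 1) :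
    0 ≤ (truncatedHankel n α β ξ).det ∧
      ∫⁻ φ in chamber n, ENNReal.ofReal (jacobiDensity α β φ) *
        {φ : Fin n → ℝ | ∀ i, ξ < φ i}.indicator 1 φ =
          ENNReal.ofReal (truncatedHankel n α β ξ).det := by
  set h : ℝ → ℝ := (Set.Ioo ξ 1).indicator fun t => t ^ α * (1 - t) ^ β with hh
  set B : Set (Fin n → ℝ) := Set.univ.pi fun _ => Set.Ioo ξ 1 with hB
  have hBm : MeasurableSet B := MeasurableSet.univ_pi fun _ => measurableSet_Ioo
  have hSm := measurableSet_strictMono n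
  have hprod : ∀ x : Fin n → ℝ, (vandermonde x).det ^ 2 * ∏ i, h (x i) =
      B.indicator (jacobiDensity α β) x := by
    intro x
    by_cases hx : x ∈ B
    · rw [Set.indicator_of_mem hx]
      have : ∀ i, h (x i) = x i ^ α * (1 - x i) ^ β := fun i =>
        Set.indicator_of_mem (hx i (Set.mem_univ i)) _
      simp only [this, jacobiDensity, jacobiWeight, Finset.prod_mul_distrib, Finset.prod_pow]
      ring
    · rw [Set.indicator_of_notMem hx]
      have : ∃ i, x i ∉ Set.Ioo ξ 1 := by
        by_contra hne
        push Not at hne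
        exact hx fun i _ => hne i
      obtain ⟨i, hi⟩ := this
      rw [Finset.prod_eq_zero (Finset.mem_univ i) (Set.indicator_of_notMem hi _), mul_zero]
  have hand := integral_strictMono_vandermonde_sq (n := n) h
    (integrable_pow_mul_indicator (by fun_prop) ξ 1)
  have hM : (Matrix.of fun i j : Fin n => ∫ t, t ^ ((i : ℕ) + j) * h t) =
      truncatedHankel n α β ξ := by
    ext i j
    exact integral_mul_indicator_Ioo (fun t => t ^ ((i : ℕ) + j)) h1
  rw [hM] at hand
  simp only [hprod] at hand
  have hnonneg : 0 ≤ᵐ[volume.restrict {x : Fin n → ℝ | StrictMono x}]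
      B.indicator (jacobiDensity α β) := by
    filter_upwards [ae_restrict_mem hSm] with x hx
    by_cases hb : x ∈ B
    · rw [Set.indicator_of_mem hb]
      have hxB : ∀ i, ξ < x i ∧ x i < 1 := fun i => hb i (Set.mem_univ i)
      have hc : x ∈ chamber n := ⟨hx, fun i => ⟨h0.trans_lt (hxB i).1, (hxB i).2⟩⟩
      exact (mul_pos (jacobiWeight_pos α β hc) (vandermonde_det_pos hx)).le
    · rw [Set.indicator_of_notMem hb]
      exact le_rfl
  refine ⟨hand ▸ integral_nonneg_of_ae hnonneg, ?_⟩
  rw [← hand, ofReal_integral_eq_lintegral_ofReal]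
  · rw [← lintegral_indicator (measurableSet_chamber n), ← lintegral_indicator hSm]
    refine lintegral_congr fun x => ?_
    by_cases hx : StrictMono x ∧ x ∈ B
    · have hxB : ∀ i, ξ < x i ∧ x i < 1 := fun i => hx.2 i (Set.mem_univ i)
      rw [Set.indicator_of_mem (show x ∈ chamber n from
          ⟨hx.1, fun i => ⟨h0.trans_lt (hxB i).1, (hxB i).2⟩⟩),
        Set.indicator_of_mem (show x ∈ {φ : Fin n → ℝ | ∀ i, ξ < φ i} from fun i => (hxB i).1),
        Set.indicator_of_mem (show x ∈ {x : Fin n → ℝ | StrictMono x} from hx.1),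
        Set.indicator_of_mem hx.2]
      simp
    · have hr : {x : Fin n → ℝ | StrictMono x}.indicator
          (fun x => ENNReal.ofReal (B.indicator (jacobiDensity α β) x)) x = 0 := by
        by_cases hs : StrictMono x
        · rw [Set.indicator_of_mem (show x ∈ {x : Fin n → ℝ | StrictMono x} from hs),
            Set.indicator_of_notMem fun hb => hx ⟨hs, hb⟩, ENNReal.ofReal_zero]
        · exact Set.indicator_of_notMem (s := {x : Fin n → ℝ | StrictMono x}) hs _
      rw [hr]
      by_cases hc : x ∈ chamber n
      · rw [Set.indicator_of_mem hc, Set.indicator_of_notMem (s := {φ : Fin n → ℝ | ∀ i, ξ < φ i})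
          fun hξ => hx ⟨hc.1, fun i _ => ⟨hξ i, (hc.2 i).2⟩⟩, mul_zero]
      · exact Set.indicator_of_notMem hc _
  · refine Integrable.integrableOn ?_
    rw [integrable_indicator_iff hBm]
    exact ((continuous_jacobiDensity α β).continuousOn.integrableOn_compact
      (isCompact_univ_pi fun _ => isCompact_Icc)).mono_set
        (Set.pi_mono fun _ _ => Set.Ioo_subset_Icc_self)
  · exact hnonneg

/-- Countably many evaluations, all at points beyond `1`, determine the polynomial and hence its
ordered roots; countability is what makes the inverse map accessible to measure theory. -/
theorem eq_of_prod_sub_eq {n : ℕ} {φ ψ : Fin n → ℝ} (hφ : StrictMono φ) (hψ : StrictMono ψ)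
    (h : ∀ j : ℕ, ∏ i, ((j : ℝ) + 2 - φ i) = ∏ i, ((j : ℝ) + 2 - ψ i)) : φ = ψ := by
  have hpoly : (∏ i, (X - C (φ i)) : ℝ[X]) = ∏ i, (X - C (ψ i)) := by
    refine Polynomial.eq_of_infinite_eval_eq _ _ (Set.infinite_of_injective_forall_mem
      (f := fun j : ℕ => (j : ℝ) + 2) (fun a b hab => by simpa using hab) fun j => ?_)
    simpa [eval_prod] using h j
  have hroots : ∀ (χ : Fin n → ℝ) (x : ℝ),
      (∏ i, (X - C (χ i)) : ℝ[X]).eval x = 0 ↔ x ∈ Set.range χ := fun χ x => by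
    simp [eval_prod, Finset.prod_eq_zero_iff, sub_eq_zero, eq_comm (a := x)]
  have hrange : Set.range φ = Set.range ψ := by
    ext x
    rw [← hroots, ← hroots, hpoly]
  exact (hφ.range_inj hψ).1 hrange

theorem continuous_pencilDet {m₁ m₂ : ℕ} (k : ℕ) (p q : ℝ) :
    Continuous fun Y : Fin k → Fin m₁ ⊕ Fin m₂ → ℂ => pencilDet Y p q := by
  unfold pencilDet
  refine Complex.continuous_re.comp (Continuous.matrix_det (continuous_matrix fun i j => ?_))
  simp only [pencil_apply]
  fun_prop

/-- The ordered roots of a pencil are a measurable function of the pencil. -/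
theorem exists_measurable_roots (m₁ m₂ k : ℕ) :
    ∃ Φ : (Fin k → Fin m₁ ⊕ Fin m₂ → ℂ) → Fin k → ℝ, Measurable Φ ∧
      ∀ Y φ, φ ∈ chamber k → HasRoots Y φ → Φ Y = φ := by
  have hm : Measurable fun (φ : chamber k) (j : ℕ) => ∏ i, ((j : ℝ) + 2 - φ.1 i) := by
    refine measurable_pi_lambda _ fun j => Finset.measurable_prod _ fun i _ => ?_
    exact measurable_const.sub ((measurable_pi_apply i).comp measurable_subtype_coe)
  -- An injective measurable map from a standard Borel space is a measurable embedding, so the roots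
  -- are measurable in the values at the points `j + 2`.
  have : StandardBorelSpace (chamber k) := (measurableSet_chamber k).standardBorel
  have hemb := hm.measurableEmbedding fun φ ψ h =>
    Subtype.ext (eq_of_prod_sub_eq φ.2.1 ψ.2.1 fun j => congrFun h j)
  obtain ⟨g, hg, hgE⟩ := hemb.exists_measurable_extend measurable_subtype_coe
    fun _ => inferInstance
  refine ⟨fun Y => g fun j : ℕ => pencilDet Y ((j : ℝ) + 1) ((j : ℝ) + 2) / pencilDet Y 1 1,
    hg.comp (measurable_pi_lambda _ fun j => (continuous_pencilDet k _ _).measurable.div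
      (continuous_pencilDet k _ _).measurable), fun Y φ hφ hY => ?_⟩
  have h1 := congrFun hgE ⟨φ, hφ⟩
  simp only [Function.comp_apply] at h1
  refine Eq.trans (congrArg g (funext fun j => ?_)) h1
  have h2 := hY.2 ((j : ℝ) + 2) (by have : (0 : ℝ) ≤ j := j.cast_nonneg; linarith)
  have e : (j : ℝ) + 2 - 1 = j + 1 := by ring
  rw [e] at h2
  rw [h2, mul_div_cancel_left₀ _ hY.1.ne']

theorem measurableSet_hasRoots {m₁ m₂ k : ℕ}
    {Φ : (Fin k → Fin m₁ ⊕ Fin m₂ → ℂ) → Fin k → ℝ} (hΦ : Measurable Φ) :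
    MeasurableSet {Y | Φ Y ∈ chamber k ∧ HasRoots Y (Φ Y)} := by
  have h1 : MeasurableSet {Y | Φ Y ∈ chamber k} := hΦ (measurableSet_chamber k)
  have h2 : MeasurableSet {Y : Fin k → Fin m₁ ⊕ Fin m₂ → ℂ | 0 < pencilDet Y 1 1} :=
    measurableSet_lt measurable_const (continuous_pencilDet k 1 1).measurable
  have h3 : IsClosed {z : (Fin k → Fin m₁ ⊕ Fin m₂ → ℂ) × (Fin k → ℝ) |
      ∀ t : ℝ, 1 < t → pencilDet z.1 (t - 1) t = pencilDet z.1 1 1 * ∏ i, (t - z.2 i)} := by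
    have : {z : (Fin k → Fin m₁ ⊕ Fin m₂ → ℂ) × (Fin k → ℝ) |
        ∀ t : ℝ, 1 < t → pencilDet z.1 (t - 1) t = pencilDet z.1 1 1 * ∏ i, (t - z.2 i)} =
        ⋂ t : ℝ, ⋂ _ : 1 < t, {z : (Fin k → Fin m₁ ⊕ Fin m₂ → ℂ) × (Fin k → ℝ) |
          pencilDet z.1 (t - 1) t = pencilDet z.1 1 1 * ∏ i, (t - z.2 i)} := by
      ext; simp
    rw [this]
    refine isClosed_iInter fun t => isClosed_iInter fun _ => isClosed_eq
      ((continuous_pencilDet k _ _).comp continuous_fst)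
      (((continuous_pencilDet k _ _).comp continuous_fst).mul ?_)
    fun_prop
  exact h1.inter (h2.inter ((measurable_id.prodMk hΦ) h3.measurableSet))

/-- The roots of a Gaussian pencil: existence, tails of the smallest root, absence of atoms. -/
theorem exists_gaussian_roots (m₁ m₂ n : ℕ) (hm₁ : n ≤ m₁) (hm₂ : n ≤ m₂) :
    ∃ Φ : (Fin n → Fin m₁ ⊕ Fin m₂ → ℂ) → Fin n → ℝ, Measurable Φ ∧
      (∀ᵐ Y ∂(Measure.pi fun _ => gaussVec (Fin m₁ ⊕ Fin m₂)),
        Φ Y ∈ chamber n ∧ HasRoots Y (Φ Y)) ∧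
      (∀ ξ : ℝ, 0 ≤ ξ → ξ < 1 →
        (Measure.pi fun _ => gaussVec (Fin m₁ ⊕ Fin m₂)).real {Y | ∀ i, ξ < Φ Y i} =
          1 - legendreG n (m₁ - n) (m₂ - n) ξ) ∧
      ∀ (i : Fin n) (t : ℝ),
        (Measure.pi fun _ => gaussVec (Fin m₁ ⊕ Fin m₂)) {Y | Φ Y i = t} = 0 := by
  obtain ⟨Φ, hΦ, hroot⟩ := exists_measurable_roots m₁ m₂ n
  obtain ⟨c, hc⟩ := exists_lintegral_roots m₁ m₂ n hm₁ hm₂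
  set γ : Measure (Fin n → Fin m₁ ⊕ Fin m₂ → ℂ) :=
    Measure.pi fun _ => gaussVec (Fin m₁ ⊕ Fin m₂) with hγ
  have hset : ∀ B : Set (Fin n → ℝ), MeasurableSet B → γ {Y | Φ Y ∈ B} =
      c * ∫⁻ φ in chamber n, ENNReal.ofReal (jacobiDensity (m₁ - n) (m₂ - n) φ) *
        B.indicator 1 φ := by
    intro B hB
    rw [← hc (fun Y => B.indicator 1 (Φ Y)) (B.indicator 1)
      ((measurable_one.indicator hB).comp hΦ) (measurable_one.indicator hB)
      fun Y φ hφ hY => by rw [hroot Y φ hφ hY]]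
    exact (lintegral_indicator_one (hΦ hB)).symm
  have htailm : ∀ ξ : ℝ, MeasurableSet {φ : Fin n → ℝ | ∀ i, ξ < φ i} := by
    intro ξ
    have : {φ : Fin n → ℝ | ∀ i, ξ < φ i} = Set.univ.pi fun _ => Set.Ioi ξ := by
      ext; simp
    rw [this]
    exact MeasurableSet.univ_pi fun _ => measurableSet_Ioi
  have htail : ∀ ξ : ℝ, 0 ≤ ξ → ξ ≤ 1 → γ {Y | ∀ i, ξ < Φ Y i} =
      c * ENNReal.ofReal (truncatedHankel n (m₁ - n) (m₂ - n) ξ).det := by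
    intro ξ h0 h1
    rw [← (lintegral_chamber_tail n _ _ h0 h1).2]
    exact hset _ (htailm ξ)
  have hexists : ∀ᵐ Y ∂γ, Φ Y ∈ chamber n ∧ HasRoots Y (Φ Y) := by
    -- The indicator of the exceptional set agrees with `0` whenever roots exist, so its integral is
    -- zero.
    have h := hc ({Y | Φ Y ∈ chamber n ∧ HasRoots Y (Φ Y)}ᶜ.indicator 1) 0
      (measurable_one.indicator (measurableSet_hasRoots hΦ).compl) measurable_zero
      fun Y φ hφ hY => by
        have : Y ∈ {Y | Φ Y ∈ chamber n ∧ HasRoots Y (Φ Y)} := by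
          change Φ Y ∈ chamber n ∧ HasRoots Y (Φ Y)
          rw [hroot Y φ hφ hY]
          exact ⟨hφ, hY⟩
        rw [Set.indicator_of_notMem (Set.notMem_compl_iff.2 this), Pi.zero_apply]
    rw [lintegral_indicator_one (measurableSet_hasRoots hΦ).compl] at h
    simp only [Pi.zero_apply, mul_zero, lintegral_zero] at h
    exact h
  refine ⟨Φ, hΦ, hexists, ?_, ?_⟩
  · have h0 : γ {Y | ∀ i, 0 < Φ Y i} = 1 := by
      refine (mem_ae_iff_prob_eq_one (hΦ (htailm 0))).1 ?_
      filter_upwards [hexists] with Y hY i using (hY.1.2 i).1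
    have h0' := htail 0 le_rfl zero_le_one
    rw [h0] at h0'
    set D0 := (truncatedHankel n (m₁ - n) (m₂ - n) 0).det with hD0
    have hpos : 0 < D0 := by
      by_contra hle
      rw [ENNReal.ofReal_of_nonpos (not_lt.1 hle), mul_zero] at h0'
      exact one_ne_zero h0'
    have hcv : c = ENNReal.ofReal D0⁻¹ := by
      rw [ENNReal.ofReal_inv_of_pos hpos]
      exact ENNReal.eq_inv_of_mul_eq_one_left h0'.symm
    intro ξ hξ0 hξ1
    rw [measureReal_def, htail ξ hξ0 hξ1.le, hcv, ← ENNReal.ofReal_mul (by positivity),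
      ENNReal.toReal_ofReal (mul_nonneg (inv_nonneg.2 hpos.le)
        (lintegral_chamber_tail n _ _ hξ0 hξ1.le).1),
      ← truncatedHankel_ratio n _ _ hξ1 hpos.ne', div_eq_inv_mul]
  · intro i t
    have h := hset {φ | φ i = t} (measurableSet_eq_fun (measurable_pi_apply i) measurable_const)
    refine h.trans ?_
    rw [lintegral_eq_zero_of_ae_eq_zero, mul_zero]
    have hnull : ∀ᵐ φ : Fin n → ℝ, φ i ≠ t := by
      rw [volume_pi]
      exact Measure.ae_eval_ne (μ := fun _ : Fin n => (volume : Measure ℝ)) i t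
    filter_upwards [ae_restrict_of_ae hnull] with φ hφ
    rw [Set.indicator_of_notMem (show φ ∉ {φ : Fin n → ℝ | φ i = t} from hφ), mul_zero]
    rfl

/-! ### Whitening -/

theorem exists_inv_eq_conjTranspose_mul {n : ℕ} {S : Matrix (Fin n) (Fin n) ℂ} (hS : S.PosDef) :
    ∃ A : Matrix (Fin n) (Fin n) ℂ, A.det ≠ 0 ∧ S⁻¹ = Aᴴ * A := by
  obtain ⟨T, -, hT, -⟩ := exists_simultaneous_diagonalization (A := S) hS.isHermitian hS
  have hdet := congrArg Matrix.det hT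
  rw [Matrix.det_mul, Matrix.det_mul, Matrix.det_one] at hdet
  have hTH : Tᴴ.det ≠ 0 := fun h => by simp [h] at hdet
  refine ⟨Tᴴ, hTH, ?_⟩
  rw [Matrix.conjTranspose_conjTranspose]
  refine Matrix.inv_eq_left_inv ?_
  have h1 : Tᴴ * (S * T) = 1 := by rw [← Matrix.mul_assoc, hT]
  have h2 : S * T * Tᴴ = 1 := mul_eq_one_comm.1 h1
  have h3 : S * (T * Tᴴ) = 1 := by rw [← Matrix.mul_assoc, h2]
  exact mul_eq_one_comm.1 h3

/-- Since `S⁻¹ = Aᴴ A`, the quadratic form in the density is `‖A x‖²`, so the image is proportional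
to the standard Gaussian law; both are probability measures. -/
theorem map_complexGaussian {n : ℕ} {S A : Matrix (Fin n) (Fin n) ℂ}
    [IsProbabilityMeasure (complexGaussian S)] (hS : S.PosDef) (hA : A.det ≠ 0)
    (hSA : S⁻¹ = Aᴴ * A) :
    (complexGaussian S).map (fun x => A *ᵥ x) = gaussVec (Fin n) := by
  have hinj : Function.Injective (Matrix.mulVecLin A) :=
    Matrix.mulVec_injective_iff_isUnit.2
      ((Matrix.isUnit_iff_isUnit_det A).2 (isUnit_iff_ne_zero.2 hA))
  have hcont : Measurable (Matrix.mulVecLin A) :=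
    (LinearMap.continuous_of_finiteDimensional _).measurable
  have hdet : 0 < S.det.re := (Complex.pos_iff.1 hS.det_pos).1
  have hquad : ∀ x : Fin n → ℂ, (star x ⬝ᵥ (S⁻¹ *ᵥ x)).re = ∑ i, ‖(A *ᵥ x) i‖ ^ 2 := by
    intro x
    rw [hSA, ← Matrix.mulVec_mulVec, Matrix.dotProduct_mulVec, ← Matrix.star_mulVec, dotProduct,
      Complex.re_sum]
    refine Finset.sum_congr rfl fun i _ => ?_
    rw [Pi.star_apply, Complex.star_def, Complex.conj_mul']
    norm_cast
  obtain ⟨c, hc⟩ := exists_map_withDensity_linearMap (Matrix.mulVecLin A) hinj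
    (g := fun x : Fin n → ℂ =>
      ENNReal.ofReal ((Real.pi ^ Fintype.card (Fin n))⁻¹ * Real.exp (-∑ i, ‖x i‖ ^ 2)))
    (by fun_prop)
  rw [← gaussVec_eq_withDensity] at hc
  have hcg : complexGaussian S = ENNReal.ofReal (S.det.re)⁻¹ • volume.withDensity fun x =>
      ENNReal.ofReal ((Real.pi ^ Fintype.card (Fin n))⁻¹ *
        Real.exp (-∑ i, ‖Matrix.mulVecLin A x i‖ ^ 2)) := by
    rw [complexGaussian, ← withDensity_smul _ (by
      have : Measurable fun x => Matrix.mulVecLin A x := hcont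
      fun_prop)]
    congr 1
    funext x
    rw [Pi.smul_apply, smul_eq_mul, ← ENNReal.ofReal_mul (by positivity), hquad, Fintype.card_fin]
    congr 1
    rw [Matrix.mulVecLin_apply]
    field_simp
  have hmap : (complexGaussian S).map (fun x => A *ᵥ x) =
      (ENNReal.ofReal (S.det.re)⁻¹ * c) • gaussVec (Fin n) := by
    change (complexGaussian S).map (Matrix.mulVecLin A) = _
    rw [hcg, Measure.map_smul, hc, smul_smul]
  have : IsProbabilityMeasure ((complexGaussian S).map (fun x => A *ᵥ x)) :=
    Measure.isProbabilityMeasure_map hcont.aemeasurable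
  exact eq_of_eq_smul hmap

theorem measurePreserving_curry (ι κ : Type*) [Fintype ι] [Fintype κ] {E : Type*}
    [MeasurableSpace E] (μ : Measure E) [IsProbabilityMeasure μ] :
    MeasurePreserving (MeasurableEquiv.curry ι κ E) (Measure.pi fun _ : ι × κ => μ)
      (Measure.pi fun _ : ι => Measure.pi fun _ : κ => μ) := by
  refine ⟨(MeasurableEquiv.curry ι κ E).measurable, ?_⟩
  have := Measure.infinitePi_map_curry (ι := ι) (κ := κ) (X := E) (fun _ _ => μ)
  simpa only [Measure.infinitePi_eq_pi] using this

theorem measurePreserving_transpose (ι κ : Type*) [Fintype ι] [Fintype κ] {E : Type*}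
    [MeasurableSpace E] (μ : Measure E) [IsProbabilityMeasure μ] :
    MeasurePreserving (fun (x : ι → κ → E) j i => x i j)
      (Measure.pi fun _ : ι => Measure.pi fun _ : κ => μ)
      (Measure.pi fun _ : κ => Measure.pi fun _ : ι => μ) := by
  have h2 := measurePreserving_piCongrLeft (fun _ : κ × ι => μ) (Equiv.prodComm ι κ)
  exact (measurePreserving_curry κ ι μ).comp (h2.comp (measurePreserving_curry ι κ μ).symm)

theorem pencilDet_star {m₁ m₂ k : ℕ} (Y : Fin k → Fin m₁ ⊕ Fin m₂ → ℂ) (p q : ℝ) :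
    pencilDet (fun j r => star (Y j r)) p q = pencilDet Y p q := by
  have h : pencil (fun j r => star (Y j r)) p q = (pencil Y p q).map (starRingEnd ℂ) := by
    ext i j
    simp [pencil_apply, Matrix.map_apply]
  rw [pencilDet, h, pencilDet]
  have := (RingHom.map_det (starRingEnd ℂ) (pencil Y p q)).symm
  rw [RingHom.mapMatrix_apply] at this
  rw [this, Complex.conj_re]

theorem HasRoots.of_pencilDet_eq {m₁ m₂ k : ℕ} {Y Y' : Fin k → Fin m₁ ⊕ Fin m₂ → ℂ} {κ : ℝ}
    (hκ : 0 < κ) (h : ∀ p q, pencilDet Y p q = κ * pencilDet Y' p q) {φ : Fin k → ℝ}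
    (hY : HasRoots Y φ) : HasRoots Y' φ := by
  refine ⟨pos_of_mul_pos_right (h 1 1 ▸ hY.1) hκ.le, fun z hz => ?_⟩
  have := hY.2 z hz
  rw [h, h, mul_assoc] at this
  exact mul_left_cancel₀ hκ.ne' this

/-- The columns of the matrix obtained by stacking two matrices. -/
def stackedColumns {m₁ m₂ n : ℕ} (X₁ : Matrix (Fin m₁) (Fin n) ℂ) (X₂ : Matrix (Fin m₂) (Fin n) ℂ)
    (j : Fin n) : Fin m₁ ⊕ Fin m₂ → ℂ := Sum.elim (fun r => X₁ r j) fun r => X₂ r j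

/-- The coordinates of the whitened rows of two matrices. -/
def whitened {m₁ m₂ n : ℕ} (A : Matrix (Fin n) (Fin n) ℂ) (X₁ : Matrix (Fin m₁) (Fin n) ℂ)
    (X₂ : Matrix (Fin m₂) (Fin n) ℂ) (j : Fin n) (r : Fin m₁ ⊕ Fin m₂) : ℂ :=
  Sum.elim (fun r => (A *ᵥ star (X₁ r)) j) (fun r => (A *ᵥ star (X₂ r)) j) r

/-- Whitening the conjugated rows multiplies the stacked matrix, up to complex conjugation, by `Aᴴ`
on the right; conjugation does not affect the real part of the determinant. -/
theorem pencilDet_whitened {m₁ m₂ n : ℕ} (A : Matrix (Fin n) (Fin n) ℂ)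
    (X₁ : Matrix (Fin m₁) (Fin n) ℂ) (X₂ : Matrix (Fin m₂) (Fin n) ℂ) (p q : ℝ) :
    pencilDet (whitened A X₁ X₂) p q = ‖A.det‖ ^ 2 * pencilDet (stackedColumns X₁ X₂) p q := by
  rw [← pencilDet_star]
  have hcol : colMatrix (fun j r => star (whitened A X₁ X₂ j r)) =
      colMatrix (stackedColumns X₁ X₂) * Aᴴ := by
    ext r j
    rcases r with r | r <;>
      simp [colMatrix, whitened, stackedColumns, Matrix.mul_apply, Matrix.mulVec, dotProduct,
        mul_comm]
  have hp : pencil (fun j r => star (whitened A X₁ X₂ j r)) p q =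
      A * pencil (stackedColumns X₁ X₂) p q * Aᴴ := by
    rw [pencil, hcol, pencil, Matrix.conjTranspose_mul, Matrix.conjTranspose_conjTranspose]
    simp only [Matrix.mul_assoc]
  rw [pencilDet, hp, Matrix.det_mul, Matrix.det_mul, Matrix.det_conjTranspose, pencilDet,
    mul_right_comm, Complex.star_def, Complex.mul_conj']
  norm_cast
  exact Complex.re_ofReal_mul _ _

theorem pencil_stackedColumns {m₁ m₂ n : ℕ} (X₁ : Matrix (Fin m₁) (Fin n) ℂ)
    (X₂ : Matrix (Fin m₂) (Fin n) ℂ) (p q : ℝ) :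
    pencil (stackedColumns X₁ X₂) p q = (p : ℂ) • (X₁ᴴ * X₁) + (q : ℂ) • (X₂ᴴ * X₂) := by
  ext i j
  rw [pencil_apply]
  simp [stackedColumns, Matrix.mul_apply]

/-! ### Extreme eigenvalues -/

/-- From `Tᴴ (W₁ + W₂) T = 1` one reads off `(W₁ + W₂)⁻¹ = T Tᴴ` and `T⁻¹ = Tᴴ (W₁ + W₂)`. One and
the same `T` serves for both orders of the matrices, whence the eigenvalues `φ_i` and `1 - φ_i`. -/
theorem HasRoots.doubleWishart_similar {m₁ m₂ n : ℕ} {X₁ : Matrix (Fin m₁) (Fin n) ℂ}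
    {X₂ : Matrix (Fin m₂) (Fin n) ℂ} {φ : Fin n → ℝ} (hφ : Function.Injective φ)
    (h : HasRoots (stackedColumns X₁ X₂) φ) :
    ∃ T : (Matrix (Fin n) (Fin n) ℂ)ˣ,
      doubleWishart X₁ X₂ = T * Matrix.diagonal (fun i => (φ i : ℂ)) *
        (↑T⁻¹ : Matrix (Fin n) (Fin n) ℂ) ∧
      doubleWishart X₂ X₁ = T * Matrix.diagonal (fun i => ((1 - φ i : ℝ) : ℂ)) *
        (↑T⁻¹ : Matrix (Fin n) (Fin n) ℂ) := by
  obtain ⟨T, h1, h2⟩ := h.exists_diagonalization hφ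
  simp only [pencil_stackedColumns, Complex.ofReal_one, Complex.ofReal_zero, one_smul, zero_smul,
    add_zero, zero_add] at h1 h2
  have h3 : Tᴴ * (X₁ᴴ * X₁ + X₂ᴴ * X₂) * T = 1 := by
    rw [Matrix.mul_add, Matrix.add_mul, h1, h2, Matrix.diagonal_add, ← Matrix.diagonal_one]
    congr 1
    ext i
    simp
  have h4 : Tᴴ * (X₁ᴴ * X₁ + X₂ᴴ * X₂) * T = 1 := h3
  have h5 : T * (Tᴴ * (X₁ᴴ * X₁ + X₂ᴴ * X₂)) = 1 := mul_eq_one_comm.1 h4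
  have hinv : (X₁ᴴ * X₁ + X₂ᴴ * X₂)⁻¹ = T * Tᴴ :=
    Matrix.inv_eq_left_inv (by rw [Matrix.mul_assoc, h5])
  have hTT : ∀ B d, Tᴴ * B * T = Matrix.diagonal d → T * Tᴴ * B =
      T * Matrix.diagonal d * (Tᴴ * (X₁ᴴ * X₁ + X₂ᴴ * X₂)) := by
    intro B d hB
    rw [← hB]
    calc T * Tᴴ * B = T * Tᴴ * B * 1 := (Matrix.mul_one _).symm
      _ = _ := by rw [← h5]; simp only [Matrix.mul_assoc]
  refine ⟨⟨T, Tᴴ * (X₁ᴴ * X₁ + X₂ᴴ * X₂), h5, h4⟩, ?_, ?_⟩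
  · rw [doubleWishart, hinv]
    exact hTT _ _ h1
  · rw [doubleWishart, add_comm (X₂ᴴ * X₂), hinv]
    exact hTT _ _ h2

theorem spectrum_real_of_similar {n : ℕ} {B : Matrix (Fin n) (Fin n) ℂ} {d : Fin n → ℝ}
    (T : (Matrix (Fin n) (Fin n) ℂ)ˣ)
    (h : B = T * Matrix.diagonal (fun i => (d i : ℂ)) * (↑T⁻¹ : Matrix (Fin n) (Fin n) ℂ)) :
    {x : ℝ | (x : ℂ) ∈ spectrum ℂ B} = Set.range d := by
  rw [h, spectrum.units_conjugate, spectrum_diagonal]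
  ext x
  simp

theorem HasRoots.extremeEigenvalues {m₁ m₂ n : ℕ} {X₁ : Matrix (Fin m₁) (Fin n) ℂ}
    {X₂ : Matrix (Fin m₂) (Fin n) ℂ} {φ : Fin n → ℝ} (hφ : StrictMono φ) (hn : 0 < n)
    (h : HasRoots (stackedColumns X₁ X₂) φ) :
    smallestEigenvalue (doubleWishart X₁ X₂) = φ ⟨0, hn⟩ ∧
      largestEigenvalue (doubleWishart X₁ X₂) =
        1 - smallestEigenvalue (doubleWishart X₂ X₁) := by
  obtain ⟨T, h1, h2⟩ := h.doubleWishart_similar hφ.injective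
  have s1 := spectrum_real_of_similar T h1
  have s2 := spectrum_real_of_similar T h2
  have hmin : IsLeast (Set.range φ) (φ ⟨0, hn⟩) :=
    ⟨⟨_, rfl⟩, by rintro _ ⟨i, rfl⟩; exact hφ.monotone (Fin.mk_le_of_le_val (Nat.zero_le _))⟩
  have hle : ∀ i : Fin n, i ≤ ⟨n - 1, by omega⟩ := fun i => by rw [Fin.le_def]; simp; omega
  have hmax : IsGreatest (Set.range φ) (φ ⟨n - 1, by omega⟩) :=
    ⟨⟨_, rfl⟩, by rintro _ ⟨i, rfl⟩; exact hφ.monotone (hle i)⟩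
  have hmin' : IsLeast (Set.range fun i => 1 - φ i) (1 - φ ⟨n - 1, by omega⟩) :=
    ⟨⟨_, rfl⟩, by rintro _ ⟨i, rfl⟩; exact sub_le_sub_left (hφ.monotone (hle i)) 1⟩
  rw [smallestEigenvalue, smallestEigenvalue, largestEigenvalue, s1, s2, hmin.csInf_eq,
    hmax.csSup_eq, hmin'.csInf_eq]
  exact ⟨rfl, by ring⟩

/-! ### From the Gaussian matrices to the distribution functions -/

theorem IsComplexGaussianMatrix.hasLaw_whitened_rows {Ω : Type*} [MeasurableSpace Ω]
    {P : Measure Ω} [IsProbabilityMeasure P] {m n : ℕ} {X : Ω → Matrix (Fin m) (Fin n) ℂ}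
    {S A : Matrix (Fin n) (Fin n) ℂ} (hS : S.PosDef) (hA : A.det ≠ 0) (hSA : S⁻¹ = Aᴴ * A)
    (hX : IsComplexGaussianMatrix X S P) :
    HasLaw (fun ω r => A *ᵥ star (X ω r)) (Measure.pi fun _ : Fin m => gaussVec (Fin n)) P := by
  have hAm : Measurable fun x : Fin n → ℂ => A *ᵥ x :=
    (LinearMap.continuous_of_finiteDimensional (Matrix.mulVecLin A)).measurable
  have hm : ∀ r, AEMeasurable (fun ω => A *ᵥ star (X ω r)) P :=
    fun r => hAm.comp_aemeasurable (hX.law_row r).aemeasurable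
  refine ⟨aemeasurable_pi_lambda _ hm, ?_⟩
  have hind : iIndepFun (fun r ω => A *ᵥ star (X ω r)) P :=
    hX.indep_rows.comp (fun _ x => A *ᵥ star x) fun _ => hAm.comp continuous_star.measurable
  rw [hind.map_fun_eq_pi_map hm]
  congr 1
  funext r
  have : IsProbabilityMeasure (complexGaussian S) := by
    rw [← (hX.law_row r).map_eq]
    exact Measure.isProbabilityMeasure_map (hX.law_row r).aemeasurable
  rw [← map_complexGaussian hS hA hSA, ← (hX.law_row r).map_eq,
    AEMeasurable.map_map_of_aemeasurable hAm.aemeasurable (hX.law_row r).aemeasurable]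
  rfl

/-- After whitening, all entries of the stacked matrix are independent standard Gaussians, so
independence of rows can be exchanged for independence of columns, the form used in the
column-by-column induction. -/
theorem hasLaw_whitened {Ω : Type*} [MeasurableSpace Ω] {P : Measure Ω} [IsProbabilityMeasure P]
    {n m₁ m₂ : ℕ} {S A : Matrix (Fin n) (Fin n) ℂ} (hS : S.PosDef) (hA : A.det ≠ 0)
    (hSA : S⁻¹ = Aᴴ * A)
    {X₁ : Ω → Matrix (Fin m₁) (Fin n) ℂ} {X₂ : Ω → Matrix (Fin m₂) (Fin n) ℂ}
    (hX₁ : IsComplexGaussianMatrix X₁ S P) (hX₂ : IsComplexGaussianMatrix X₂ S P)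
    (hX : IndepFun (fun ω (i : Fin m₁) (j : Fin n) => X₁ ω i j)
      (fun ω (i : Fin m₂) (j : Fin n) => X₂ ω i j) P) :
    HasLaw (fun ω => whitened A (X₁ ω) (X₂ ω))
      (Measure.pi fun _ : Fin n => gaussVec (Fin m₁ ⊕ Fin m₂)) P := by
  have hAm : Measurable fun x : Fin n → ℂ => A *ᵥ x :=
    (LinearMap.continuous_of_finiteDimensional (Matrix.mulVecLin A)).measurable
  have hrow : ∀ m, Measurable fun (x : Fin m → Fin n → ℂ) r => A *ᵥ star (x r) := fun m =>
    measurable_pi_lambda _ fun r => hAm.comp (continuous_star.measurable.comp (measurable_pi_apply r))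
  have h1 := hX₁.hasLaw_whitened_rows hS hA hSA
  have h2 := hX₂.hasLaw_whitened_rows hS hA hSA
  have hind : IndepFun (fun ω r => A *ᵥ star (X₁ ω r)) (fun ω r => A *ᵥ star (X₂ ω r)) P :=
    hX.comp (hrow m₁) (hrow m₂)
  have hpair := hind.map_prod_eq_prod_map_map h1.aemeasurable h2.aemeasurable
  rw [h1.map_eq, h2.map_eq] at hpair
  have hsum := measurePreserving_sumPiEquivProdPi_symm
    (fun _ : Fin m₁ ⊕ Fin m₂ => gaussVec (Fin n))
  have htr := (measurePreserving_transpose (Fin m₁ ⊕ Fin m₂) (Fin n) stdComplexGaussian).comp hsum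
  have hae := h1.aemeasurable.prodMk h2.aemeasurable
  have heq : (fun ω => whitened A (X₁ ω) (X₂ ω)) =
      ((fun (x : Fin m₁ ⊕ Fin m₂ → Fin n → ℂ) j i => x i j) ∘
        ⇑(MeasurableEquiv.sumPiEquivProdPi fun _ : Fin m₁ ⊕ Fin m₂ => Fin n → ℂ).symm) ∘
        fun ω => (fun r => A *ᵥ star (X₁ ω r), fun r => A *ᵥ star (X₂ ω r)) := by
    funext ω j r
    rcases r with r | r <;> rfl
  rw [heq]
  refine ⟨htr.measurable.comp_aemeasurable hae, ?_⟩
  rw [← AEMeasurable.map_map_of_aemeasurable htr.measurable.aemeasurable hae, hpair]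
  exact htr.map_eq

/-- The smallest eigenvalue of the double Wishart matrix. -/
theorem smallestEigenvalue_law {Ω : Type*} [MeasurableSpace Ω] {P : Measure Ω}
    [IsProbabilityMeasure P] {n m₁ m₂ : ℕ} (hn : 0 < n) (hm₁ : n ≤ m₁) (hm₂ : n ≤ m₂)
    {S : Matrix (Fin n) (Fin n) ℂ} (hS : S.PosDef)
    {X₁ : Ω → Matrix (Fin m₁) (Fin n) ℂ} {X₂ : Ω → Matrix (Fin m₂) (Fin n) ℂ}
    (hX₁ : IsComplexGaussianMatrix X₁ S P) (hX₂ : IsComplexGaussianMatrix X₂ S P)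
    (hX : IndepFun (fun ω (i : Fin m₁) (j : Fin n) => X₁ ω i j)
      (fun ω (i : Fin m₂) (j : Fin n) => X₂ ω i j) P) :
    AEMeasurable (fun ω => smallestEigenvalue (doubleWishart (X₁ ω) (X₂ ω))) P ∧
    (∀ ξ : ℝ, 0 ≤ ξ → ξ < 1 →
      (P.map fun ω => smallestEigenvalue (doubleWishart (X₁ ω) (X₂ ω))).real (Set.Ioi ξ) =
        1 - legendreG n (m₁ - n) (m₂ - n) ξ) ∧
    (∀ t : ℝ,
      (P.map fun ω => smallestEigenvalue (doubleWishart (X₁ ω) (X₂ ω))) {t} = 0) ∧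
    ∀ᵐ ω ∂P, largestEigenvalue (doubleWishart (X₁ ω) (X₂ ω)) =
      1 - smallestEigenvalue (doubleWishart (X₂ ω) (X₁ ω)) := by
  obtain ⟨A, hA, hSA⟩ := exists_inv_eq_conjTranspose_mul hS
  have hlaw := hasLaw_whitened hS hA hSA hX₁ hX₂ hX
  obtain ⟨Φ, hΦ, hroots, htail, hatom⟩ := exists_gaussian_roots m₁ m₂ n hm₁ hm₂
  rw [← hlaw.map_eq] at hroots
  have hae := ae_of_ae_map hlaw.aemeasurable hroots
  have hext : ∀ᵐ ω ∂P,
      smallestEigenvalue (doubleWishart (X₁ ω) (X₂ ω)) =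
        Φ (whitened A (X₁ ω) (X₂ ω)) ⟨0, hn⟩ ∧
      largestEigenvalue (doubleWishart (X₁ ω) (X₂ ω)) =
        1 - smallestEigenvalue (doubleWishart (X₂ ω) (X₁ ω)) := by
    filter_upwards [hae] with ω hω
    exact (hω.2.of_pencilDet_eq (by positivity)
      fun p q => pencilDet_whitened A (X₁ ω) (X₂ ω) p q).extremeEigenvalues hω.1.1 hn
  have hΦ0 : Measurable fun Y => Φ Y ⟨0, hn⟩ := (measurable_pi_apply _).comp hΦ
  have hΦm : AEMeasurable (fun ω => Φ (whitened A (X₁ ω) (X₂ ω)) ⟨0, hn⟩) P :=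
    hΦ0.comp_aemeasurable hlaw.aemeasurable
  have hmap : (P.map fun ω => smallestEigenvalue (doubleWishart (X₁ ω) (X₂ ω))) =
      (Measure.pi fun _ : Fin n => gaussVec (Fin m₁ ⊕ Fin m₂)).map fun Y => Φ Y ⟨0, hn⟩ := by
    rw [Measure.map_congr (hext.mono fun ω h => h.1), ← hlaw.map_eq,
      AEMeasurable.map_map_of_aemeasurable hΦ0.aemeasurable hlaw.aemeasurable]
    rfl
  refine ⟨hΦm.congr (hext.mono fun ω h => h.1.symm), fun ξ h0 h1 => ?_, fun t => ?_,
    hext.mono fun ω h => h.2⟩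
  · rw [hmap, map_measureReal_apply hΦ0 measurableSet_Ioi, ← htail ξ h0 h1]
    refine measureReal_congr ?_
    rw [hlaw.map_eq] at hroots
    filter_upwards [hroots] with Y hY
    refine propext ⟨fun h i => ?_, fun h => h _⟩
    exact lt_of_lt_of_le h (hY.1.1.monotone (Fin.mk_le_of_le_val (Nat.zero_le _)))
  · rw [hmap, Measure.map_apply hΦ0 (measurableSet_singleton t)]
    exact hatom _ t

end

theorem theorem1 {Ω : Type*} [MeasurableSpace Ω] (P : Measure Ω) [IsProbabilityMeasure P]
    (n m₁ m₂ : ℕ) (hn : 1 ≤ n) (hm₁ : n ≤ m₁) (hm₂ : n ≤ m₂)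
    (S : Matrix (Fin n) (Fin n) ℂ) (hS : S.PosDef)
    (X₁ : Ω → Matrix (Fin m₁) (Fin n) ℂ) (X₂ : Ω → Matrix (Fin m₂) (Fin n) ℂ)
    (hX₁ : IsComplexGaussianMatrix X₁ S P) (hX₂ : IsComplexGaussianMatrix X₂ S P)
    (hX : IndepFun (fun ω (i : Fin m₁) (j : Fin n) => X₁ ω i j)
      (fun ω (i : Fin m₂) (j : Fin n) => X₂ ω i j) P) :
    (∀ ξ : ℝ, 0 ≤ ξ → ξ < 1 →
      cdf (P.map fun ω => smallestEigenvalue (doubleWishart (X₁ ω) (X₂ ω))) ξ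
        = legendreG n (m₁ - n) (m₂ - n) ξ) ∧
    (∀ ξ : ℝ, 0 < ξ → ξ ≤ 1 →
      cdf (P.map fun ω => largestEigenvalue (doubleWishart (X₁ ω) (X₂ ω))) ξ
        = 1 - legendreG n (m₂ - n) (m₁ - n) (1 - ξ)) := by
  obtain ⟨hm, htail, -, hlarge⟩ := smallestEigenvalue_law hn hm₁ hm₂ hS hX₁ hX₂ hX
  obtain ⟨hm', htail', hatom', -⟩ := smallestEigenvalue_law hn hm₂ hm₁ hS hX₂ hX₁ hX.symm
  refine ⟨fun ξ h0 h1 => ?_, fun ξ h0 h1 => ?_⟩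
  · have := Measure.isProbabilityMeasure_map hm
    rw [cdf_eq_real, ← Set.compl_Ioi, probReal_compl_eq_one_sub measurableSet_Ioi, htail ξ h0 h1,
      sub_sub_cancel]
  · have := Measure.isProbabilityMeasure_map hm'
    have hsub : Measurable fun x : ℝ => 1 - x := measurable_const.sub measurable_id
    have hmap : (P.map fun ω => largestEigenvalue (doubleWishart (X₁ ω) (X₂ ω))) =
        (P.map fun ω => smallestEigenvalue (doubleWishart (X₂ ω) (X₁ ω))).map fun x => 1 - x := by
      rw [Measure.map_congr hlarge,
        AEMeasurable.map_map_of_aemeasurable hsub.aemeasurable hm']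
      rfl
    have hpre : (fun x : ℝ => 1 - x) ⁻¹' Set.Iic ξ = Set.Ici (1 - ξ) := by
      ext x
      simp only [Set.mem_preimage, Set.mem_Iic, Set.mem_Ici]
      constructor <;> intro h <;> linarith
    have := Measure.isProbabilityMeasure_map (μ := P.map fun ω =>
      smallestEigenvalue (doubleWishart (X₂ ω) (X₁ ω))) hsub.aemeasurable
    rw [hmap, cdf_eq_real, map_measureReal_apply hsub measurableSet_Iic, hpre,
      ← htail' (1 - ξ) (by linarith) (by linarith)]
    refine measureReal_congr ?_
    -- Reflection turns `≤ ξ` into `≥ 1 - ξ`, while the tail formula is for `> 1 - ξ`; the absence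
    -- of atoms closes the gap.
    have hne : ∀ᵐ x ∂(P.map fun ω => smallestEigenvalue (doubleWishart (X₂ ω) (X₁ ω))),
        x ≠ 1 - ξ := by
      rw [ae_iff]
      simpa using hatom' (1 - ξ)
    filter_upwards [hne] with x hx
    exact propext ⟨fun h => lt_of_le_of_ne h hx.symm, fun h => le_of_lt h⟩
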